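/- All varieties are over $\mathbb{C}$. A fibration of genus $g$ is a surjective morphism $f\colon S\to B$ with connected fibers from a smooth projective surface to a smooth projective curve whose general fiber is a smooth projective curve of genus $g$; it is relatively minimal if no $(-1)$-curve (a smooth rational curve with self-intersection number $-1$) is contained in a fiber. Let $n\ge 2$ and $g\ge 2$. Let $f\colon S\to B$ be a primitive cyclic covering fibration of type $(g,0,n)$, that is: $f$ is a relatively minimal fibration of genus $g$, and there are a fibration $\widetilde{\varphi}\colon\widetilde{W}\to B$ of genus $0$, a divisor class $\widetilde{\mathfrak d}\in\mathrm{Pic}(\widetilde{W})$, a smooth curve $\widetilde{R}\in|n\widetilde{\mathfrak d}|$ and the classical $n$-cyclic covering $$\widetilde{\theta}\colon\widetilde{S}=\mathrm{Spec}_{\widetilde{W}}\Bigl(\bigoplus_{j=0}^{n-1}\mathcal{O}_{\widetilde{W}}(-j\widetilde{\mathfrak d})\Bigr)\to\widetilde{W}$$ branched over $\widetilde{R}$ (the algebra structure is given by multiplication with the section of $\mathcal{O}_{\widetilde{W}}(n\widetilde{\mathfrak d})$ defining $\widetilde{R}$), such that $\widetilde{\varphi}\circ\widetilde{\theta}\colon\widetilde{S}\to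 B$ is a fibration with relatively minimal model $f$. Put $r=\widetilde{R}\cdot\widetilde{\Gamma}$, where $\widetilde{\Gamma}$ is a general fiber of $\widetilde{\varphi}$. If $r\ge 2n$, then the gonality of $f$ is $n$; that is, for all closed points $b$ of some nonempty Zariski open subset of $B$, the fiber $F=f^{-1}(b)$ is a smooth projective curve of gonality exactly $n$, i.e. the minimum of the degrees of surjective morphisms $F\to\mathbb{P}^1$ is $n$. -/

import Mathlib

open CategoryTheory CategoryTheory.Limits AlgebraicGeometry TopologicalSpace

noncomputable section

namespace CyclicFibration

/-! ### Sections as complex vector spaces, projective varieties -/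

/-- The point `Spec ℂ`. A complex scheme is a scheme `X` with a morphism `p : X ⟶ SpecC`. -/
abbrev SpecC : Scheme.{0} := Spec (CommRingCat.of ℂ)

/-- Restriction of regular functions to a smaller open set. -/
def restrict {X : Scheme.{0}} {U V : X.Opens} (h : V ≤ U) : Γ(X, U) →+* Γ(X, V) :=
  (X.presheaf.map (homOfLE h).op).hom

/-- The constants `ℂ → Γ(X, U)` of a complex scheme. -/
def constants {X : Scheme.{0}} (p : X ⟶ SpecC) (U : X.Opens) : ℂ →+* Γ(X, U) :=
  (restrict (le_top : U ≤ ⊤)).comp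
    (p.appTop.hom.comp (Scheme.ΓSpecIso (CommRingCat.of ℂ)).inv.hom)

/-- `Γ(X, U)`, regarded as a `ℂ`-algebra through the structure morphism `p`. -/
def Sections {X : Scheme.{0}} (_p : X ⟶ SpecC) (U : X.Opens) : Type := Γ(X, U)

instance {X : Scheme.{0}} (p : X ⟶ SpecC) (U : X.Opens) : CommRing (Sections p U) :=
  inferInstanceAs (CommRing Γ(X, U))

instance {X : Scheme.{0}} (p : X ⟶ SpecC) (U : X.Opens) : Algebra ℂ (Sections p U) :=
  (constants p U).toAlgebra

/-- Restriction of regular functions, as a homomorphism of `ℂ`-algebras. -/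
def Sections.res {X : Scheme.{0}} (p : X ⟶ SpecC) {U V : X.Opens} (h : V ≤ U) :
    Sections p U →ₐ[ℂ] Sections p V :=
  { restrict h with
    commutes' := fun c => by
      change restrict h (restrict le_top _) = restrict le_top _
      simp only [restrict, ← CommRingCat.comp_apply, ← Functor.map_comp]
      rfl }

attribute [local instance] MvPolynomial.gradedAlgebra

/-- Complex projective space `ℙ^N`. -/
def ProjSpace (N : ℕ) : Scheme.{0} :=
  Proj (MvPolynomial.homogeneousSubmodule (Fin (N + 1)) ℂ)

/-- The structure morphism of `ℙ^N`. -/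
def ProjSpace.toSpecC (N : ℕ) : ProjSpace N ⟶ SpecC :=
  Proj.toSpecZero (MvPolynomial.homogeneousSubmodule (Fin (N + 1)) ℂ) ≫
    Spec.map (CommRingCat.ofHom
      (algebraMap ℂ (MvPolynomial.homogeneousSubmodule (Fin (N + 1)) ℂ 0)))

/-- A complex scheme is projective if it is a closed subscheme of some `ℙ^N`. -/
def IsProjective {X : Scheme.{0}} (p : X ⟶ SpecC) : Prop :=
  ∃ (N : ℕ) (i : X ⟶ ProjSpace N), IsClosedImmersion i ∧ i ≫ ProjSpace.toSpecC N = p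

/-- A smooth projective variety of dimension `d` over `ℂ`
(a curve for `d = 1`, a surface for `d = 2`). -/
structure IsSmoothProjectiveVariety (d : ℕ) {X : Scheme.{0}} (p : X ⟶ SpecC) : Prop where
  integral : IsIntegral X
  smooth : SmoothOfRelativeDimension d p
  projective : IsProjective p

/-! ### Cohomology of the structure sheaf of a projective curve

A projective scheme of dimension at most one is the union of two affine open subsets `U`, `V`, and
the cohomology of its structure sheaf is that of the Čech complex
`Γ(U) × Γ(V) → Γ(U ∩ V)`, for every choice of `U` and `V`. -/

/-- The Čech cohomology group `H¹({U, V}, 𝒪_X) = Γ(U ∩ V) / (Γ(U) + Γ(V))`. -/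
abbrev CechH1 {X : Scheme.{0}} (p : X ⟶ SpecC) (U V : X.Opens) : Type :=
  Sections p (U ⊓ V) ⧸
    (LinearMap.range (Sections.res p (inf_le_left : U ⊓ V ≤ U)).toLinearMap ⊔
      LinearMap.range (Sections.res p (inf_le_right : U ⊓ V ≤ V)).toLinearMap)

/-- The curve `X` has (arithmetic) genus `g = dim H¹(X, 𝒪_X)`. -/
def HasGenus {X : Scheme.{0}} (p : X ⟶ SpecC) (g : ℕ) : Prop :=
  ∃ U V : X.Opens, IsAffineOpen U ∧ IsAffineOpen V ∧ U ⊔ V = ⊤ ∧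
    Module.Finite ℂ (CechH1 p U V) ∧ Module.finrank ℂ (CechH1 p U V) = g

/-- The (possibly non-reduced) projective curve `X` has Euler characteristic
`e = dim H⁰(X, 𝒪_X) - dim H¹(X, 𝒪_X)`. -/
def HasEulerChar {X : Scheme.{0}} (p : X ⟶ SpecC) (e : ℤ) : Prop :=
  ∃ U V : X.Opens, IsAffineOpen U ∧ IsAffineOpen V ∧ U ⊔ V = ⊤ ∧
    Module.Finite ℂ (Sections p ⊤) ∧ Module.Finite ℂ (CechH1 p U V) ∧
    (Module.finrank ℂ (Sections p ⊤) : ℤ) - Module.finrank ℂ (CechH1 p U V) = e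

/-! ### Degree and gonality -/

/-- The degree `[K(X) : K(Y)]` of a dominant morphism of integral schemes `φ : X ⟶ Y`; the local
ring of `Y` at the image of the generic point of `X` is then the function field of `Y`. -/
def degree {X Y : Scheme.{0}} [IrreducibleSpace X] (φ : X ⟶ Y) : ℕ :=
  letI := (φ.stalkMap (genericPoint X)).hom.toAlgebra
  Module.finrank (Y.presheaf.stalk (φ (genericPoint X))) (X.presheaf.stalk (genericPoint X))

/-- The complex curve `C` is integral, and `n` is its gonality, the minimum of the degrees of
surjective morphisms from `C` to `ℙ¹`. -/
def HasGonality {C : Scheme.{0}} (p : C ⟶ SpecC) (n : ℕ) : Prop :=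
  ∃ _ : IsIntegral C,
    IsLeast {d : ℕ | ∃ φ : C ⟶ ProjSpace 1,
      φ ≫ ProjSpace.toSpecC 1 = p ∧ Surjective φ ∧ degree φ = d} n

/-! ### Fibrations -/

/-- The closed (that is, complex) points of a complex variety. -/
def ClosedPt {B : Scheme.{0}} (pB : B ⟶ SpecC) : Type :=
  {b : SpecC ⟶ B // b ≫ pB = 𝟙 SpecC}

/-- The closed point `b` lies in the open set `U`. -/
def ClosedPt.MemOpen {B : Scheme.{0}} {pB : B ⟶ SpecC} (b : ClosedPt pB) (U : B.Opens) : Prop :=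
  Set.range b.1 ⊆ (U : Set B)

/-- The fiber of `f` over the closed point `b`. -/
abbrev fiber {S B : Scheme.{0}} (f : S ⟶ B) {pB : B ⟶ SpecC} (b : ClosedPt pB) : Scheme.{0} :=
  pullback f b.1

/-- The structure morphism of the fiber of `f` over `b`. -/
abbrev fiberToSpecC {S B : Scheme.{0}} (f : S ⟶ B) {pB : B ⟶ SpecC} (b : ClosedPt pB) :
    fiber f b ⟶ SpecC :=
  pullback.snd f b.1

/-- `P` holds for a general closed point of `B`: for all closed points of some nonempty (Zariski)
open subset. -/
def ForGeneral {B : Scheme.{0}} (pB : B ⟶ SpecC) (P : ClosedPt pB → Prop) : Prop :=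
  ∃ U : B.Opens, (U : Set B).Nonempty ∧ ∀ b : ClosedPt pB, b.MemOpen U → P b

/-- A fibration (fibered surface): a surjective morphism with connected fibers from a smooth
projective surface `S` to a smooth projective curve `B`. The complex structure of `S` is the
one induced by `f`. -/
structure IsFibration {S B : Scheme.{0}} (pB : B ⟶ SpecC) (f : S ⟶ B) : Prop where
  surface : IsSmoothProjectiveVariety 2 (f ≫ pB)
  curve : IsSmoothProjectiveVariety 1 pB
  surjective : Surjective f
  connected : ∀ b : ClosedPt pB, ConnectedSpace (fiber f b)

/-- A fibration of genus `g`: the general fiber is a smooth projective curve of genus `g`. -/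
structure IsFibrationOfGenus {S B : Scheme.{0}} (pB : B ⟶ SpecC) (f : S ⟶ B) (g : ℕ) : Prop
    extends IsFibration pB f where
  genus : ForGeneral pB fun b =>
    IsSmoothProjectiveVariety 1 (fiberToSpecC f b) ∧ HasGenus (fiberToSpecC f b) g

/-- The curve (effective divisor) `E` with ideal sheaf `I` on the complex surface `S` has
self-intersection number `m`. By bilinearity of Euler characteristics the number
`E · E = χ(𝒪_S) - 2 χ(𝒪_S(-E)) + χ(𝒪_S(-2E))` is `2 χ(𝒪_E) - χ(𝒪_{2E})`. -/
def HasSelfIntersection {S : Scheme.{0}} (p : S ⟶ SpecC) (I : S.IdealSheafData) (m : ℤ) : Prop :=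
  ∃ e₁ e₂ : ℤ, HasEulerChar (I.subschemeι ≫ p) e₁ ∧
    HasEulerChar ((I ^ 2).subschemeι ≫ p) e₂ ∧ m = 2 * e₁ - e₂

/-- A `(-1)`-curve: a curve isomorphic to `ℙ¹` with self-intersection number `-1`. -/
def IsMinusOneCurve {S : Scheme.{0}} (p : S ⟶ SpecC) (I : S.IdealSheafData) : Prop :=
  (∃ e : I.subscheme ≅ ProjSpace 1, e.hom ≫ ProjSpace.toSpecC 1 = I.subschemeι ≫ p) ∧
    HasSelfIntersection p I (-1)

/-- `f` is relatively minimal: no `(-1)`-curve is contained in a fiber of `f`. -/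
def IsRelativelyMinimal {S B : Scheme.{0}} (pB : B ⟶ SpecC) (f : S ⟶ B) : Prop :=
  ¬ ∃ I : S.IdealSheafData, IsMinusOneCurve (f ≫ pB) I ∧
    ∃ b : B, ∀ x ∈ I.support, f x = b

/-- A birational morphism between integral schemes: an isomorphism over a nonempty open set. -/
def IsBirationalMorphism {X Y : Scheme.{0}} (ρ : X ⟶ Y) : Prop :=
  ∃ V : Y.Opens, (V : Set Y).Nonempty ∧ IsIso (ρ ∣_ V)

/-! ### Line bundles and classical cyclic coverings -/

/-- A line bundle on `Y`, given by an affine open covering and transition functions. A section is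
a family `s i ∈ Γ(Y, U i)` with `s i = g i j * s j` on `U i ∩ U j`. -/
structure LineBundle (Y : Scheme.{0}) where
  ι : Type
  U : ι → Y.Opens
  isAffineOpen : ∀ i, IsAffineOpen (U i)
  cover : ⨆ i, U i = ⊤
  g : ∀ i j, (Γ(Y, U i ⊓ U j))ˣ
  cocycle : ∀ i j k,
    restrict (inf_le_left : U i ⊓ U j ⊓ U k ≤ U i ⊓ U j) (g i j : Γ(Y, U i ⊓ U j)) *
      restrict (le_inf (inf_le_left.trans inf_le_right) inf_le_right :
        U i ⊓ U j ⊓ U k ≤ U j ⊓ U k) (g j k : Γ(Y, U j ⊓ U k)) =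
    restrict (le_inf (inf_le_left.trans inf_le_left) inf_le_right :
        U i ⊓ U j ⊓ U k ≤ U i ⊓ U k) (g i k : Γ(Y, U i ⊓ U k))

/-- A global section of the `n`-th tensor power of `L`. -/
structure LineBundle.PowerSection {Y : Scheme.{0}} (L : LineBundle Y) (n : ℕ) where
  val : ∀ i, Γ(Y, L.U i)
  compat : ∀ i j, restrict (inf_le_left : L.U i ⊓ L.U j ≤ L.U i) (val i) =
    (L.g i j : Γ(Y, L.U i ⊓ L.U j)) ^ n *
      restrict (inf_le_right : L.U i ⊓ L.U j ≤ L.U j) (val j)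

/-- The section `s` defines the effective (Cartier) divisor `R`, given by its ideal sheaf:
`R ∈ |n𝔡|` if `L = 𝒪_Y(𝔡)`. -/
def LineBundle.PowerSection.Defines {Y : Scheme.{0}} {L : LineBundle Y} {n : ℕ}
    (s : L.PowerSection n) (R : Y.IdealSheafData) : Prop :=
  ∀ i, s.val i ∈ nonZeroDivisors Γ(Y, L.U i) ∧
    R.ideal ⟨L.U i, L.isAffineOpen i⟩ = Ideal.span {s.val i}

/-- `θ : Z ⟶ Y` is (isomorphic over `Y` to) the classical `n`-cyclic covering
`Spec_Y (⨁_{j < n} L⁻ʲ) ⟶ Y`, with multiplication `L⁻ⁿ → 𝒪_Y` given by `s ∈ H⁰(Y, Lⁿ)`.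
Over `U i` the algebra is free with basis `1, z, …, z ^ (n - 1)` and `z ^ n = s i`, where `z = z i`
is the generator of `L⁻¹` dual to that of `L`; the `z i` form the tautological section of the
pullback of `L` to `Z`. -/
structure IsClassicalCyclicCovering {Z Y : Scheme.{0}} (θ : Z ⟶ Y) (L : LineBundle Y) (n : ℕ)
    (s : L.PowerSection n) : Prop where
  isAffineHom : IsAffineHom θ
  exists_coordinate : ∃ z : ∀ i, Γ(Z, θ ⁻¹ᵁ L.U i),
    (∀ i j,
      restrict (θ.preimage_mono inf_le_left : θ ⁻¹ᵁ (L.U i ⊓ L.U j) ≤ θ ⁻¹ᵁ L.U i) (z i) =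
        (θ.app (L.U i ⊓ L.U j)).hom (L.g i j : Γ(Y, L.U i ⊓ L.U j)) *
          restrict (θ.preimage_mono inf_le_right : θ ⁻¹ᵁ (L.U i ⊓ L.U j) ≤ θ ⁻¹ᵁ L.U j) (z j)) ∧
    (∀ i, z i ^ n = (θ.app (L.U i)).hom (s.val i)) ∧
    ∀ i (w : Γ(Z, θ ⁻¹ᵁ L.U i)), ∃! a : Fin n → Γ(Y, L.U i),
      w = ∑ k : Fin n, (θ.app (L.U i)).hom (a k) * z i ^ (k : ℕ)

/-! ### Primitive cyclic covering fibrations -/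

/-- The data exhibiting `f : S ⟶ B` as a primitive cyclic covering fibration of type
`(g, h, n)`. -/
structure PrimitiveCyclicCovering {S B : Scheme.{0}} (pB : B ⟶ SpecC) (f : S ⟶ B)
    (g h n : ℕ) where
  two_le_g : 2 ≤ g
  two_le_n : 2 ≤ n
  /-- `f` is a relatively minimal fibration of genus `g`. -/
  isFibration : IsFibrationOfGenus pB f g
  relativelyMinimal : IsRelativelyMinimal pB f
  /-- The surface `W̃` with its fibration `φ̃ : W̃ ⟶ B` of genus `h`. -/
  W : Scheme.{0}
  φ : W ⟶ B
  isFibration_φ : IsFibrationOfGenus pB φ h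
  /-- The line bundle `𝒪(𝔡̃)`, the section of `𝒪(n𝔡̃)` and the smooth curve `R̃` it defines. -/
  d : LineBundle W
  s : d.PowerSection n
  R : W.IdealSheafData
  defines : s.Defines R
  smooth_R : SmoothOfRelativeDimension 1 (R.subschemeι ≫ φ ≫ pB)
  /-- The classical `n`-cyclic covering `θ̃ : S̃ ⟶ W̃` branched over `R̃`. -/
  Z : Scheme.{0}
  θ : Z ⟶ W
  isCyclic : IsClassicalCyclicCovering θ d n s
  /-- `f` is the relatively minimal model of the fibration `φ̃ ∘ θ̃`. -/
  isFibration_Z : IsFibrationOfGenus pB (θ ≫ φ) g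
  ρ : Z ⟶ S
  birational_ρ : IsBirationalMorphism ρ
  ρ_comp : ρ ≫ f = θ ≫ φ

/-- `r = R̃ · Γ̃` for a general fiber `Γ̃` of `φ̃`: the intersection `R̃ ∩ Γ̃` is finite and
`dim H⁰(𝒪_{R̃ ∩ Γ̃}) = r`. -/
def PrimitiveCyclicCovering.HasBranchNumber {S B : Scheme.{0}} {pB : B ⟶ SpecC} {f : S ⟶ B}
    {g h n : ℕ} (D : PrimitiveCyclicCovering pB f g h n) (r : ℕ) : Prop :=
  ForGeneral pB fun b =>
    let q : pullback D.R.subschemeι (pullback.fst D.φ b.1) ⟶ SpecC :=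
      pullback.snd D.R.subschemeι (pullback.fst D.φ b.1) ≫ fiberToSpecC D.φ b
    IsFinite q ∧ Module.finrank ℂ (Sections q ⊤) = r

end CyclicFibration

end

/-! Reduction to function fields. For general `b` the fiber of `φ̃` is a smooth projective curve of
genus zero, so its function field is `ℂ(x)` (`HasGenus.exists_adjoin_eq_top`). The classical
covering restricts to an `n`-cyclic covering of this curve. Since `ρ` is an isomorphism over a
nonempty open subset of `S`, which meets the general fiber, the fiber `F` of `f` has the same
function field `K` as the covering curve. Surjective morphisms `F → ℙ¹` correspond to transcendental
`u ∈ K`, and the degree is `[K : ℂ(u)]` (`exists_transcendental_of_surjective`,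
`exists_surjective_of_transcendental`). The gonality is therefore the minimum of `[K : ℂ(u)]`. The
function `x` attains `n`, and the problem is the lower bound.

Equation. Given `u`, the coordinate `x` is chosen so that the covering is unbranched over `x = ∞`
and `u` has no pole there. If `d` is the degree of the line bundle on the rational curve, then `K`
is given by `y ^ n = p(x)` with `deg p = n * d`. The subscheme `R̃ ∩ Γ̃` has length at most `deg p`
(`finrank_sections_le_natDegree`), so `r ≥ 2n` gives `d ≥ 2`. Writing `u = ∑ c_j y ^ j`, regularity
at infinity gives `deg c_j ≤ -d * j ≤ -2 * j`.

Lower bound (`le_finrank_of_superelliptic`). Suppose `[K : ℂ(u)] ≤ n - 1`. Let `A = ℂ[x, y]` and let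
`I` be the ideal of all `h ∈ A` with `h * u ∈ A`. Its codimension is at most the degree of the
divisor of poles of `u`, hence at most `n - 1` (`card_le_finrank_of_linearIndependent`).
Consequently polynomials of total degree at most `n - 2` in `x` and `y` represent all of `A / I`
(`le_pow_sup_of_card_le`). For such a polynomial `h` the coefficient of `y ^ (n - 1)` in `h * u` has
degree at most `-2`, and for `h ∈ I` it is a polynomial. So for every `h ∈ A` this coefficient has
no term `x⁻¹` at infinity. Taking `h = x ^ i * y ^ (n - 1 - j)` shows that `x ^ i * c_j` has no such
term for any `i`, hence every `c_j` is a polynomial. The degree bounds leave only a constant `c_0`,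
contradicting transcendence.

Classically this is Riemann–Roch: since `d ≥ 2`, the forms `x ^ i * y ^ j dx / y ^ (n - 1)` with `i
+ j ≤ n - 2` are regular differentials. They impose independent conditions on any `n - 1` points, so
no divisor of degree at most `n - 1` moves. The coefficient of `x⁻¹` above is the residue pairing.
-/

open CategoryTheory CategoryTheory.Limits AlgebraicGeometry TopologicalSpace

noncomputable section

namespace CyclicFibration

section

open Polynomial

/-! ### Pole ideals and degrees of functions -/

/-- The elements `h` of `A` such that `h * u` lies in `A`. -/
def poleSubmodule {k K : Type*} [Field k] [Field K] [Algebra k K] (A : Subalgebra k K) (u : K) :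
    Submodule k K :=
  Subalgebra.toSubmodule A ⊓ (Subalgebra.toSubmodule A).comap (LinearMap.mulRight k u)

theorem mem_poleSubmodule {k K : Type*} [Field k] [Field K] [Algebra k K] {A : Subalgebra k K}
    {u h : K} : h ∈ poleSubmodule A u ↔ h ∈ A ∧ h * u ∈ A := by
  simp [poleSubmodule]

/-- `A` contains comaximal denominators for `u` and `u⁻¹`: locally on `Spec A`, the rational
function `u` is a morphism to `ℙ¹`. -/
def HasComaximalDenominators {R K : Type*} [CommSemiring R] [Field K] [Algebra R K]
    (A : Subalgebra R K) (u : K) : Prop :=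
  ∃ a b : K, a ∈ A ∧ b ∈ A ∧ a + b = 1 ∧ a * u ∈ A ∧ b * u⁻¹ ∈ A

/-- Where `u` is regular, so is `h * u`; where `u⁻¹` is regular, the right-hand side of `e` is
regular. A power of `b` clears all powers of `u⁻¹`, and that power and `a` still generate the unit
ideal. -/
theorem mul_mem_of_hasComaximalDenominators {k K : Type*} [Field k] [Field K] [Algebra k K]
    {A : Subalgebra k K} {u : K} (hA : HasComaximalDenominators A u) {h : K} (hh : h ∈ A)
    {ι : Type*} [Fintype ι] (p : ι → k[X]) (f : ι → K) (hf : ∀ i, f i ∈ A)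
    (e : h * u = ∑ i, aeval u⁻¹ (p i) * f i) : h * u ∈ A := by
  obtain ⟨a, b, ha, hb, hab, hau, hbu⟩ := hA
  have key : ∀ q : k[X], ∀ N, q.natDegree ≤ N → b ^ N * aeval u⁻¹ q ∈ A := by
    intro q N hN
    rw [aeval_eq_sum_range, Finset.mul_sum]
    refine sum_mem fun j hj => ?_
    have hj' : j ≤ N := by simp at hj; omega
    obtain ⟨c, rfl⟩ := Nat.exists_eq_add_of_le hj'
    have : b ^ (j + c) * q.coeff j • u⁻¹ ^ j = q.coeff j • ((b * u⁻¹) ^ j * b ^ c) := by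
      rw [mul_smul_comm]; congr 1; ring
    rw [this]
    exact A.smul_mem (A.mul_mem (pow_mem hbu _) (pow_mem hb _)) _
  set N := Finset.univ.sup fun i => (p i).natDegree
  have h1 : b ^ N * (h * u) ∈ A := by
    rw [e, Finset.mul_sum]
    refine sum_mem fun i _ => ?_
    rw [← mul_assoc]
    exact A.mul_mem (key _ _ (Finset.le_sup (f := fun i => (p i).natDegree) (Finset.mem_univ i)))
      (hf i)
  have h2 : a * (h * u) ∈ A := by
    rw [mul_left_comm]; exact A.mul_mem hh hau
  obtain ⟨c, hc, hcA⟩ : ∃ c, 1 - b ^ N = c * a ∧ c ∈ A := by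
    refine ⟨∑ i ∈ Finset.range N, b ^ i, ?_, sum_mem fun i _ => pow_mem hb _⟩
    have := geom_sum_mul b N
    have ha' : a = 1 - b := by rw [← hab]; ring
    rw [ha']; linear_combination this
  have : h * u = b ^ N * (h * u) + c * (a * (h * u)) := by
    rw [← mul_assoc c, ← hc]; ring
  rw [this]
  exact A.add_mem h1 (A.mul_mem hcA h2)

/-- A relation over `k[u⁻¹]` may be divided by the gcd of its coefficients, after which some
constant term is nonzero. The combination `h` of the `f i` with these constant terms is `u⁻¹` times
a combination over `k[u⁻¹]`, so `h * u ∈ A`. This is a nontrivial relation modulo the pole ideal. -/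
theorem linearIndependent_adjoin_inv {k K : Type*} [Field k] [Field K] [Algebra k K]
    {A : Subalgebra k K} {u : K} (hu : Transcendental k u) (hA : HasComaximalDenominators A u)
    {ι : Type*} [Fintype ι] (f : ι → K) (hf : ∀ i, f i ∈ A)
    (hli : LinearIndependent k ((poleSubmodule A u).mkQ ∘ f)) :
    LinearIndependent (Algebra.adjoin k {u⁻¹}) f := by
  classical
  have hu0 : u ≠ 0 := fun h => hu (h ▸ isAlgebraic_zero)
  rw [Fintype.linearIndependent_iff]
  intro g hg
  have : ∀ i, ∃ p : k[X], aeval u⁻¹ p = (g i : K) := fun i => by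
    have : (g i : K) ∈ (aeval (R := k) u⁻¹).range :=
      Algebra.adjoin_singleton_eq_range_aeval k u⁻¹ ▸ (g i).2
    exact this
  choose p hp using this
  by_contra! hne
  obtain ⟨i₀, hi₀⟩ := hne
  have hp0 : p i₀ ≠ 0 := by
    intro h0
    apply hi₀
    apply Subtype.ext
    rw [← hp, h0]; simp
  obtain ⟨p', hp', hgcd⟩ := Finset.extract_gcd p (s := Finset.univ) ⟨i₀, Finset.mem_univ _⟩
  set d := Finset.univ.gcd p
  have hd0 : d ≠ 0 := by
    intro h
    apply hp0
    rw [hp' i₀ (Finset.mem_univ _), h, zero_mul]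
  have hd : aeval u⁻¹ d ≠ 0 := by
    intro h
    exact hu ((IsAlgebraic.inv_iff).mp ⟨d, hd0, h⟩)
  have hsum : ∑ i, aeval u⁻¹ (p' i) * f i = 0 := by
    have : aeval u⁻¹ d * ∑ i, aeval u⁻¹ (p' i) * f i = 0 := by
      rw [Finset.mul_sum, ← hg]
      refine Finset.sum_congr rfl fun i _ => ?_
      rw [Subalgebra.smul_def, smul_eq_mul, ← hp i, hp' i (Finset.mem_univ _), map_mul, mul_assoc]
    exact (mul_eq_zero.mp this).resolve_left hd
  have hX : ∃ i, (p' i).coeff 0 ≠ 0 := by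
    by_contra! h
    have : (X : k[X]) ∣ Finset.univ.gcd p' := Finset.dvd_gcd fun i _ => X_dvd_iff.mpr (h i)
    rw [hgcd] at this
    exact not_isUnit_X (isUnit_of_dvd_one this)
  obtain ⟨i₁, hi₁⟩ := hX
  set h : K := ∑ i, (p' i).coeff 0 • f i
  have hhA : h ∈ A := sum_mem fun i _ => A.smul_mem (hf i) _
  have hhu : h * u = ∑ i, aeval u⁻¹ (-(p' i).divX) * f i := by
    have e : ∀ i, aeval u⁻¹ (p' i) * f i =
        u⁻¹ * (aeval u⁻¹ (p' i).divX * f i) + (p' i).coeff 0 • f i := by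
      intro i
      conv_lhs => rw [← divX_mul_X_add (p' i)]
      simp [Algebra.smul_def]; ring
    rw [Finset.sum_congr rfl fun i _ => e i, Finset.sum_add_distrib, ← Finset.mul_sum] at hsum
    have : h = -(u⁻¹ * ∑ i, aeval u⁻¹ (p' i).divX * f i) := by linear_combination hsum
    rw [this]
    simp only [map_neg, neg_mul, Finset.sum_neg_distrib]
    field_simp
  have hmem : h ∈ poleSubmodule A u := mem_poleSubmodule.mpr
    ⟨hhA, mul_mem_of_hasComaximalDenominators hA hhA _ f hf hhu⟩
  have h0 : ∑ i, (p' i).coeff 0 • ((poleSubmodule A u).mkQ ∘ f) i = 0 := by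
    have := (Submodule.Quotient.mk_eq_zero (poleSubmodule A u)).mpr hmem
    rw [← Submodule.mkQ_apply, map_sum] at this
    simpa using this
  exact hi₁ (Fintype.linearIndependent_iff.mp hli _ h0 i₁)

open scoped IntermediateField.algebraAdjoinAdjoin in
/-- The affine part of the divisor of poles of a function `u` has degree at most `[K : k(u)]`. -/
theorem card_le_finrank_of_linearIndependent {k K : Type*} [Field k] [Field K] [Algebra k K]
    {A : Subalgebra k K} {u : K} (hu : Transcendental k u) (hA : HasComaximalDenominators A u)
    [Module.Finite (IntermediateField.adjoin k {u}) K]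
    {ι : Type*} [Fintype ι] (f : ι → K) (hf : ∀ i, f i ∈ A)
    (hli : LinearIndependent k ((poleSubmodule A u).mkQ ∘ f)) :
    Fintype.card ι ≤ Module.finrank (IntermediateField.adjoin k {u}) K := by
  have h1 := linearIndependent_adjoin_inv hu hA f hf hli
  have e : IntermediateField.adjoin k {u⁻¹} = IntermediateField.adjoin k {u} := by
    apply le_antisymm <;> rw [IntermediateField.adjoin_simple_le_iff]
    · exact inv_mem (IntermediateField.mem_adjoin_simple_self k u)
    · have := inv_mem (IntermediateField.mem_adjoin_simple_self k u⁻¹)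
      rwa [inv_inv] at this
  rw [LinearIndependent.iff_fractionRing (Algebra.adjoin k {u⁻¹})
    (IntermediateField.adjoin k {u⁻¹}), e] at h1
  exact h1.fintype_card_le_finrank

/-- In a quotient of dimension at most `m + 1`, the powers of a generating subspace `W` exhaust
the algebra at the `m`-th step. -/
theorem le_pow_sup_of_card_le {k K : Type*} [Field k] [Field K] [Algebra k K]
    (A W I : Submodule k K) [Module.Finite k W] (h1 : 1 ≤ W) (hI : W * I ≤ I)
    (hWA : ∀ m, W ^ m ≤ A) (hAW : ∀ f ∈ A, ∃ m, f ∈ W ^ m) (m : ℕ) (hI1 : (1 : K) ∉ I)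
    (hcard : ∀ f : Fin (m + 2) → K, (∀ i, f i ∈ A) → ¬ LinearIndependent k (I.mkQ ∘ f)) :
    A ≤ W ^ m ⊔ I := by
  have hfin : ∀ j, Module.Finite k ↥((W ^ j).map I.mkQ) := fun j => by
    have : (W ^ j).FG := Submodule.FG.pow (Module.Finite.iff_fg.mp inferInstance) j
    exact Module.Finite.iff_fg.mpr (this.map _)
  have hmono : Monotone fun j => W ^ j := monotone_nat_of_le_succ fun j => by
    rw [pow_succ]
    calc W ^ j = W ^ j * 1 := (mul_one _).symm
      _ ≤ W ^ j * W := mul_le_mul' le_rfl h1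
  -- The images of `W ^ 0, …, W ^ (m + 1)` in the quotient cannot grow strictly at each step: the
  -- first has dimension at least one, so the last would have dimension at least `m + 2`.
  obtain ⟨j, hj, hstab⟩ : ∃ j ≤ m, (W ^ (j + 1)).map I.mkQ = (W ^ j).map I.mkQ := by
    by_contra! hne
    have hlt : ∀ j ≤ m + 1, j + 1 ≤ Module.finrank k ((W ^ j).map I.mkQ) := by
      intro j
      induction j with
      | zero =>
        intro _
        rw [zero_add, Nat.one_le_iff_ne_zero, ← pos_iff_ne_zero, Module.finrank_pos_iff]
        refine ⟨⟨⟨I.mkQ 1, 1, by simp, rfl⟩, 0, fun h => hI1 ?_⟩⟩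
        have := congrArg Subtype.val h
        simpa using this
      | succ j ih =>
        intro hj
        refine Nat.succ_le_of_lt (lt_of_le_of_lt (ih (by omega)) ?_)
        exact Submodule.finrank_lt_finrank_of_lt
          (lt_of_le_of_ne (Submodule.map_mono (hmono (Nat.le_succ j))) (hne j (by omega)).symm)
    obtain ⟨g, hg⟩ := exists_linearIndependent_of_le_finrank (hlt (m + 1) le_rfl)
    have : ∀ i, ∃ f ∈ W ^ (m + 1), I.mkQ f = (g i : K ⧸ I) := fun i => (g i).2
    choose f hf hfg using this
    refine hcard f (fun i => hWA _ (hf i)) ?_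
    have e : I.mkQ ∘ f = ((W ^ (m + 1)).map I.mkQ).subtype ∘ g := by
      funext i; simp [← hfg]
    rw [e]
    exact hg.map' _ (Submodule.ker_subtype _)
  have hle : W ^ (j + 1) ≤ W ^ j ⊔ I := by
    rw [sup_comm, ← Submodule.ker_mkQ I, ← Submodule.comap_map_eq_self (f := I.mkQ)
      (p := I.mkQ.ker ⊔ W ^ j) le_sup_left, ← Submodule.map_le_iff_le_comap, hstab]
    exact Submodule.map_mono le_sup_right
  -- Since `I` is stable under multiplication by `W`, one coincidence of consecutive powers modulo
  -- `I` propagates to all later powers.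
  have hall : ∀ i, W ^ (j + i) ≤ W ^ j ⊔ I := by
    intro i
    induction i with
    | zero => exact le_sup_left
    | succ i ih =>
      rw [← add_assoc, pow_succ']
      refine (mul_le_mul' le_rfl ih).trans ?_
      rw [Submodule.mul_sup, ← pow_succ']
      exact sup_le hle (hI.trans le_sup_right)
  intro f hf
  obtain ⟨i, hi⟩ := hAW f hf
  have := hall i (hmono (Nat.le_add_left i j) hi)
  exact sup_le_sup_right (hmono hj) I this

end

section

open Polynomial

/-! ### Functions on a superelliptic curve -/

/-- Rational functions of degree at most `d`. -/
def degLE (k : Type*) [Field k] (d : ℤ) : Submodule k (RatFunc k) where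
  carrier := {f | f = 0 ∨ f.intDegree ≤ d}
  zero_mem' := Or.inl rfl
  add_mem' := by
    intro a b ha hb
    by_cases hb0 : b = 0
    · simpa [hb0] using ha
    by_cases hab : a + b = 0
    · exact Or.inl hab
    by_cases ha0 : a = 0
    · simpa [ha0] using hb
    exact Or.inr ((RatFunc.intDegree_add_le hb0 hab).trans
      (max_le (ha.resolve_left ha0) (hb.resolve_left hb0)))
  smul_mem' := by
    intro c f hf
    by_cases hf0 : f = 0
    · simp [hf0]
    by_cases hc : c = 0
    · simp [hc]
    · right
      rw [RatFunc.smul_eq_C_mul, RatFunc.intDegree_mul (by simpa using hc) hf0]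
      simpa using hf.resolve_left hf0

theorem mem_degLE {k : Type*} [Field k] {d : ℤ} {f : RatFunc k} :
    f ∈ degLE k d ↔ f = 0 ∨ f.intDegree ≤ d := Iff.rfl

theorem mul_mem_degLE {k : Type*} [Field k] {d e : ℤ} {f g : RatFunc k} (hf : f ∈ degLE k d)
    (hg : g ∈ degLE k e) : f * g ∈ degLE k (d + e) := by
  by_cases hf0 : f = 0
  · simp [hf0]
  by_cases hg0 : g = 0
  · simp [hg0]
  right
  rw [RatFunc.intDegree_mul hf0 hg0]
  exact add_le_add (hf.resolve_left hf0) (hg.resolve_left hg0)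

theorem degLE_mono {k : Type*} [Field k] {d e : ℤ} (h : d ≤ e) : degLE k d ≤ degLE k e :=
  fun _ hf => hf.imp_right fun h' => h'.trans h

/-- The polynomials, as a subspace of the rational functions. -/
def polys (k : Type*) [Field k] : Submodule k (RatFunc k) :=
  LinearMap.range (Algebra.linearMap k[X] (RatFunc k) |>.restrictScalars k)

theorem mem_polys {k : Type*} [Field k] {f : RatFunc k} :
    f ∈ polys k ↔ ∃ p : k[X], algebraMap k[X] (RatFunc k) p = f := Iff.rfl

theorem eq_zero_of_mem_polys_of_mem_degLE {k : Type*} [Field k] {d : ℤ} {f : RatFunc k}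
    (hf : f ∈ polys k) (hd : f ∈ degLE k d) (hd0 : d < 0) : f = 0 := by
  obtain ⟨p, rfl⟩ := mem_polys.mp hf
  refine hd.resolve_right fun h => ?_
  rw [RatFunc.intDegree_polynomial] at h
  omega

/-- The residue at infinity detects polynomials. -/
theorem mem_polys_of_forall_X_pow_mul {k : Type*} [Field k] (f : RatFunc k)
    (h : ∀ i : ℕ, RatFunc.X ^ i * f ∈ polys k ⊔ degLE k (-2)) : f ∈ polys k := by
  obtain ⟨g, hg, e, he, hge⟩ := Submodule.mem_sup.mp (by simpa using h 0)
  by_cases he0 : e = 0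
  · rw [← hge, he0, add_zero]; exact hg
  exfalso
  have hed := he.resolve_left he0
  -- `X ^ i` moves the leading term of `e` to `X⁻¹`, a term found neither in a polynomial nor in a
  -- function of degree at most `-2`.
  obtain ⟨i, hi⟩ : ∃ i : ℕ, e.intDegree + i = -1 := ⟨(-1 - e.intDegree).toNat, by omega⟩
  have hX : (RatFunc.X : RatFunc k) ^ i = algebraMap k[X] (RatFunc k) (X ^ i) := by simp
  have hXd : ((RatFunc.X : RatFunc k) ^ i).intDegree = i := by
    rw [hX, RatFunc.intDegree_polynomial, natDegree_X_pow]
  have hX0 : (RatFunc.X : RatFunc k) ^ i ≠ 0 := pow_ne_zero _ RatFunc.X_ne_zero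
  obtain ⟨g', hg', e', he', hge'⟩ := Submodule.mem_sup.mp (h i)
  have hXg : RatFunc.X ^ i * g ∈ polys k := by
    obtain ⟨p, rfl⟩ := mem_polys.mp hg
    exact mem_polys.mpr ⟨X ^ i * p, by simp⟩
  have hXe : (RatFunc.X ^ i * e).intDegree = -1 := by
    rw [RatFunc.intDegree_mul hX0 he0, hXd]; omega
  have h1 : RatFunc.X ^ i * e - e' ∈ polys k := by
    have : RatFunc.X ^ i * e - e' = g' - RatFunc.X ^ i * g := by
      rw [← hge, mul_add] at hge'
      linear_combination -hge'
    rw [this]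
    exact sub_mem hg' hXg
  have h2 : RatFunc.X ^ i * e - e' ∈ degLE k (-1) :=
    sub_mem (Or.inr hXe.le) (degLE_mono (by norm_num) he')
  have h3 := eq_zero_of_mem_polys_of_mem_degLE h1 h2 (by norm_num)
  rw [sub_eq_zero] at h3
  rcases he' with h0 | h0
  · rw [h0] at h3
    exact mul_ne_zero hX0 he0 h3
  · rw [← h3, hXe] at h0
    omega

/-- Multiplication by `y ^ (n - j)` carries `y ^ j` to the last basis element. An exponent exceeding
`n` is reduced by `y ^ (n + 1) = p` to one smaller than `n`, so no other term contributes. The last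
coordinate thus plays the part of a residue pairing that recovers each coefficient. -/
theorem coord_last_pow_mul {k K : Type*} [Field k] [Field K] [Algebra (RatFunc k) K] {n : ℕ}
    (B : Module.Basis (Fin (n + 1)) (RatFunc k) K) {y : K}
    {p : RatFunc k} (hB : ∀ j, B j = y ^ (j : ℕ)) (hy : y ^ (n + 1) = algebraMap (RatFunc k) K p)
    (c : Fin (n + 1) → RatFunc k) (j : Fin (n + 1)) :
    B.coord (Fin.last n) (y ^ (n - j : ℕ) * ∑ l, c l • y ^ (l : ℕ)) = c j := by
  have key : ∀ l : Fin (n + 1), B.coord (Fin.last n) (y ^ (n - j + l : ℕ)) =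
      if l = j then 1 else 0 := by
    intro l
    have hl := l.2
    have hj := j.2
    by_cases h : n - j + (l : ℕ) ≤ n
    · have : y ^ (n - j + l : ℕ) = B ⟨n - j + l, by omega⟩ := by rw [hB]
      rw [this, Module.Basis.coord_apply, Module.Basis.repr_self, Finsupp.single_apply]
      congr 1
      simp only [Fin.ext_iff, Fin.val_last, eq_iff_iff]
      omega
    · have : y ^ (n - j + l : ℕ) = p • B ⟨n - j + l - (n + 1), by omega⟩ := by
        rw [hB, Algebra.smul_def, ← hy, ← pow_add]
        congr 1; simp only; omega
      rw [this, map_smul, Module.Basis.coord_apply, Module.Basis.repr_self, Finsupp.single_apply,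
        if_neg, smul_zero, if_neg]
      · rintro rfl; omega
      · simp only [Fin.ext_iff, Fin.val_last]; omega
  rw [Finset.mul_sum, map_sum]
  simp_rw [mul_smul_comm, ← pow_add, map_smul, key]
  simp

section Superelliptic

variable {k K : Type*} [Field k] [Field K] [Algebra (RatFunc k) K] [Algebra k K]
  [IsScalarTower k (RatFunc k) K]

/-- The coordinate ring `k[x, y]` of the affine part of a superelliptic curve. -/
def coordRing (k : Type*) {K : Type*} [Field k] [Field K] [Algebra (RatFunc k) K] [Algebra k K]
    (y : K) : Subalgebra k K :=
  Algebra.adjoin k {algebraMap (RatFunc k) K RatFunc.X, y}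

theorem algebraMap_mem_coordRing (y : K) (p : k[X]) :
    algebraMap (RatFunc k) K (algebraMap k[X] (RatFunc k) p) ∈ coordRing k y := by
  have : algebraMap (RatFunc k) K (algebraMap k[X] (RatFunc k) p) =
      aeval (algebraMap (RatFunc k) K RatFunc.X) p := by
    rw [aeval_algebraMap_apply]
    simp [RatFunc.aeval_X_left_eq_algebraMap]
  rw [this]
  exact Algebra.adjoin_mono (by simp) (aeval_mem_adjoin_singleton k _)

/-- Division by the monic polynomial `Y ^ n - p(x)` reduces every polynomial expression in `x` and
`y` to degree less than `n` in `y`. -/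
theorem mem_coordRing_iff {n : ℕ} (hn : n ≠ 0) {y : K} {p : k[X]}
    (hy : y ^ n = algebraMap (RatFunc k) K (algebraMap k[X] (RatFunc k) p)) (f : K) :
    f ∈ coordRing k y ↔ ∃ c : Fin n → k[X],
      f = ∑ j, algebraMap k[X] (RatFunc k) (c j) • y ^ (j : ℕ) := by
  constructor
  · intro hf
    set φ : k[X] →+* K := (algebraMap (RatFunc k) K).comp (algebraMap k[X] (RatFunc k)) with hφ
    have hG : ∃ G : k[X][X], eval₂ φ y G = f := by
      induction hf using Algebra.adjoin_induction with
      | mem f hf =>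
        rcases hf with rfl | rfl
        · exact ⟨C X, by simp [hφ]⟩
        · exact ⟨X, by simp⟩
      | algebraMap r =>
        refine ⟨C (C r), ?_⟩
        rw [eval₂_C, hφ, RingHom.comp_apply, ← algebraMap_eq,
          ← IsScalarTower.algebraMap_apply k k[X] (RatFunc k),
          ← IsScalarTower.algebraMap_apply k (RatFunc k) K]
      | add f g _ _ hf hg =>
        obtain ⟨F, rfl⟩ := hf
        obtain ⟨G, rfl⟩ := hg
        exact ⟨F + G, eval₂_add _ _⟩
      | mul f g _ _ hf hg =>
        obtain ⟨F, rfl⟩ := hf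
        obtain ⟨G, rfl⟩ := hg
        exact ⟨F * G, eval₂_mul _ _⟩
    obtain ⟨G, rfl⟩ := hG
    have hm : (X ^ n - C p : k[X][X]).Monic := monic_X_pow_sub_C p hn
    have hroot : eval₂ φ y (X ^ n - C p) = 0 := by
      rw [eval₂_sub, eval₂_pow, eval₂_X, eval₂_C, hy, hφ, RingHom.comp_apply, sub_self]
    refine ⟨fun j => (G %ₘ (X ^ n - C p)).coeff j, ?_⟩
    rw [← eval₂_modByMonic_eq_self_of_root hroot, eval₂_eq_sum_range' φ (n := n),
      ← Fin.sum_univ_eq_sum_range (fun j => φ ((G %ₘ (X ^ n - C p)).coeff j) * y ^ j)]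
    · simp [Algebra.smul_def, hφ]
    · have := natDegree_modByMonic_lt G hm (by
        intro h
        have := congrArg natDegree h
        rw [natDegree_X_pow_sub_C, natDegree_one] at this
        exact hn this)
      rwa [natDegree_X_pow_sub_C] at this
  · rintro ⟨c, rfl⟩
    refine sum_mem fun j _ => ?_
    rw [Algebra.smul_def]
    exact mul_mem (algebraMap_mem_coordRing _ _)
      (pow_mem (Algebra.subset_adjoin (by simp)) _)

/-- The function field of a superelliptic curve `y ^ n = p(x)` whose functions of weight `0`
have coefficients decreasing quickly has gonality at least `n`. -/
theorem le_finrank_of_superelliptic {n : ℕ} (B : Module.Basis (Fin (n + 2)) (RatFunc k) K) {y : K}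
    {p : k[X]} (hB : ∀ j, B j = y ^ (j : ℕ))
    (hy : y ^ (n + 2) = algebraMap (RatFunc k) K (algebraMap k[X] (RatFunc k) p))
    {u : K} (hu : Transcendental k u) (c : Fin (n + 2) → RatFunc k)
    (hc : u = ∑ j, c j • y ^ (j : ℕ)) (hdeg : ∀ j : Fin (n + 2), c j ∈ degLE k (-2 * (j : ℕ)))
    [Module.Finite (IntermediateField.adjoin k {u}) K]
    (hA : HasComaximalDenominators (coordRing k y) u) :
    n + 2 ≤ Module.finrank (IntermediateField.adjoin k {u}) K := by
  -- The covering has degree `n + 2` here, so the assumption is that `u` has degree at most `n + 1`.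
  by_contra! hlt
  set x : K := algebraMap (RatFunc k) K RatFunc.X with hx
  have hxA : x ∈ coordRing k y := Algebra.subset_adjoin (by simp [hx])
  have hyA : y ∈ coordRing k y := Algebra.subset_adjoin (by simp)
  have hcoeff : ∀ f ∈ coordRing k y, ∀ l, B.coord l f ∈ polys k := by
    intro f hf l
    obtain ⟨d, rfl⟩ := (mem_coordRing_iff (by omega) hy f).mp hf
    simp_rw [← hB, map_sum, map_smul, Module.Basis.coord_apply, Module.Basis.repr_self]
    simp [Finsupp.single_apply, mem_polys]
  -- Elements of the coordinate ring have polynomial coefficients. The bounds `-2 * j` then kill all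
  -- of them but `c 0` and make that one a constant. The contradiction will come from showing that
  -- `u` does lie in the coordinate ring.
  have huA : u ∉ coordRing k y := by
    intro huA
    have hcp : ∀ j, c j ∈ polys k := by
      intro j
      have := hcoeff u huA j
      rw [hc] at this
      simp_rw [← hB, map_sum, map_smul, Module.Basis.coord_apply, Module.Basis.repr_self] at this
      simpa [Finsupp.single_apply] using this
    have h0 : ∀ j, j ≠ 0 → c j = 0 := by
      intro j hj
      refine eq_zero_of_mem_polys_of_mem_degLE (hcp j) (hdeg j) ?_
      have : 0 < (j : ℕ) := Nat.pos_of_ne_zero fun h => hj (Fin.ext h)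
      omega
    rw [Finset.sum_eq_single 0 (fun j _ hj => by rw [h0 j hj, zero_smul]) (by simp)] at hc
    obtain ⟨q, hq⟩ := mem_polys.mp (hcp 0)
    have hqd : q.natDegree = 0 := by
      by_cases hq0 : q = 0
      · simp [hq0]
      rcases hdeg 0 with h | h
      · rw [← hq] at h
        exact absurd ((map_eq_zero_iff _ (RatFunc.algebraMap_injective k)).mp h) hq0
      · rw [← hq, RatFunc.intDegree_polynomial] at h
        simpa using h
    rw [natDegree_eq_zero] at hqd
    obtain ⟨r, rfl⟩ := hqd
    apply hu
    have : u = algebraMap k K r := by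
      rw [hc, ← hq, Fin.val_zero, pow_zero, ← algebraMap_eq,
        ← IsScalarTower.algebraMap_apply k k[X] (RatFunc k), Algebra.smul_def, mul_one,
        ← IsScalarTower.algebraMap_apply k (RatFunc k) K]
    rw [this]
    exact isAlgebraic_algebraMap r
  set A := Subalgebra.toSubmodule (coordRing k y)
  set I := poleSubmodule (coordRing k y) u
  -- The power `W ^ m` consists of the polynomials of total degree at most `m`, with `x` and `y`
  -- both of weight one.
  set W : Submodule k K := Submodule.span k {1, x, y} with hW
  have hWA : W ≤ A := by
    rw [hW, Submodule.span_le]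
    rintro f (rfl | rfl | rfl)
    · exact one_mem (coordRing k y)
    · exact hxA
    · exact hyA
  have hWmA : ∀ m, W ^ m ≤ A := by
    intro m
    induction m with
    | zero =>
      rw [pow_zero, Submodule.one_le]
      exact one_mem (coordRing k y)
    | succ m ih =>
      rw [pow_succ, Submodule.mul_le]
      exact fun f hf g hg => mul_mem (S := Subalgebra k K) (ih hf) (hWA hg)
  have h1W : 1 ≤ W := by
    rw [Submodule.one_le]
    exact Submodule.subset_span (by simp)
  have hxW : x ∈ W := Submodule.subset_span (by simp)
  have hyW : y ∈ W := Submodule.subset_span (by simp)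
  have hmono : Monotone fun j => W ^ j := monotone_nat_of_le_succ fun j => by
    rw [pow_succ]
    calc W ^ j = W ^ j * 1 := (mul_one _).symm
      _ ≤ W ^ j * W := mul_le_mul' le_rfl h1W
  have hAW : ∀ f ∈ A, ∃ m, f ∈ W ^ m := by
    intro f hf
    change f ∈ Algebra.adjoin k {x, y} at hf
    induction hf using Algebra.adjoin_induction with
    | mem f hf =>
      refine ⟨1, ?_⟩
      rw [pow_one]
      rcases hf with rfl | rfl
      · exact hxW
      · exact hyW
    | algebraMap r =>
      refine ⟨0, ?_⟩
      rw [pow_zero]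
      exact Submodule.algebraMap_mem r
    | add f g _ _ hf hg =>
      obtain ⟨i, hi⟩ := hf
      obtain ⟨j, hj⟩ := hg
      exact ⟨i + j, add_mem (hmono (Nat.le_add_right i j) hi) (hmono (Nat.le_add_left j i) hj)⟩
    | mul f g _ _ hf hg =>
      obtain ⟨i, hi⟩ := hf
      obtain ⟨j, hj⟩ := hg
      exact ⟨i + j, by rw [pow_add]; exact Submodule.mul_mem_mul hi hj⟩
  have hWI : W * I ≤ I := by
    rw [Submodule.mul_le]
    intro f hf g hg
    rw [mem_poleSubmodule] at hg ⊢
    exact ⟨mul_mem (hWA hf) hg.1, by rw [mul_assoc]; exact mul_mem (hWA hf) hg.2⟩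
  have : Module.Finite k W := Module.Finite.span_of_finite k (by simp)
  -- The pole ideal has codimension at most `n + 1`, so total degree at most `n` suffices to
  -- represent every class modulo it.
  have hAWI := le_pow_sup_of_card_le A W I h1W hWI hWmA hAW n
    (fun h => huA (by simpa using (mem_poleSubmodule.mp h).2))
    (fun f hf hli => by
      have := card_le_finrank_of_linearIndependent hu hA f hf hli
      rw [Fintype.card_fin] at this
      omega)
  -- For `h = x ^ i * y ^ j` the last coordinate of `h * u` is `x ^ i * c (n + 1 - j)`. Its degree
  -- is at most `i - 2 * (n + 1 - j)`, which is at most `-2` because `i + j ≤ n`.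
  have hlast : ∀ h ∈ W ^ n, B.coord (Fin.last (n + 1)) (h * u) ∈ degLE k (-2) := by
    have hspan : ∀ m, W ^ m ≤
        Submodule.span k {h | ∃ i j : ℕ, i + j ≤ m ∧ h = x ^ i * y ^ j} := by
      intro m
      induction m with
      | zero =>
        rw [pow_zero, Submodule.one_le]
        exact Submodule.subset_span ⟨0, 0, by simp⟩
      | succ m ih =>
        rw [pow_succ]
        refine (mul_le_mul' ih le_rfl).trans ?_
        rw [hW, Submodule.span_mul_span, Submodule.span_le]
        rintro _ ⟨_, ⟨i, j, hij, rfl⟩, g, hg, rfl⟩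
        rcases hg with rfl | rfl | rfl
        · exact Submodule.subset_span ⟨i, j, by omega, by simp⟩
        · exact Submodule.subset_span ⟨i + 1, j, by omega, by simp only; ring⟩
        · exact Submodule.subset_span ⟨i, j + 1, by omega, by simp only; ring⟩
    have hle : Submodule.span k {h | ∃ i j : ℕ, i + j ≤ n ∧ h = x ^ i * y ^ j} ≤
        (degLE k (-2)).comap (((B.coord (Fin.last (n + 1))).restrictScalars k).comp
          (LinearMap.mulRight k u)) := by
      rw [Submodule.span_le]
      rintro _ ⟨i, j, hij, rfl⟩
      have hj : j = n + 1 - ((⟨n + 1 - j, by omega⟩ : Fin (n + 2)) : ℕ) := by simp only; omega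
      have : x ^ i * y ^ j * u = (RatFunc.X ^ i : RatFunc k) • (y ^ j * u) := by
        rw [Algebra.smul_def, map_pow, mul_assoc]
      simp only [SetLike.mem_coe, Submodule.mem_comap, LinearMap.comp_apply,
        LinearMap.mulRight_apply, LinearMap.restrictScalars_apply]
      rw [this, map_smul, hc]
      conv in y ^ j => rw [hj]
      rw [coord_last_pow_mul B hB hy, smul_eq_mul]
      have hXi : (RatFunc.X ^ i : RatFunc k) ∈ degLE k i := by
        right
        have hX : (RatFunc.X : RatFunc k) ^ i = algebraMap k[X] (RatFunc k) (X ^ i) := by simp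
        rw [hX, RatFunc.intDegree_polynomial, natDegree_X_pow]
      refine degLE_mono ?_ (mul_mem_degLE hXi (hdeg _))
      push_cast
      omega
    exact fun h hh => hle (hspan n hh)
  have hAll : ∀ h ∈ A, B.coord (Fin.last (n + 1)) (h * u) ∈ polys k ⊔ degLE k (-2) := by
    intro h hh
    obtain ⟨v, hv, e, he, rfl⟩ := Submodule.mem_sup.mp (hAWI hh)
    rw [add_mul, map_add, add_comm]
    exact add_mem (Submodule.mem_sup_left (hcoeff _ (mem_poleSubmodule.mp he).2 _))
      (Submodule.mem_sup_right (hlast v hv))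
  apply huA
  rw [mem_coordRing_iff (by omega) hy]
  -- Testing against `x ^ i * y ^ (n + 1 - j)` isolates `x ^ i * c j`; letting `i` vary excludes
  -- every negative power of `x` from the expansion of `c j` at infinity.
  have hcp : ∀ j, c j ∈ polys k := by
    intro j
    refine mem_polys_of_forall_X_pow_mul _ fun i => ?_
    have := hAll (x ^ i * y ^ (n + 1 - j : ℕ)) 
      (mul_mem (S := Subalgebra k K) (pow_mem hxA _) (pow_mem hyA _))
    have e : x ^ i * y ^ (n + 1 - j : ℕ) * u =
        (RatFunc.X ^ i : RatFunc k) • (y ^ (n + 1 - j : ℕ) * u) := by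
      rw [Algebra.smul_def, map_pow, mul_assoc]
    rwa [e, map_smul, hc, coord_last_pow_mul B hB hy, smul_eq_mul] at this
  choose d hd using fun j => mem_polys.mp (hcp j)
  exact ⟨d, by simp_rw [hd]; exact hc⟩

end Superelliptic

end

section

open Polynomial

/-! ### The local rings of the affine line -/

/-- The local ring of the affine line at the point `a`. -/
def pointRing {k : Type*} [Field k] (a : k) : ValuationSubring (RatFunc k) where
  carrier := {f | ∃ p q : k[X], q.eval a ≠ 0 ∧ f * algebraMap k[X] (RatFunc k) q =
    algebraMap k[X] (RatFunc k) p}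
  mul_mem' := by
    rintro f g ⟨p, q, hq, h⟩ ⟨p', q', hq', h'⟩
    refine ⟨p * p', q * q', by simp [hq, hq'], ?_⟩
    rw [map_mul, map_mul, ← h, ← h']; ring
  one_mem' := ⟨1, 1, by simp, by simp⟩
  add_mem' := by
    rintro f g ⟨p, q, hq, h⟩ ⟨p', q', hq', h'⟩
    refine ⟨p * q' + p' * q, q * q', by simp [hq, hq'], ?_⟩
    rw [map_mul, map_add, map_mul, map_mul, ← h, ← h']; ring
  zero_mem' := ⟨0, 1, by simp, by simp⟩
  neg_mem' := by
    rintro f ⟨p, q, hq, h⟩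
    exact ⟨-p, q, hq, by rw [map_neg, ← h]; ring⟩
  mem_or_inv_mem' := by
    intro f
    by_cases h : f.denom.eval a = 0
    · right
      refine ⟨f.denom, f.num, fun hn => ?_, ?_⟩
      · obtain ⟨r, s, hrs⟩ := f.isCoprime_num_denom
        have := congrArg (eval a) hrs
        simp [h, hn] at this
      · by_cases hf : f = 0
        · subst hf; simp at h
        have : f * algebraMap k[X] (RatFunc k) f.denom = algebraMap k[X] (RatFunc k) f.num := by
          conv_lhs => enter [1]; rw [← f.num_div_denom]
          rw [div_mul_cancel₀]
          exact RatFunc.algebraMap_ne_zero f.denom_ne_zero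
        rw [← this]
        field_simp
    · left
      refine ⟨f.num, f.denom, h, ?_⟩
      conv_lhs => enter [1]; rw [← f.num_div_denom]
      rw [div_mul_cancel₀]
      exact RatFunc.algebraMap_ne_zero f.denom_ne_zero

theorem mem_pointRing {k : Type*} [Field k] {a : k} {f : RatFunc k} :
    f ∈ pointRing a ↔ ∃ p q : k[X], q.eval a ≠ 0 ∧ f * algebraMap k[X] (RatFunc k) q =
      algebraMap k[X] (RatFunc k) p := Iff.rfl

theorem algebraMap_mem_pointRing {k : Type*} [Field k] (a : k) (p : k[X]) :
    algebraMap k[X] (RatFunc k) p ∈ pointRing a := ⟨p, 1, by simp, by simp⟩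

theorem inv_algebraMap_mem_pointRing {k : Type*} [Field k] {a : k} {q : k[X]} (hq : q.eval a ≠ 0) :
    (algebraMap k[X] (RatFunc k) q)⁻¹ ∈ pointRing a := by
  refine ⟨1, q, hq, ?_⟩
  rw [inv_mul_cancel₀, map_one]
  exact RatFunc.algebraMap_ne_zero (by rintro rfl; simp at hq)

theorem exists_eq_zpow_mul {k : Type*} [Field k] (a : k) {f : RatFunc k} (hf : f ≠ 0) :
    ∃ (m : ℤ) (g : RatFunc k), f = algebraMap k[X] (RatFunc k) (X - C a) ^ m * g ∧
      g ∈ pointRing a ∧ g⁻¹ ∈ pointRing a := by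
  obtain ⟨p, hp, hpa⟩ := exists_eq_pow_rootMultiplicity_mul_and_not_dvd f.num
    (RatFunc.num_ne_zero hf) a
  obtain ⟨q, hq, hqa⟩ := exists_eq_pow_rootMultiplicity_mul_and_not_dvd f.denom
    f.denom_ne_zero a
  rw [dvd_iff_isRoot, IsRoot.def] at hpa hqa
  have h0 : algebraMap k[X] (RatFunc k) (X - C a) ≠ 0 :=
    RatFunc.algebraMap_ne_zero (X_sub_C_ne_zero a)
  refine ⟨(f.num.rootMultiplicity a : ℤ) - f.denom.rootMultiplicity a,
    algebraMap k[X] (RatFunc k) p * (algebraMap k[X] (RatFunc k) q)⁻¹, ?_,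
    mul_mem (algebraMap_mem_pointRing _ _) (inv_algebraMap_mem_pointRing hqa), ?_⟩
  · conv_lhs => rw [← f.num_div_denom, hp, hq]
    rw [map_mul, map_mul, map_pow, map_pow, zpow_sub₀ h0, zpow_natCast, zpow_natCast]
    have := RatFunc.algebraMap_ne_zero (K := k) (x := q) (by rintro rfl; simp at hqa)
    field_simp
  · rw [mul_inv, inv_inv]
    exact mul_mem (inv_algebraMap_mem_pointRing hpa) (algebraMap_mem_pointRing _ _)

theorem mem_polys_of_forall_mem_pointRing {k : Type*} [Field k] [IsAlgClosed k] {f : RatFunc k}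
    (h : ∀ a, f ∈ pointRing a) : f ∈ polys k := by
  have hd : f.denom.natDegree = 0 := by
    by_contra hd
    obtain ⟨a, ha⟩ := IsAlgClosed.exists_root f.denom (by
      rw [degree_eq_natDegree f.denom_ne_zero]
      exact_mod_cast hd)
    obtain ⟨p, q, hq, e⟩ := h a
    have e' : f.num * q = p * f.denom := by
      apply RatFunc.algebraMap_injective k
      have hd0 := RatFunc.algebraMap_ne_zero (K := k) f.denom_ne_zero
      rw [map_mul, map_mul, ← e]
      conv_rhs => enter [1, 1]; rw [← f.num_div_denom]
      field_simp
    have h1 := congrArg (eval a) e'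
    rw [eval_mul, eval_mul, ha, mul_zero, mul_eq_zero, or_iff_left hq] at h1
    obtain ⟨r, s, hrs⟩ := f.isCoprime_num_denom
    have := congrArg (eval a) hrs
    rw [eval_add, eval_mul, eval_mul, h1, ha.eq_zero] at this
    simp at this
  rw [(f.monic_denom.natDegree_eq_zero).mp hd |> fun h => (f.num_div_denom.symm.trans (by rw [h]))]
  exact mem_polys.mpr ⟨f.num, by simp⟩

theorem exists_common_denominator {k : Type*} [Field k] {a : k} {ι : Type*} [Fintype ι]
    (f : ι → RatFunc k) (hf : ∀ i, f i ∈ pointRing a) :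
    ∃ g : k[X], g.eval a ≠ 0 ∧ ∀ i, algebraMap k[X] (RatFunc k) g * f i ∈ polys k := by
  classical
  choose p q hq h using fun i => mem_pointRing.mp (hf i)
  refine ⟨∏ i, q i, by rw [eval_prod]; exact Finset.prod_ne_zero_iff.mpr fun i _ => hq i,
    fun i => mem_polys.mpr ⟨(∏ j ∈ Finset.univ.erase i, q j) * p i, ?_⟩⟩
  rw [← Finset.mul_prod_erase _ _ (Finset.mem_univ i), map_mul, map_mul, ← h]
  ring

/-- A divisor of degree `d` on the affine line is principal. -/
theorem exists_ratFunc_of_divisor {k : Type*} [Field k] (h : k → RatFunc k) (h0 : ∀ a, h a ≠ 0)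
    (hfin : {a | h a ≠ 1}.Finite) :
    ∃ q : RatFunc k, q ≠ 0 ∧ ∀ a, h a * q⁻¹ ∈ pointRing a ∧ (h a)⁻¹ * q ∈ pointRing a := by
  classical
  choose m g hg hg1 hg2 using fun a => exists_eq_zpow_mul a (h0 a)
  have hX : ∀ b : k, algebraMap k[X] (RatFunc k) (X - C b) ≠ 0 := fun b =>
    RatFunc.algebraMap_ne_zero (X_sub_C_ne_zero b)
  have hunit : ∀ (a : k) (s : Finset k), a ∉ s →
      (∏ b ∈ s, algebraMap k[X] (RatFunc k) (X - C b) ^ m b) ∈ pointRing a ∧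
      (∏ b ∈ s, algebraMap k[X] (RatFunc k) (X - C b) ^ m b)⁻¹ ∈ pointRing a := by
    intro a s has
    have : ∀ b ∈ s, ∀ m : ℤ, algebraMap k[X] (RatFunc k) (X - C b) ^ m ∈ pointRing a := by
      intro b hb m
      have hab : (X - C b).eval a ≠ 0 := by
        simpa [sub_eq_zero] using fun e : a = b => has (e ▸ hb)
      cases m with
      | ofNat m =>
        rw [Int.ofNat_eq_natCast, zpow_natCast]
        exact pow_mem (algebraMap_mem_pointRing _ _) _
      | negSucc m =>
        rw [zpow_negSucc, ← inv_pow]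
        exact pow_mem (inv_algebraMap_mem_pointRing hab) _
    refine ⟨prod_mem fun b hb => this b hb _, ?_⟩
    rw [← Finset.prod_inv_distrib]
    refine prod_mem fun b hb => ?_
    rw [← zpow_neg]
    exact this b hb _
  refine ⟨∏ b ∈ hfin.toFinset, algebraMap k[X] (RatFunc k) (X - C b) ^ m b,
    Finset.prod_ne_zero_iff.mpr fun b _ => zpow_ne_zero _ (hX b), fun a => ?_⟩
  by_cases ha : a ∈ hfin.toFinset
  · rw [← Finset.mul_prod_erase _ _ ha]
    obtain ⟨h1, h2⟩ := hunit a (hfin.toFinset.erase a) (Finset.notMem_erase _ _)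
    have hz := zpow_ne_zero (m a) (hX a)
    set P := ∏ b ∈ hfin.toFinset.erase a, algebraMap k[X] (RatFunc k) (X - C b) ^ m b
    constructor
    · have : h a * (algebraMap k[X] (RatFunc k) (X - C a) ^ m a * P)⁻¹ = g a * P⁻¹ := by
        conv_lhs => rw [hg a]
        field_simp
      rw [this]; exact mul_mem (hg1 a) h2
    · have : (h a)⁻¹ * (algebraMap k[X] (RatFunc k) (X - C a) ^ m a * P) = (g a)⁻¹ * P := by
        conv_lhs => rw [hg a]
        field_simp
      rw [this]; exact mul_mem (hg2 a) h1
  · have h1 : h a = 1 := by simpa using ha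
    obtain ⟨h2, h3⟩ := hunit a hfin.toFinset ha
    rw [h1, inv_one, one_mul, one_mul]
    exact ⟨h3, h2⟩

end

section

open Polynomial

/-! ### From local coordinates to superelliptic curves -/

/-- The elements `∑ d j * w ^ j`, `j < n`, with all `d j` in `O`. -/
def IsIntegralCombination {L K : Type*} [Field L] [Field K] [Algebra L K] (n : ℕ) (O : Set L)
    (w f : K) : Prop :=
  ∃ d : Fin n → L, (∀ j, d j ∈ O) ∧ f = ∑ j, d j • w ^ (j : ℕ)

/-- Comaximal denominators of `v` and `v⁻¹` among the combinations of powers of `w`. -/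
def HasLocalDenominators {L K : Type*} [Field L] [Field K] [Algebra L K] (n : ℕ) (O : Set L)
    (w v : K) : Prop :=
  ∃ a b : K, a + b = 1 ∧ IsIntegralCombination n O w a ∧ IsIntegralCombination n O w b ∧
    IsIntegralCombination n O w (a * v) ∧ IsIntegralCombination n O w (b * v⁻¹)

theorem IsIntegralCombination.mono {L K : Type*} [Field L] [Field K] [Algebra L K] {n : ℕ}
    {O O' : Set L} (h : O ⊆ O') {w f : K} (hf : IsIntegralCombination n O w f) :
    IsIntegralCombination n O' w f := by
  obtain ⟨d, hd, e⟩ := hf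
  exact ⟨d, fun j => h (hd j), e⟩

theorem HasLocalDenominators.mono {L K : Type*} [Field L] [Field K] [Algebra L K] {n : ℕ}
    {O O' : Set L} (h : O ⊆ O') {w v : K} (hv : HasLocalDenominators n O w v) :
    HasLocalDenominators n O' w v := by
  obtain ⟨a, b, hab, h1, h2, h3, h4⟩ := hv
  exact ⟨a, b, hab, h1.mono h, h2.mono h, h3.mono h, h4.mono h⟩

theorem IsIntegralCombination.mul_right {L K : Type*} [Field L] [Field K] [Algebra L K] {n : ℕ}
    {O : ValuationSubring L} {w f : K} {t : L} (ht : t ∈ O)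
    (hf : IsIntegralCombination n (O : Set L) (t • w) f) :
    IsIntegralCombination n (O : Set L) w f := by
  obtain ⟨d, hd, rfl⟩ := hf
  refine ⟨fun j => d j * t ^ (j : ℕ), fun j => mul_mem (hd j) (pow_mem ht _), ?_⟩
  simp_rw [_root_.smul_pow, smul_smul]

section

variable {k K : Type*} [Field k] [Field K] [Algebra (RatFunc k) K] [Algebra k K]
  [IsScalarTower k (RatFunc k) K]

/-- The polynomials `g` such that `g = a + b` where `a`, `b`, `a * v` and `b * v⁻¹` are regular. -/
def denominatorIdeal (A : Subalgebra k K) (hA : ∀ p : k[X],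
    algebraMap (RatFunc k) K (algebraMap k[X] (RatFunc k) p) ∈ A) (v : K) : Ideal k[X] where
  carrier := {g | ∃ a b : K, a ∈ A ∧ b ∈ A ∧
    a + b = algebraMap (RatFunc k) K (algebraMap k[X] (RatFunc k) g) ∧ a * v ∈ A ∧ b * v⁻¹ ∈ A}
  zero_mem' := ⟨0, 0, by simp⟩
  add_mem' := by
    rintro g g' ⟨a, b, h1, h2, h3, h4, h5⟩ ⟨a', b', h1', h2', h3', h4', h5'⟩
    refine ⟨a + a', b + b', add_mem h1 h1', add_mem h2 h2', ?_, ?_, ?_⟩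
    · rw [map_add, map_add, ← h3, ← h3']; ring
    · rw [add_mul]; exact add_mem h4 h4'
    · rw [add_mul]; exact add_mem h5 h5'
  smul_mem' := by
    rintro c g ⟨a, b, h1, h2, h3, h4, h5⟩
    refine ⟨_ * a, _ * b, mul_mem (hA c) h1, mul_mem (hA c) h2, ?_, ?_, ?_⟩
    · rw [smul_eq_mul, map_mul, map_mul, ← h3]; ring
    · rw [mul_assoc]; exact mul_mem (hA c) h4
    · rw [mul_assoc]; exact mul_mem (hA c) h5

theorem IsIntegralCombination.exists_mul_mem_coordRing {n : ℕ} {a : k} {y f : K}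
    (hf : IsIntegralCombination n (pointRing a : Set (RatFunc k)) y f) :
    ∃ g : k[X], g.eval a ≠ 0 ∧
      algebraMap (RatFunc k) K (algebraMap k[X] (RatFunc k) g) * f ∈ coordRing k y := by
  obtain ⟨d, hd, rfl⟩ := hf
  obtain ⟨g, hg, h⟩ := exists_common_denominator d hd
  refine ⟨g, hg, ?_⟩
  rw [Finset.mul_sum]
  refine sum_mem fun j _ => ?_
  obtain ⟨p, hp⟩ := mem_polys.mp (h j)
  rw [Algebra.smul_def, ← mul_assoc, ← map_mul, ← hp]
  exact mul_mem (algebraMap_mem_coordRing _ _) (pow_mem (Algebra.subset_adjoin (by simp)) _)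

/-- The polynomials that split into a denominator of `v` and one of `v⁻¹` form an ideal of `k[X]`.
Clearing finitely many denominators at `a` yields a member that does not vanish at `a`, and an ideal
without zeros over an algebraically closed field contains `1`. -/
theorem hasComaximalDenominators_of_local [IsAlgClosed k] {n : ℕ} {y v : K}
    (h : ∀ a : k, HasLocalDenominators n (pointRing a : Set (RatFunc k)) y v) :
    HasComaximalDenominators (coordRing k y) v := by
  set J := denominatorIdeal (coordRing k y) (algebraMap_mem_coordRing y) v with hJ
  have hlocal : ∀ a : k, ∃ g ∈ J, g.eval a ≠ 0 := by
    intro a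
    obtain ⟨a', b', hab, h1, h2, h3, h4⟩ := h a
    obtain ⟨g1, hg1, h1⟩ := h1.exists_mul_mem_coordRing
    obtain ⟨g2, hg2, h2⟩ := h2.exists_mul_mem_coordRing
    obtain ⟨g3, hg3, h3⟩ := h3.exists_mul_mem_coordRing
    obtain ⟨g4, hg4, h4⟩ := h4.exists_mul_mem_coordRing
    set φ : k[X] →+* K := (algebraMap (RatFunc k) K).comp (algebraMap k[X] (RatFunc k))
    have hφ : ∀ p : k[X], φ p ∈ coordRing k y := algebraMap_mem_coordRing y
    change φ g1 * a' ∈ _ at h1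
    change φ g2 * b' ∈ _ at h2
    change φ g3 * (a' * v) ∈ _ at h3
    change φ g4 * (b' * v⁻¹) ∈ _ at h4
    refine ⟨g1 * g2 * g3 * g4, ⟨φ (g1 * g2 * g3 * g4) * a', φ (g1 * g2 * g3 * g4) * b', ?_, ?_,
      ?_, ?_, ?_⟩, by simp [hg1, hg2, hg3, hg4]⟩
    · have : φ (g1 * g2 * g3 * g4) * a' = φ (g2 * g3 * g4) * (φ g1 * a') := by
        simp only [map_mul]; ring
      rw [this]; exact mul_mem (hφ _) h1
    · have : φ (g1 * g2 * g3 * g4) * b' = φ (g1 * g3 * g4) * (φ g2 * b') := by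
        simp only [map_mul]; ring
      rw [this]; exact mul_mem (hφ _) h2
    · rw [← mul_add, hab, mul_one]; rfl
    · have : φ (g1 * g2 * g3 * g4) * a' * v = φ (g1 * g2 * g4) * (φ g3 * (a' * v)) := by
        simp only [map_mul]; ring
      rw [this]; exact mul_mem (hφ _) h3
    · have : φ (g1 * g2 * g3 * g4) * b' * v⁻¹ = φ (g1 * g2 * g3) * (φ g4 * (b' * v⁻¹)) := by
        simp only [map_mul]; ring
      rw [this]; exact mul_mem (hφ _) h4
  have htop : J = ⊤ := by
    obtain ⟨g, hg⟩ := (IsPrincipalIdealRing.principal J).principal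
    rw [hg, Ideal.submodule_span_eq, Ideal.span_singleton_eq_top]
    by_contra hu
    have hroot : ∃ a, g.eval a = 0 := by
      by_cases hg0 : g = 0
      · exact ⟨0, by simp [hg0]⟩
      · exact IsAlgClosed.exists_root g fun hd => hu (isUnit_iff_degree_eq_zero.mpr hd)
    obtain ⟨a, ha⟩ := hroot
    obtain ⟨f, hf, hfa⟩ := hlocal a
    rw [hg, Ideal.submodule_span_eq, Ideal.mem_span_singleton] at hf
    obtain ⟨c, rfl⟩ := hf
    simp [ha] at hfa
  obtain ⟨a, b, h1, h2, h3, h4, h5⟩ : (1 : k[X]) ∈ J := htop ▸ Submodule.mem_top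
  exact ⟨a, b, h1, h2, by simpa using h3, h4, h5⟩

/-- The function field of a cyclic covering `w ^ n = s` of the projective line, given by local
coordinates `h a * w` at the points `a` of the affine line and by `w` at infinity, has gonality at
least `n` if the line bundle defined by the local coordinates has degree at least `2`. -/
theorem le_finrank_of_cyclic [IsAlgClosed k] {n : ℕ} (B : Module.Basis (Fin (n + 2)) (RatFunc k) K)
    {w : K} {s : RatFunc k} (hB : ∀ j, B j = w ^ (j : ℕ))
    (hs : w ^ (n + 2) = algebraMap (RatFunc k) K s)
    (h : k → RatFunc k) (hsh : ∀ a, s * h a ^ (n + 2) ∈ pointRing a)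
    {q : RatFunc k} (hq0 : q ≠ 0)
    (hq : ∀ a, h a * q⁻¹ ∈ pointRing a ∧ (h a)⁻¹ * q ∈ pointRing a)
    (hdeg : 2 ≤ q.intDegree) (h0 : ∀ a, h a ≠ 0)
    {u : K} (hu : Transcendental k u) (c : Fin (n + 2) → RatFunc k)
    (hc : u = ∑ j, c j • w ^ (j : ℕ)) (hc0 : ∀ j, c j ∈ degLE k 0)
    [Module.Finite (IntermediateField.adjoin k {u}) K]
    (hloc : ∀ a, HasLocalDenominators (n + 2) (pointRing a : Set (RatFunc k)) (h a • w) u) :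
    n + 2 ≤ Module.finrank (IntermediateField.adjoin k {u}) K := by
  -- On the affine line `q` has the same divisor as the local factors `h a`, so `q • w` is a good
  -- coordinate at all finite points simultaneously, and its power `y ^ (n + 2)` is a polynomial in
  -- `x`.
  set y : K := q • w with hy
  have hp : s * q ^ (n + 2) ∈ polys k := by
    refine mem_polys_of_forall_mem_pointRing fun a => ?_
    have : s * q ^ (n + 2) = s * h a ^ (n + 2) * ((h a)⁻¹ * q) ^ (n + 2) := by
      rw [mul_assoc, ← mul_pow, mul_inv_cancel_left₀ (h0 a)]
    rw [this]
    exact mul_mem (hsh a) (pow_mem (hq a).2 _)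
  obtain ⟨p, hp⟩ := mem_polys.mp hp
  refine le_finrank_of_superelliptic (y := y) (p := p)
    (B.isUnitSMul (w := fun j => q ^ (j : ℕ)) fun j => (pow_ne_zero _ hq0).isUnit) ?_ ?_ hu
    (fun j => c j * (q⁻¹) ^ (j : ℕ)) ?_ ?_ ?_
  · intro j
    rw [Module.Basis.isUnitSMul_apply, hB, hy, _root_.smul_pow]
  · rw [hy, _root_.smul_pow, hs, hp, Algebra.smul_def, ← map_mul, mul_comm]
  · rw [hc]
    refine Finset.sum_congr rfl fun j _ => ?_
    rw [hy, _root_.smul_pow, smul_smul, mul_assoc, ← mul_pow, inv_mul_cancel₀ hq0, one_pow, mul_one]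
  -- Replacing `w` by `q • w` divides the coefficient of index `j` by `q ^ j`, which has degree at
  -- least `2 * j`.
  · intro j
    have hqj : (q⁻¹) ^ (j : ℕ) ∈ degLE k (-2 * (j : ℕ)) := by
      generalize (j : ℕ) = i
      induction i with
      | zero => right; simp
      | succ i ih =>
        rw [pow_succ]
        refine degLE_mono ?_ (mul_mem_degLE ih (e := -2) (Or.inr ?_))
        · push_cast; omega
        · rw [RatFunc.intDegree_inv]; omega
    exact degLE_mono (by simp) (mul_mem_degLE (hc0 j) hqj)
  · refine hasComaximalDenominators_of_local (n := n + 2) fun a => ?_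
    have key : ∀ f, IsIntegralCombination (n + 2) (pointRing a : Set (RatFunc k)) (h a • w) f →
        IsIntegralCombination (n + 2) (pointRing a : Set (RatFunc k)) y f := by
      intro f hf
      have e : h a • w = (h a * q⁻¹) • y := by
        rw [hy, smul_smul, mul_assoc, inv_mul_cancel₀ hq0, mul_one]
      rw [e] at hf
      exact hf.mul_right (hq a).1
    obtain ⟨a', b', hab, h1, h2, h3, h4⟩ := hloc a
    exact ⟨a', b', hab, key _ h1, key _ h2, key _ h3, key _ h4⟩

end

end

/-! ### Smooth algebras of dimension one -/

theorem isPrincipalIdealRing_mvPolynomial (k : Type*) [Field k] :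
    IsPrincipalIdealRing (MvPolynomial (Fin 1) k) :=
  IsPrincipalIdealRing.of_surjective (MvPolynomial.uniqueAlgEquiv k (Fin 1)).symm.toRingHom
    (MvPolynomial.uniqueAlgEquiv k (Fin 1)).symm.surjective

/-- Étale algebras are unramified, so the maximal ideal of the localization is generated by the
prime below it, and that prime is principal in `P`. -/
theorem isPrincipal_maximalIdeal_of_unramified {P R : Type*} [CommRing P] [CommRing R] [Algebra P R]
    [IsPrincipalIdealRing P] [Algebra.Etale P R] (q : Ideal R) [q.IsPrime] :
    (IsLocalRing.maximalIdeal (Localization.AtPrime q)).IsPrincipal := by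
  let := Localization.AtPrime.algebraOfLiesOver (q.under P) q
  have h := ((Algebra.isUnramifiedAt_iff_map_eq P (q.under P) q).mp inferInstance).2
  rw [← h]
  obtain ⟨x, hx⟩ := (IsPrincipalIdealRing.principal (q.under P)).principal
  rw [hx, Ideal.submodule_span_eq, Ideal.map_span, Set.image_singleton]
  exact ⟨_, rfl⟩

/-- The localizations of a smooth algebra of relative dimension one over a field have principal
maximal ideals. -/
theorem isPrincipal_maximalIdeal_of_isStandardSmooth {k R : Type*} [Field k] [CommRing R]
    {f : k →+* R} (hf : f.IsStandardSmoothOfRelativeDimension 1) (q : Ideal R) [q.IsPrime] :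
    (IsLocalRing.maximalIdeal (Localization.AtPrime q)).IsPrincipal := by
  obtain ⟨g, -, hg⟩ := hf.exists_etale_mvPolynomial
  algebraize [g]
  have := isPrincipalIdealRing_mvPolynomial k
  exact isPrincipal_maximalIdeal_of_unramified (P := MvPolynomial (Fin 1) k) q

theorem isNoetherianRing_of_isStandardSmooth {k R : Type*} [Field k] [CommRing R]
    {f : k →+* R} (hf : f.IsStandardSmoothOfRelativeDimension 1) : IsNoetherianRing R := by
  obtain ⟨g, -, hg⟩ := hf.exists_etale_mvPolynomial
  algebraize [g]
  exact Algebra.FiniteType.isNoetherianRing (MvPolynomial (Fin 1) k) R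

/-- The fraction field of a smooth algebra of relative dimension one has transcendence degree one. -/
theorem trdeg_of_isStandardSmooth {k R K : Type*} [Field k] [CommRing R] [IsDomain R] [Field K]
    [Algebra k R] [Algebra R K] [Algebra k K] [IsScalarTower k R K] [IsFractionRing R K]
    (hf : (algebraMap k R).IsStandardSmoothOfRelativeDimension 1) :
    Algebra.trdeg k K = 1 := by
  obtain ⟨g, hgf, hg⟩ := hf.exists_etale_mvPolynomial
  algebraize [g, (algebraMap R K).comp g]
  have : IsScalarTower k (MvPolynomial (Fin 1) k) R := .of_algebraMap_eq' hgf.symm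
  have : IsScalarTower k (MvPolynomial (Fin 1) k) K := .to₁₂₄ _ _ R _
  have hinj : Function.Injective (algebraMap (MvPolynomial (Fin 1) k) R) :=
    FaithfulSMul.algebraMap_injective _ _
  have hinjK : Function.Injective (algebraMap (MvPolynomial (Fin 1) k) K) := by
    rw [IsScalarTower.algebraMap_eq (MvPolynomial (Fin 1) k) R K]
    exact (IsFractionRing.injective R K).comp hinj
  have : FaithfulSMul (MvPolynomial (Fin 1) k) K :=
    (faithfulSMul_iff_algebraMap_injective _ _).mpr hinjK
  have : Algebra.FormallyUnramified R K := .of_isLocalization (nonZeroDivisors R)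
  have : Algebra.FormallyUnramified (MvPolynomial (Fin 1) k) K := .comp _ R _
  have : Algebra.EssFiniteType R K := .of_isLocalization _ (nonZeroDivisors R)
  have : Algebra.EssFiniteType (MvPolynomial (Fin 1) k) K := .comp _ R _
  let F := FractionRing (MvPolynomial (Fin 1) k)
  let : Algebra F K := FractionRing.liftAlgebra _ _
  have : IsScalarTower (MvPolynomial (Fin 1) k) F K := FractionRing.isScalarTower_liftAlgebra _ _
  have : Algebra.FormallyUnramified F K := .of_restrictScalars (MvPolynomial (Fin 1) k) _ _
  have : Algebra.EssFiniteType F K := .of_comp (MvPolynomial (Fin 1) k) _ _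
  -- An unramified algebra essentially of finite type over a field is finite-dimensional, so `K` is
  -- algebraic over the rational function field `F` in one variable.
  have hfin : Module.Finite F K := Algebra.FormallyUnramified.finite_of_free _ _
  have : Algebra.IsAlgebraic F K := inferInstance
  have : Algebra.IsAlgebraic (MvPolynomial (Fin 1) k) K :=
    (IsFractionRing.comap_isAlgebraic_iff (A := MvPolynomial (Fin 1) k) (K := F) (C := K)).mpr this
  have hb := (IsTranscendenceBasis.mvPolynomial (Fin 1) k).algebraMap_comp (A := K)
  simpa using hb.lift_cardinalMk_eq_trdeg.symm

theorem isAlgebraic_adjoin_simple_of_trdeg {k K : Type*} [Field k] [Field K] [Algebra k K]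
    (h : Algebra.trdeg k K = 1) {x : K} (hx : Transcendental k x) :
    Algebra.IsAlgebraic (IntermediateField.adjoin k {x}) K := by
  have hx' : AlgebraicIndependent k (fun _ : Unit => x) :=
    (algebraicIndependent_unique_type_iff).mpr hx
  have hb := AlgebraicIndependent.isTranscendenceBasis_of_lift_trdeg_le_of_finite hx' (by simp [h])
  have := hb.isAlgebraic_field
  rwa [Set.range_const] at this

theorem exists_transcendental_of_trdeg {k K : Type*} [Field k] [Field K] [Algebra k K]
    (h : Algebra.trdeg k K = 1) : ∃ x : K, Transcendental k x := by
  by_contra! H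
  have : Algebra.IsAlgebraic k K := ⟨fun x => by simpa [Transcendental] using H x⟩
  rw [trdeg_eq_zero_iff.mpr this] at h
  exact zero_ne_one h

/-! ### The function field of an integral complex scheme -/

/-- The field of rational functions of an integral complex scheme, as a `ℂ`-algebra. -/
def FunField {X : Scheme.{0}} [IsIntegral X] (_p : X ⟶ SpecC) : Type := X.functionField

instance {X : Scheme.{0}} [IsIntegral X] (p : X ⟶ SpecC) : Field (FunField p) :=
  inferInstanceAs (Field X.functionField)

section

variable {X : Scheme.{0}} [IsIntegral X] (p : X ⟶ SpecC)

/-- The rational function defined by a regular function on a nonempty open set. -/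
def toFunField (U : X.Opens) (hU : genericPoint X ∈ U) : Γ(X, U) →+* FunField p :=
  (X.presheaf.germ U (genericPoint X) hU).hom

/-- The rational function defined by a germ. -/
def stalkToFunField (x : X) : X.presheaf.stalk x →+* FunField p :=
  algebraMap (X.presheaf.stalk x) X.functionField

instance : Algebra ℂ (FunField p) := ((toFunField p ⊤ (Opens.mem_top _)).comp (constants p ⊤)).toAlgebra

variable {p}

theorem genericPoint_mem_of_mem {U : X.Opens} {x : X} (hx : x ∈ U) : genericPoint X ∈ U :=
  ((genericPoint_spec X).mem_open_set_iff U.isOpen).mpr ⟨x, trivial, hx⟩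

theorem toFunField_injective (U : X.Opens) (hU : genericPoint X ∈ U) :
    Function.Injective (toFunField p U hU) := germ_injective_of_isIntegral X _ hU

theorem stalkToFunField_injective (x : X) : Function.Injective (stalkToFunField p x) :=
  IsFractionRing.injective (X.presheaf.stalk x) X.functionField

theorem toFunField_restrict {U V : X.Opens} (h : V ≤ U) (hV : genericPoint X ∈ V) (s : Γ(X, U)) :
    toFunField p V hV (restrict h s) = toFunField p U (h hV) s :=
  X.presheaf.germ_res_apply (homOfLE h) _ hV s

theorem toFunField_constants (U : X.Opens) (hU : genericPoint X ∈ U) (c : ℂ) :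
    toFunField p U hU (constants p U c) = algebraMap ℂ (FunField p) c := by
  exact (toFunField_restrict le_top hU _).trans
    (toFunField_restrict (le_refl ⊤) (Opens.mem_top _) _).symm

theorem stalkToFunField_germ {U : X.Opens} {x : X} (hx : x ∈ U) (s : Γ(X, U)) :
    stalkToFunField p x (X.presheaf.germ U x hx s) =
      toFunField p U (genericPoint_mem_of_mem hx) s := by
  change (X.presheaf.stalkSpecializes ((genericPoint_spec X).specializes trivial))
    (X.presheaf.germ U x hx s) = X.presheaf.germ U (genericPoint X) _ s
  rw [← CommRingCat.comp_apply, X.presheaf.germ_stalkSpecializes]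

variable (p)

/-- The local ring of `X` at `x`, as a subring of the function field. -/
def localRing (x : X) : Subalgebra ℂ (FunField p) :=
  { (stalkToFunField p x).range with
    algebraMap_mem' := fun c => ⟨X.presheaf.germ ⊤ x (Opens.mem_top x) (constants p ⊤ c), by
      rw [stalkToFunField_germ, toFunField_constants]⟩ }

/-- The ring of regular functions on a nonempty open set, as a subring of the function field. -/
def sectionRing (U : X.Opens) (hU : genericPoint X ∈ U) : Subalgebra ℂ (FunField p) :=
  { (toFunField p U hU).range with
    algebraMap_mem' := fun c => ⟨constants p U c, toFunField_constants U hU c⟩ }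

variable {p}

theorem mem_localRing {x : X} {f : FunField p} :
    f ∈ localRing p x ↔ ∃ s, stalkToFunField p x s = f := Iff.rfl

theorem mem_sectionRing {U : X.Opens} {hU : genericPoint X ∈ U} {f : FunField p} :
    f ∈ sectionRing p U hU ↔ ∃ s, toFunField p U hU s = f := Iff.rfl

theorem exists_section_of_mem_localRing {x : X} {f : FunField p} (hf : f ∈ localRing p x) :
    ∃ (U : X.Opens) (hx : x ∈ U) (s : Γ(X, U)),
      toFunField p U (genericPoint_mem_of_mem hx) s = f := by
  obtain ⟨s, rfl⟩ := mem_localRing.mp hf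
  obtain ⟨U, hx, t, rfl⟩ := X.presheaf.exists_germ_eq s
  exact ⟨U, hx, t, (stalkToFunField_germ hx t).symm⟩

theorem sectionRing_le_localRing {U : X.Opens} {x : X} (hx : x ∈ U) :
    sectionRing p U (genericPoint_mem_of_mem hx) ≤ localRing p x := by
  rintro _ ⟨s, rfl⟩
  exact ⟨_, stalkToFunField_germ hx s⟩

/-- A rational function which is regular at all points of `U` is a regular function on `U`. -/
theorem mem_sectionRing_of_forall {U : X.Opens} {hU : genericPoint X ∈ U} {f : FunField p}
    (h : ∀ x ∈ U, f ∈ localRing p x) : f ∈ sectionRing p U hU := by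
  choose V hxV s hs using fun x : U => exists_section_of_mem_localRing (h x.1 x.2)
  have hcompat : TopCat.Presheaf.IsCompatible X.presheaf V s := by
    intro x y
    apply germ_injective_of_isIntegral X (genericPoint X)
      (⟨genericPoint_mem_of_mem (hxV x), genericPoint_mem_of_mem (hxV y)⟩ :
        genericPoint X ∈ V x ⊓ V y)
    have h1 := toFunField_restrict (p := p) (inf_le_left : V x ⊓ V y ≤ V x)
      ⟨genericPoint_mem_of_mem (hxV x), genericPoint_mem_of_mem (hxV y)⟩ (s x)
    have h2 := toFunField_restrict (p := p) (inf_le_right : V x ⊓ V y ≤ V y)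
      ⟨genericPoint_mem_of_mem (hxV x), genericPoint_mem_of_mem (hxV y)⟩ (s y)
    exact (h1.trans (hs x)).trans (h2.trans (hs y)).symm
  obtain ⟨t', ht, -⟩ := X.sheaf.existsUnique_gluing V s hcompat
  let t : Γ(X, iSup V) := t'
  have hle : U ≤ iSup V := fun x hx => Opens.mem_iSup.mpr ⟨⟨x, hx⟩, hxV ⟨x, hx⟩⟩
  refine ⟨restrict hle t, ?_⟩
  change toFunField p U hU (restrict hle t) = f
  rw [toFunField_restrict, ← hs ⟨genericPoint X, hU⟩, ← ht ⟨genericPoint X, hU⟩]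
  exact (toFunField_restrict (p := p) (le_iSup V ⟨genericPoint X, hU⟩) _ t).symm

/-- An element of an affine coordinate ring is a fraction of global elements in a local ring. -/
theorem exists_fraction_of_mem_localRing {U : X.Opens} (hU : IsAffineOpen U) {x : X} (hx : x ∈ U)
    {f : FunField p} (hf : f ∈ localRing p x) :
    ∃ a b : Γ(X, U), IsUnit (X.presheaf.germ U x hx b) ∧
      f * toFunField p U (genericPoint_mem_of_mem hx) b =
        toFunField p U (genericPoint_mem_of_mem hx) a := by
  obtain ⟨s, rfl⟩ := mem_localRing.mp hf
  let := X.presheaf.algebra_section_stalk (U := U) ⟨x, hx⟩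
  have := hU.isLocalization_stalk ⟨x, hx⟩
  obtain ⟨⟨a, b⟩, h⟩ := IsLocalization.surj (hU.primeIdealOf ⟨x, hx⟩).asIdeal.primeCompl s
  refine ⟨a, b, IsLocalization.map_units (X.presheaf.stalk x) b, ?_⟩
  have := congrArg (stalkToFunField p x) h
  rw [map_mul] at this
  rw [← stalkToFunField_germ hx, ← stalkToFunField_germ hx]
  exact this

theorem exists_fraction {U : X.Opens} (hU : IsAffineOpen U) (hg : genericPoint X ∈ U)
    (f : FunField p) : ∃ a b : Γ(X, U), toFunField p U hg b ≠ 0 ∧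
      f * toFunField p U hg b = toFunField p U hg a := by
  have hf : f ∈ localRing p (genericPoint X) := by
    refine ⟨f, ?_⟩
    change X.presheaf.stalkSpecializes _ f = f
    rw [TopCat.Presheaf.stalkSpecializes_refl]
    rfl
  obtain ⟨a, b, hb, h⟩ := exists_fraction_of_mem_localRing hU hg hf
  refine ⟨a, b, fun h0 => ?_, h⟩
  have := hb.map (stalkToFunField p (genericPoint X))
  rw [stalkToFunField_germ] at this
  exact this.ne_zero h0

end

/-! ### Local rings of smooth curves -/

/-- `Spec ℂ` has a single point, so the affine open subset of the base provided by smoothness is the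
whole base. -/
theorem exists_isStandardSmooth_constants {X : Scheme.{0}} (p : X ⟶ SpecC)
    [h : SmoothOfRelativeDimension 1 p] (x : X) :
    ∃ V : X.Opens, IsAffineOpen V ∧ x ∈ V ∧
      (constants p V).IsStandardSmoothOfRelativeDimension 1 := by
  obtain ⟨U, hU, V, hV, hx, e, hs⟩ := h.exists_isStandardSmoothOfRelativeDimension x
  have hUtop : U = ⊤ := by
    refine top_le_iff.mp fun y _ => ?_
    have : y = p x := Subsingleton.elim (α := PrimeSpectrum ℂ) _ _
    rw [this]
    exact e hx
  subst hUtop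
  refine ⟨V, hV, hx, ?_⟩
  have h1 := hs.comp (RingHom.IsStandardSmoothOfRelativeDimension.equiv
    (Scheme.ΓSpecIso (CommRingCat.of ℂ)).symm.commRingCatIsoToRingEquiv)
  exact h1

section

variable {X : Scheme.{0}} [IsIntegral X] {p : X ⟶ SpecC}

theorem isFractionRing_toFunField {U : X.Opens} (hU : IsAffineOpen U) (hg : genericPoint X ∈ U) :
    letI := (toFunField p U hg).toAlgebra
    IsFractionRing Γ(X, U) (FunField p) := by
  have : Nonempty U := ⟨⟨_, hg⟩⟩
  exact functionField_isFractionRing_of_isAffineOpen X U hU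

theorem trdeg_funField [SmoothOfRelativeDimension 1 p] : Algebra.trdeg ℂ (FunField p) = 1 := by
  obtain ⟨V, hV, hx, hs⟩ := exists_isStandardSmooth_constants p (genericPoint X)
  have : Nonempty V := ⟨⟨_, hx⟩⟩
  let := (constants p V).toAlgebra
  let := (toFunField p V hx).toAlgebra
  have := isFractionRing_toFunField (p := p) hV hx
  have : IsScalarTower ℂ Γ(X, V) (FunField p) :=
    .of_algebraMap_eq fun c => (toFunField_constants V hx c).symm
  exact trdeg_of_isStandardSmooth (R := Γ(X, V)) hs

/-- The stalk is a localization of an algebra étale over a polynomial ring in one variable, hence a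
Noetherian local domain with principal maximal ideal. The generic point is included; there the stalk
is a field. -/
theorem isPrincipalIdealRing_stalk [SmoothOfRelativeDimension 1 p] (x : X) :
    IsPrincipalIdealRing (X.presheaf.stalk x) := by
  obtain ⟨V, hV, hx, hs⟩ := exists_isStandardSmooth_constants p x
  let := X.presheaf.algebra_section_stalk (U := V) ⟨x, hx⟩
  have hloc := hV.isLocalization_stalk ⟨x, hx⟩
  set q := (hV.primeIdealOf ⟨x, hx⟩).asIdeal
  have hN := isNoetherianRing_of_isStandardSmooth hs
  have : IsNoetherianRing (X.presheaf.stalk x) :=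
    IsLocalization.isNoetherianRing q.primeCompl _ hN
  refine ((tfae_of_isNoetherianRing_of_isLocalRing_of_isDomain
    (X.presheaf.stalk x)).out 4 0).mp ?_
  obtain ⟨t, ht⟩ := isPrincipal_maximalIdeal_of_isStandardSmooth hs q
  let e := IsLocalization.algEquiv q.primeCompl (Localization.AtPrime q) (X.presheaf.stalk x)
  rw [Ideal.submodule_span_eq] at ht
  refine ⟨e t, ?_⟩
  rw [Ideal.submodule_span_eq]
  have hm := IsLocalRing.map_ringEquiv_maximalIdeal e.toRingEquiv
  rw [← hm, ht, Ideal.map_span, Set.image_singleton]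
  rfl

theorem mem_or_inv_mem_localRing [SmoothOfRelativeDimension 1 p] (x : X) (f : FunField p) :
    f ∈ localRing p x ∨ f⁻¹ ∈ localRing p x := by
  have := isPrincipalIdealRing_stalk (p := p) x
  exact (ValuationRing.isInteger_or_isInteger (X.presheaf.stalk x) (K := X.functionField) f)

variable (p) in
/-- The local ring of a smooth curve, as a valuation ring. -/
def valuationRing [SmoothOfRelativeDimension 1 p] (x : X) : ValuationSubring (FunField p) :=
  { (localRing p x).toSubring with
    mem_or_inv_mem' := mem_or_inv_mem_localRing x }

theorem mem_valuationRing [SmoothOfRelativeDimension 1 p] {x : X} {f : FunField p} :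
    f ∈ valuationRing p x ↔ f ∈ localRing p x := Iff.rfl

end

/-! ### Projective schemes are proper -/

attribute [local instance] MvPolynomial.gradedAlgebra

theorem bijective_algebraMap_homogeneousSubmodule_zero (N : ℕ) :
    Function.Bijective
      (algebraMap ℂ (MvPolynomial.homogeneousSubmodule (Fin (N + 1)) ℂ 0)) := by
  constructor
  · intro a b h
    exact MvPolynomial.C_injective _ _ (congrArg Subtype.val h)
  · rintro ⟨q, hq⟩
    refine ⟨q.coeff 0, Subtype.ext ?_⟩
    have := MvPolynomial.totalDegree_eq_zero_iff_eq_C.mp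
      ((MvPolynomial.totalDegree_zero_iff_isHomogeneous _).mpr hq)
    exact this.symm

/-- `Proj` is proper over the spectrum of the degree-zero part of the graded ring, and this part is
`ℂ`. -/
instance isProper_projSpace (N : ℕ) : IsProper (ProjSpace.toSpecC N) := by
  let 𝒜 := MvPolynomial.homogeneousSubmodule (Fin (N + 1)) ℂ
  have : Algebra.FiniteType (𝒜 0) (MvPolynomial (Fin (N + 1)) ℂ) := by
    have h : (algebraMap ℂ (MvPolynomial (Fin (N + 1)) ℂ)).FiniteType :=
      (RingHom.finiteType_algebraMap.mpr inferInstance)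
    have h2 : ((algebraMap (𝒜 0) (MvPolynomial (Fin (N + 1)) ℂ)).comp
      (algebraMap ℂ (𝒜 0))).FiniteType := h
    exact RingHom.FiniteType.of_comp_finiteType h2
  have : IsIso (CommRingCat.ofHom (algebraMap ℂ (𝒜 0))) :=
    (ConcreteCategory.isIso_iff_bijective _).mpr (bijective_algebraMap_homogeneousSubmodule_zero N)
  have : IsProper (Proj.toSpecZero 𝒜) := inferInstance
  exact inferInstanceAs (IsProper (Proj.toSpecZero 𝒜 ≫ Spec.map _))

theorem IsProjective.isProper {X : Scheme.{0}} {p : X ⟶ SpecC} (hp : IsProjective p) :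
    IsProper p := by
  obtain ⟨N, i, hi, rfl⟩ := hp
  infer_instance

theorem fromSpecStalk_comp {X : Scheme.{0}} (p : X ⟶ SpecC) (x : X) : X.fromSpecStalk x ≫ p =
    Spec.map (CommRingCat.ofHom ((X.presheaf.germ ⊤ x (Opens.mem_top x)).hom.comp
      (constants p ⊤))) := by
  have h1 : p = X.toSpecΓ ≫ Spec.map ((Scheme.ΓSpecIso (CommRingCat.of ℂ)).inv ≫ p.appTop) := by
    rw [Spec.map_comp, ← Scheme.toSpecΓ_naturality_assoc, toSpecΓ_SpecMap_ΓSpecIso_inv]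
    simp
  conv_lhs => rw [h1]
  rw [Scheme.fromSpecStalk_toSpecΓ_assoc, ← Spec.map_comp]
  congr 1
  ext c
  change _ = X.presheaf.germ ⊤ x (Opens.mem_top x) (restrict le_top _)
  exact (X.presheaf.germ_res_apply (homOfLE le_top) _ _ _).symm

theorem map_closedPoint_fromSpecStalk {X : Scheme.{0}} {R : CommRingCat.{0}} [IsLocalRing R]
    (x : X) (f : X.presheaf.stalk x ⟶ R) (hf : IsLocalHom f.hom) :
    (Spec.map f ≫ X.fromSpecStalk x) (IsLocalRing.closedPoint R) = x := by
  refine (Scheme.Hom.comp_apply _ _ _).trans ?_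
  have h : Spec.map f (IsLocalRing.closedPoint R) = IsLocalRing.closedPoint _ := Spec_closedPoint
  exact (congrArg _ h).trans Scheme.fromSpecStalk_closedPoint

section

variable {X : Scheme.{0}} [IsIntegral X] {p : X ⟶ SpecC}

/-- Regular functions on a proper integral scheme are constant. -/
theorem mem_range_algebraMap_of_forall_mem_localRing [IsProper p] {f : FunField p}
    (hf : ∀ x, f ∈ localRing p x) : ∃ c : ℂ, algebraMap ℂ (FunField p) c = f := by
  obtain ⟨s, rfl⟩ := mem_sectionRing.mp
    (mem_sectionRing_of_forall (U := ⊤) (hU := Opens.mem_top _) fun x _ => hf x)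
  -- Global functions on a universally closed scheme are integral over the base, and a domain
  -- integral over `ℂ` is `ℂ`.
  have hint := isIntegral_appTop_of_universallyClosed p
  have h2 : (p.appTop.hom.comp (Scheme.ΓSpecIso (CommRingCat.of ℂ)).inv.hom).IsIntegral :=
    RingHom.IsIntegral.trans _ _ (RingHom.isIntegral_of_surjective _
      (Scheme.ΓSpecIso (CommRingCat.of ℂ)).symm.commRingCatIsoToRingEquiv.surjective) hint
  obtain ⟨c, hc⟩ := (IsAlgClosed.ringHom_bijective_of_isIntegral _ h2).2 s
  refine ⟨c, ?_⟩
  rw [← hc, ← toFunField_constants ⊤ (Opens.mem_top _)]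
  exact toFunField_restrict (p := p) (le_refl ⊤) (Opens.mem_top _) _

variable (p) in
/-- The local ring at `x` is dominated by the valuation ring `O`. -/
def IsCenter (O : ValuationSubring (FunField p)) (x : X) : Prop :=
  ∀ f ∈ localRing p x, f ∈ O ∧ (f⁻¹ ∈ O → f⁻¹ ∈ localRing p x)

variable (p) in
/-- The inclusion of the generic point. -/
def genericMap : Spec (.of (FunField p)) ⟶ X := X.fromSpecStalk (genericPoint X)

theorem spec_algebraMap_comp_fromSpecStalk {R : Type} [CommRing R] (x : X)
    (ψ : X.presheaf.stalk x →+* R) (j : R →+* FunField p) (h : j.comp ψ = stalkToFunField p x) :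
    Spec.map (CommRingCat.ofHom j) ≫ Spec.map (CommRingCat.ofHom ψ) ≫ X.fromSpecStalk x =
      genericMap p := by
  rw [← Spec.map_comp_assoc, ← CommRingCat.ofHom_comp, h]
  exact Scheme.SpecMap_stalkSpecializes_fromSpecStalk
    ((genericPoint_spec X).specializes trivial)

theorem genericMap_comp : genericMap p ≫ p =
    Spec.map (CommRingCat.ofHom (algebraMap ℂ (FunField p))) :=
  fromSpecStalk_comp p _

/-- The existence part of the valuative criterion extends the generic point to a morphism `Spec O ⟶
X`; the center is the image of the closed point. -/
theorem exists_isCenter [IsProper p] (O : ValuationSubring (FunField p))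
    (hO : ∀ c : ℂ, algebraMap ℂ (FunField p) c ∈ O) : ∃ x, IsCenter p O x := by
  let ι : ℂ →+* O := (algebraMap ℂ (FunField p)).codRestrict O.toSubring hO
  have hex : ValuativeCriterion.Existence p := by
    have h : (ValuativeCriterion.Existence ⊓ @QuasiCompact) p := by
      rw [← UniversallyClosed.eq_valuativeCriterion]
      exact (inferInstance : UniversallyClosed p)
    exact h.1
  let S : ValuativeCommSq p :=
    { R := O
      K := FunField p
      i₁ := genericMap p
      i₂ := Spec.map (CommRingCat.ofHom ι)
      commSq := ⟨by
        rw [genericMap_comp, ← Spec.map_comp]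
        rfl⟩ }
  obtain ⟨⟨l, hl, -⟩⟩ := (hex S).exists_lift
  change Spec (.of O) ⟶ X at l
  change Spec.map (CommRingCat.ofHom (algebraMap O (FunField p))) ≫ l = genericMap p at hl
  let x := l (IsLocalRing.closedPoint O)
  let ψ : X.presheaf.stalk x →+* O := (Scheme.stalkClosedPointTo l).hom
  have hψ : IsLocalHom ψ := Scheme.isLocalHom_stalkClosedPointTo l
  have hlψ : Spec.map (CommRingCat.ofHom ψ) ≫ X.fromSpecStalk x = l :=
    Scheme.Spec_stalkClosedPointTo_fromSpecStalk l
  have hcomp : (algebraMap O (FunField p)).comp ψ = stalkToFunField p x := by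
    have h1 := spec_algebraMap_comp_fromSpecStalk (p := p) x (RingHom.id _)
      (stalkToFunField p x) rfl
    rw [← hl, ← hlψ] at h1
    simp only [CommRingCat.ofHom_id, Spec.map_id, Category.id_comp] at h1
    rw [← Category.assoc, cancel_mono, ← Spec.map_comp, Spec.map_inj] at h1
    exact congrArg CommRingCat.Hom.hom h1.symm
  refine ⟨x, fun f hf => ?_⟩
  obtain ⟨s, rfl⟩ := mem_localRing.mp hf
  rw [← hcomp]
  refine ⟨(ψ s).2, fun h => ?_⟩
  by_cases h0 : s = 0
  · rw [h0, map_zero, inv_zero]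
    exact zero_mem _
  have hs0 : ((ψ s : O) : FunField p) ≠ 0 := by
    intro h1
    apply h0
    apply stalkToFunField_injective (p := p)
    rw [← hcomp, map_zero]
    exact h1
  have hu : IsUnit (ψ s) := .of_mul_eq_one ⟨_, h⟩ (Subtype.ext (mul_inv_cancel₀ hs0))
  obtain ⟨t, ht⟩ := (hψ.map_nonunit s hu).exists_right_inv
  refine ⟨t, ?_⟩
  have h1 := congrArg (fun z : O => (z : FunField p)) ((map_mul ψ s t).symm.trans
    ((congrArg ψ ht).trans (map_one ψ)))
  change stalkToFunField p x t = _
  rw [← hcomp]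
  exact eq_inv_of_mul_eq_one_right h1

/-- Domination exhibits each center as the image of the closed point under a morphism `Spec O ⟶ X`
that extends the generic point. Separatedness leaves only one such morphism. -/
theorem IsCenter.eq [IsProper p] {O : ValuationSubring (FunField p)} {x y : X}
    (hx : IsCenter p O x) (hy : IsCenter p O y) : x = y := by
  have key : ∀ z : X, IsCenter p O z → ∃ ψ : X.presheaf.stalk z →+* O, IsLocalHom ψ ∧
      (algebraMap O (FunField p)).comp ψ = stalkToFunField p z := by
    intro z hz
    refine ⟨(stalkToFunField p z).codRestrict O.toSubring fun s => (hz _ ⟨s, rfl⟩).1, ⟨?_⟩, rfl⟩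
    intro s hs
    obtain ⟨t, ht⟩ := hs.exists_right_inv
    have h1 : stalkToFunField p z s * (t : FunField p) = 1 :=
      congrArg (fun w : O => (w : FunField p)) ht
    have h2 : (stalkToFunField p z s)⁻¹ = t := inv_eq_of_mul_eq_one_right h1
    obtain ⟨w, hw⟩ := (hz _ ⟨s, rfl⟩).2 (h2 ▸ t.2)
    refine .of_mul_eq_one w (stalkToFunField_injective (p := p) z ?_)
    rw [map_mul, map_one]
    rw [show stalkToFunField p z w = _ from hw]
    exact mul_inv_cancel₀ (left_ne_zero_of_mul_eq_one h1)
  obtain ⟨ψ, hψ, hψc⟩ := key x hx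
  obtain ⟨χ, hχ, hχc⟩ := key y hy
  have hO : ∀ c : ℂ, algebraMap ℂ (FunField p) c ∈ O :=
    fun c => (hx _ ((localRing p x).algebraMap_mem c)).1
  let ι : ℂ →+* O := (algebraMap ℂ (FunField p)).codRestrict O.toSubring hO
  have hgen : genericMap p ≫ p = Spec.map (CommRingCat.ofHom (algebraMap O (FunField p))) ≫
      Spec.map (CommRingCat.ofHom ι) := by
    rw [genericMap_comp, ← Spec.map_comp]
    rfl
  let S : ValuativeCommSq p :=
    { R := O
      K := FunField p
      i₁ := genericMap p
      i₂ := Spec.map (CommRingCat.ofHom ι)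
      commSq := ⟨hgen⟩ }
  have hlift : ∀ (z : X) (ψ : X.presheaf.stalk z →+* O),
      (algebraMap O (FunField p)).comp ψ = stalkToFunField p z →
      ∃ l : S.commSq.LiftStruct, l.l = Spec.map (CommRingCat.ofHom ψ) ≫ X.fromSpecStalk z := by
    intro z ψ h
    refine ⟨⟨_, spec_algebraMap_comp_fromSpecStalk (p := p) z ψ _ h, ?_⟩, rfl⟩
    change _ = Spec.map (CommRingCat.ofHom ι)
    rw [Category.assoc, fromSpecStalk_comp, ← Spec.map_comp, ← CommRingCat.ofHom_comp]
    congr 2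
    ext c
    refine (RingHom.congr_fun h _).trans ?_
    rw [RingHom.comp_apply, stalkToFunField_germ, toFunField_constants]
    rfl
  obtain ⟨l, hl⟩ := hlift x ψ hψc
  obtain ⟨l', hl'⟩ := hlift y χ hχc
  have hll : l = l' := (IsSeparated.valuativeCriterion p S).elim l l'
  have hmaps : Spec.map (CommRingCat.ofHom ψ) ≫ X.fromSpecStalk x =
      Spec.map (CommRingCat.ofHom χ) ≫ X.fromSpecStalk y := hl.symm.trans (hll ▸ hl')
  refine (map_closedPoint_fromSpecStalk x (CommRingCat.ofHom ψ) hψ).symm.trans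
    (Eq.trans ?_ (map_closedPoint_fromSpecStalk y (CommRingCat.ofHom χ) hχ))
  exact congrArg (fun m : Spec (.of O) ⟶ X => m (IsLocalRing.closedPoint O)) hmaps

end

/-! ### Valuation rings of function fields in one variable -/

section

variable {k K : Type*} [Field k] [Field K] [Algebra k K] (O : ValuationSubring K)

theorem mem_valuationSubring_of_isIntegral {R : Type*} [CommRing R] [Algebra R K]
    (h : ∀ r, algebraMap R K r ∈ O) {z : K} (hz : IsIntegral R z) : z ∈ O := by
  obtain ⟨P, hP, h0⟩ := hz
  let i : R →+* O := (algebraMap R K).codRestrict O.toSubring h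
  have : IsIntegral O z := ⟨P.map i, hP.map i, by rw [Polynomial.eval₂_map]; exact h0⟩
  obtain ⟨y, rfl⟩ := IsIntegrallyClosed.isIntegral_iff.mp this
  exact y.2

theorem valuation_algebraMap_eq_one (hO : ∀ c : k, algebraMap k K c ∈ O) {c : k} (hc : c ≠ 0) :
    O.valuation (algebraMap k K c) = 1 := by
  have h := (O.valuation_le_one_iff _).mpr (hO c)
  have h' := (O.valuation_le_one_iff _).mpr (hO c⁻¹)
  refine le_antisymm h ?_
  rw [map_inv₀, map_inv₀] at h'
  exact (inv_le_one₀ (zero_lt_iff.mpr (by simpa using hc))).mp h'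

/-- The residue field of a nontrivial valuation of a function field of one variable over an
algebraically closed field is the ground field. -/
theorem exists_valuation_sub_algebraMap_lt_one [IsAlgClosed k] (htr : Algebra.trdeg k K = 1)
    (hO : ∀ c : k, algebraMap k K c ∈ O) (hne : O ≠ ⊤) {f : K} (hf : f ∈ O) :
    ∃ c : k, O.valuation (f - algebraMap k K c) < 1 := by
  by_contra! H
  have H1 : ∀ c : k, O.valuation (f - algebraMap k K c) = 1 := fun c =>
    le_antisymm ((O.valuation_le_one_iff _).mpr (sub_mem hf (hO c))) (H c)
  -- If all `f - c` are units of `O`, so is every nonzero polynomial in `f`, since it splits into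
  -- such factors. Then `O` contains `k(f)`, over which `K` is algebraic, and so `O` is all of `K`.
  have hpoly : ∀ q : Polynomial k, q ≠ 0 → O.valuation (Polynomial.aeval f q) = 1 := by
    intro q hq
    have hs := (IsAlgClosed.splits q).eq_prod_roots
    rw [hs, map_mul, map_mul, Polynomial.aeval_C, valuation_algebraMap_eq_one O hO (by simpa),
      one_mul, map_multiset_prod, map_multiset_prod, Multiset.map_map, Multiset.map_map]
    refine Multiset.prod_eq_one fun x hx => ?_
    obtain ⟨a, -, rfl⟩ := Multiset.mem_map.mp hx
    simpa using H1 a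
  have hft : Transcendental k f := by
    rw [transcendental_iff]
    intro q h0
    by_contra hq
    simpa [h0] using hpoly q hq
  have := isAlgebraic_adjoin_simple_of_trdeg htr hft
  refine hne (top_le_iff.mp fun z _ => ?_)
  refine mem_valuationSubring_of_isIntegral O (R := IntermediateField.adjoin k {f}) ?_
    (Algebra.IsIntegral.isIntegral z)
  rintro ⟨r, hr⟩
  obtain ⟨a, b, rfl⟩ := (IntermediateField.mem_adjoin_simple_iff _ _).mp hr
  rw [← O.valuation_le_one_iff]
  change O.valuation (_ / _) ≤ 1
  by_cases hb : b = 0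
  · simp [hb]
  by_cases ha : a = 0
  · simp [ha]
  rw [map_div₀, hpoly a ha, hpoly b hb, div_one]

end

section

variable {X : Scheme.{0}} [IsIntegral X] {p : X ⟶ SpecC}

theorem isCenter_valuationRing [SmoothOfRelativeDimension 1 p] (x : X) :
    IsCenter p (valuationRing p x) x := fun _ hf => ⟨hf, id⟩

theorem valuationRing_injective [SmoothOfRelativeDimension 1 p] [IsProper p] {x y : X}
    (h : valuationRing p x = valuationRing p y) : x = y :=
  (isCenter_valuationRing x).eq (h ▸ isCenter_valuationRing y)

theorem algebraMap_mem_valuationRing [SmoothOfRelativeDimension 1 p] (x : X) (c : ℂ) :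
    algebraMap ℂ (FunField p) c ∈ valuationRing p x := (localRing p x).algebraMap_mem c

theorem localRing_genericPoint : localRing p (genericPoint X) = ⊤ := by
  refine top_le_iff.mp fun f _ => ⟨f, ?_⟩
  change X.presheaf.stalkSpecializes _ f = f
  rw [TopCat.Presheaf.stalkSpecializes_refl]
  rfl

theorem valuationRing_ne_top [SmoothOfRelativeDimension 1 p] [IsProper p] {x : X}
    (h : x ≠ genericPoint X) : valuationRing p x ≠ ⊤ := by
  refine fun h' => h (valuationRing_injective (p := p) (h'.trans ?_))
  refine (top_le_iff.mp fun f _ => ?_).symm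
  rw [mem_valuationRing, localRing_genericPoint]
  trivial

theorem valuation_stalkToFunField_eq_one_iff [SmoothOfRelativeDimension 1 p] {x : X}
    {s : X.presheaf.stalk x} :
    (valuationRing p x).valuation (stalkToFunField p x s) = 1 ↔ IsUnit s := by
  have hm : stalkToFunField p x s ∈ valuationRing p x := ⟨s, rfl⟩
  have h1 := (valuationRing p x).valuation_eq_one_iff ⟨_, hm⟩
  rw [← h1]
  constructor
  · intro h
    obtain ⟨⟨t, w, hw⟩, ht⟩ := h.exists_right_inv
    refine .of_mul_eq_one w (stalkToFunField_injective (p := p) x ?_)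
    rw [map_mul, map_one]
    have h2 := congrArg Subtype.val ht
    change _ * t = 1 at h2
    rw [← h2, ← hw]
  · intro h
    obtain ⟨t, ht⟩ := h.exists_right_inv
    refine .of_mul_eq_one ⟨stalkToFunField p x t, t, rfl⟩ (Subtype.ext ?_)
    change stalkToFunField p x s * stalkToFunField p x t = 1
    rw [← map_mul, ht, map_one]

theorem exists_fraction_of_mem_valuationRing [SmoothOfRelativeDimension 1 p] {U : X.Opens}
    (hU : IsAffineOpen U) {x : X} (hx : x ∈ U) {f : FunField p} (hf : f ∈ valuationRing p x) :
    ∃ a b : Γ(X, U),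
      (valuationRing p x).valuation (toFunField p U (genericPoint_mem_of_mem hx) b) = 1 ∧
      f * toFunField p U (genericPoint_mem_of_mem hx) b =
        toFunField p U (genericPoint_mem_of_mem hx) a := by
  obtain ⟨a, b, hb, h⟩ := exists_fraction_of_mem_localRing hU hx hf
  refine ⟨a, b, ?_, h⟩
  rw [← stalkToFunField_germ hx]
  exact valuation_stalkToFunField_eq_one_iff.mpr hb

theorem toFunField_mem_valuationRing [SmoothOfRelativeDimension 1 p] {U : X.Opens} {x : X}
    (hx : x ∈ U) (s : Γ(X, U)) :
    toFunField p U (genericPoint_mem_of_mem hx) s ∈ valuationRing p x :=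
  sectionRing_le_localRing hx ⟨s, rfl⟩

/-- Every local ring of a smooth curve has a uniformizer. -/
theorem exists_uniformizer [SmoothOfRelativeDimension 1 p] (x : X) :
    ∃ t : FunField p, (valuationRing p x).valuation t < 1 ∧
      (∀ f, (valuationRing p x).valuation f < 1 →
        (valuationRing p x).valuation f ≤ (valuationRing p x).valuation t) ∧
      ∀ f ≠ 0, ∃ m, (valuationRing p x).valuation t ^ m ≤ (valuationRing p x).valuation f := by
  set O := valuationRing p x
  have := isPrincipalIdealRing_stalk (p := p) x
  obtain ⟨π, hπ⟩ := IsPrincipalIdealRing.principal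
    (IsLocalRing.maximalIdeal (X.presheaf.stalk x))
  rw [Ideal.submodule_span_eq] at hπ
  have hle : ∀ s, O.valuation (stalkToFunField p x s) ≤ 1 := fun s =>
    (O.valuation_le_one_iff _).mpr ⟨s, rfl⟩
  have hlt : ∀ s, O.valuation (stalkToFunField p x s) < 1 ↔ π ∣ s := by
    intro s
    rw [(hle s).lt_iff_ne, Ne, valuation_stalkToFunField_eq_one_iff, ← Ideal.mem_span_singleton,
      ← hπ, IsLocalRing.mem_maximalIdeal]
    rfl
  refine ⟨stalkToFunField p x π, (hlt π).mpr dvd_rfl, fun f hf => ?_, fun f hf => ?_⟩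
  · obtain ⟨s, rfl⟩ : f ∈ localRing p x := (O.valuation_le_one_iff _).mp hf.le
    obtain ⟨w, rfl⟩ := (hlt s).mp hf
    change O.valuation (stalkToFunField p x (π * w)) ≤ _
    rw [map_mul, map_mul]
    exact mul_le_of_le_one_right' (hle w)
  · obtain ⟨a, b, hb, hab⟩ := IsFractionRing.div_surjective (A := X.presheaf.stalk x)
      (K := X.functionField) f
    have ha0 : a ≠ 0 := by
      rintro rfl
      refine hf (hab.symm.trans ?_)
      rw [map_zero, zero_div]
      rfl
    have hπu : ¬ IsUnit π := by
      rw [← mem_nonunits_iff, ← IsLocalRing.mem_maximalIdeal, hπ]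
      exact Ideal.mem_span_singleton_self π
    obtain ⟨w, hw, hdvd⟩ :=
      (FiniteMultiplicity.of_not_isUnit hπu ha0).exists_eq_pow_mul_and_not_dvd
    have hval : O.valuation (stalkToFunField p x a) =
        O.valuation (stalkToFunField p x π) ^ multiplicity π a := by
      have h1 := congrArg (fun s => O.valuation (stalkToFunField p x s)) hw
      simp only [map_mul, map_pow] at h1
      rwa [(hle w).antisymm (not_lt.mp ((hlt w).not.mpr hdvd)), mul_one] at h1
    refine ⟨multiplicity π a, hval.symm.trans_le ?_⟩
    · have hb0 : stalkToFunField p x b ≠ 0 := fun h0 => nonZeroDivisors.ne_zero hb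
        (stalkToFunField_injective (p := p) x (h0.trans (map_zero _).symm))
      have h1 : stalkToFunField p x a = f * stalkToFunField p x b :=
        (div_eq_iff hb0).mp hab
      rw [h1, map_mul]
      exact mul_le_of_le_one_right' (hle b)

end

/-! ### Curves of genus zero are rational -/

/-- The product of the multipliers of finitely many generators works for all elements. It serves to
turn the statement that a uniformizer generates the maximal ideal locally into one common
denominator. -/
theorem exists_notMem_mul_mem_of_fg {R : Type*} [CommRing R] {I J : Ideal R} (hI : I.FG)
    (S : Submonoid R) (h : ∀ m ∈ I, ∃ b ∈ S, b * m ∈ J) : ∃ b ∈ S, ∀ m ∈ I, b * m ∈ J := by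
  obtain ⟨s, rfl⟩ := hI
  choose! b hbS hb using h
  refine ⟨∏ m ∈ s, b m, prod_mem fun m hm => hbS m (Ideal.subset_span hm), fun m hm => ?_⟩
  induction hm using Submodule.span_induction with
  | mem m hm =>
    obtain ⟨c, hc⟩ := Finset.dvd_prod_of_mem b hm
    rw [hc, mul_assoc, mul_left_comm]
    exact J.mul_mem_left _ (hb m (Ideal.subset_span hm))
  | zero => simp
  | add x y _ _ hx hy => rw [mul_add]; exact J.add_mem hx hy
  | smul r x _ hx => rw [smul_eq_mul, mul_left_comm]; exact J.mul_mem_left _ hx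

section

variable {X : Scheme.{0}} [IsIntegral X] {p : X ⟶ SpecC}
  [SmoothOfRelativeDimension 1 p] [IsProper p]

/-- If the proper curve were affine, every rational function would be a quotient of two global
functions. These are constants, whereas the function field has transcendence degree one. -/
theorem not_isAffineOpen_top {X : Scheme.{0}} [IsIntegral X] (p : X ⟶ SpecC)
    [SmoothOfRelativeDimension 1 p] [IsProper p] : ¬ IsAffineOpen (⊤ : X.Opens) := by
  intro h
  obtain ⟨u, hu⟩ := exists_transcendental_of_trdeg (trdeg_funField (p := p))
  obtain ⟨a, b, hb, hab⟩ := exists_fraction (p := p) h (Opens.mem_top _) u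
  have hc : ∀ s, ∃ c : ℂ, algebraMap ℂ (FunField p) c = toFunField p ⊤ (Opens.mem_top _) s :=
    fun s => mem_range_algebraMap_of_forall_mem_localRing fun x =>
      sectionRing_le_localRing (Opens.mem_top x) ⟨s, rfl⟩
  obtain ⟨c, hc'⟩ := hc a
  obtain ⟨d, hd'⟩ := hc b
  rw [← hc', ← hd'] at hab
  rw [← hd'] at hb
  refine hu ?_
  rw [eq_div_of_mul_eq hb hab, ← map_div₀]
  exact isAlgebraic_algebraMap _

variable (p) in
-- The residue field at `P` is `ℂ`, so a function regular at `P` is a constant plus an element of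
-- the maximal ideal at `P`. Inclusion of valuation rings reverses the inclusion of maximal ideals,
-- so that element is regular at `Q` too.
theorem valuationRing_eq_of_le {P Q : X} (hgen : P ≠ genericPoint X)
    (h : valuationRing p Q ≤ valuationRing p P) : Q = P := by
  refine valuationRing_injective (p := p) (le_antisymm h fun f hf => ?_)
  obtain ⟨c, hc⟩ := exists_valuation_sub_algebraMap_lt_one _ (trdeg_funField (p := p))
    (algebraMap_mem_valuationRing P) (valuationRing_ne_top hgen) hf
  have h1 := ValuationSubring.nonunits_le_nonunits.mpr h hc
  have h2 := (ValuationSubring.valuation_le_one_iff _ _).mp (le_of_lt h1)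
  exact sub_add_cancel f (algebraMap ℂ (FunField p) c) ▸
    add_mem h2 (algebraMap_mem_valuationRing Q c)

/-- For a closed point `P` of an affine open set `U` there is a rational function with a simple
pole at `P` and no other poles in `U`. -/
theorem exists_simple_pole {U : X.Opens} (hU : IsAffineOpen U) {P : X} (hP : P ∈ U)
    (hgen : P ≠ genericPoint X) : ∃ t h : FunField p,
      (valuationRing p P).valuation t < 1 ∧
      (∀ f, (valuationRing p P).valuation f < 1 →
        (valuationRing p P).valuation f ≤ (valuationRing p P).valuation t) ∧
      (valuationRing p P).valuation (t * h) = 1 ∧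
      ∀ Q ∈ U, Q ≠ P → h ∈ localRing p Q := by
  set O := valuationRing p P with hO
  let i := toFunField p U (genericPoint_mem_of_mem hP)
  have hi1 : ∀ s, O.valuation (i s) ≤ 1 := fun s =>
    (O.valuation_le_one_iff _).mpr (toFunField_mem_valuationRing hP s)
  have : IsLocallyNoetherian X := LocallyOfFiniteType.isLocallyNoetherian p
  have : IsNoetherianRing Γ(X, U) := IsLocallyNoetherian.component_noetherian ⟨U, hU⟩
  obtain ⟨t₀, ht₀, htmax, -⟩ := exists_uniformizer (p := p) P
  obtain ⟨t, b₀, hb₀, htb⟩ := exists_fraction_of_mem_valuationRing (p := p) hU hP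
    (f := t₀) ((O.valuation_le_one_iff _).mp ht₀.le)
  have hvt : O.valuation (i t) = O.valuation t₀ := by
    change O.valuation (toFunField p U _ t) = _
    rw [← htb, map_mul, hb₀, mul_one]
  have ht0 : i t ≠ 0 := by
    intro h0
    refine valuationRing_ne_top (p := p) hgen (top_le_iff.mp fun f _ => ?_)
    by_contra hf
    have h1 := htmax f⁻¹ ((ValuationSubring.inv_mem_nonunits_iff _).mpr (.inr hf))
    rw [← hvt, h0, map_zero, le_zero_iff, map_eq_zero, inv_eq_zero] at h1
    exact hf (h1 ▸ zero_mem _)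
  let I : Ideal Γ(X, U) :=
    { carrier := {s | O.valuation (i s) < 1}
      add_mem' := fun {a b} ha hb => by
        change O.valuation (i (a + b)) < 1
        rw [map_add]
        exact Valuation.map_add_lt _ ha hb
      zero_mem' := by simp
      smul_mem' := fun c s hs => by
        change O.valuation (i (c * s)) < 1
        rw [map_mul, map_mul]
        exact (mul_le_of_le_one_left' (hi1 c)).trans_lt hs }
  let S : Submonoid Γ(X, U) :=
    { carrier := {s | O.valuation (i s) = 1}
      one_mem' := by simp
      mul_mem' := fun {a b} ha hb => by
        change O.valuation (i (a * b)) = 1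
        rw [map_mul, map_mul, ha, hb, one_mul] }
  -- `I` is the prime ideal of `P` and `t` generates it in the local ring there. One `b` not
  -- vanishing at `P` satisfies `b * I ⊆ (t)`, and `b / t` is the desired function.
  obtain ⟨b, hb, hbI⟩ := exists_notMem_mul_mem_of_fg (J := Ideal.span {t})
      ((isNoetherianRing_iff_ideal_fg _).mp ‹_› I) S fun m hm => by
    have h1 : i m / i t ∈ O := by
      rw [← O.valuation_le_one_iff, map_div₀, hvt]
      exact div_le_one_of_le₀ (htmax _ hm) zero_le
    obtain ⟨w, b, hb, hwb⟩ := exists_fraction_of_mem_valuationRing (p := p) hU hP h1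
    refine ⟨b, hb, Ideal.mem_span_singleton.mpr ⟨w, ?_⟩⟩
    apply toFunField_injective (p := p) U (genericPoint_mem_of_mem hP)
    rw [map_mul, map_mul, ← hwb]
    change _ = i t * (i m / i t * _)
    field_simp
    rfl
  refine ⟨i t, i b / i t, hvt.trans_lt ht₀, fun f hf => hvt ▸ htmax f hf, ?_, ?_⟩
  · rw [mul_div_cancel₀ _ ht0]
    exact hb
  · intro Q hQ hQP
    let j := valuationRing p Q
    have hiQ : ∀ s, j.valuation (i s) ≤ 1 := fun s =>
      (j.valuation_le_one_iff _).mpr (toFunField_mem_valuationRing hQ s)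
    -- Some `m` in the prime ideal of `P` is invertible at `Q`, for otherwise the local ring at `Q`
    -- would lie in that at `P`. From `b * m = t * e` follows `b / t = e / m`, which is regular at
    -- `Q`.
    obtain ⟨m, hm, hmQ⟩ : ∃ m ∈ I, j.valuation (i m) = 1 := by
      by_contra! H
      have H' : ∀ m ∈ I, j.valuation (i m) < 1 := fun m hm => (hiQ m).lt_of_ne (H m hm)
      have hle : j ≤ O := by
        intro f hf
        obtain ⟨a, b, hb, hab⟩ := exists_fraction_of_mem_valuationRing (p := p) hU hQ hf
        have hbO : O.valuation (i b) = 1 :=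
          (hi1 b).antisymm (not_lt.mp fun h => (H' b h).ne hb)
        rw [← O.valuation_le_one_iff]
        have h1 := congrArg O.valuation hab
        rw [map_mul] at h1
        change _ * O.valuation (i b) = O.valuation (i a) at h1
        rw [hbO, mul_one] at h1
        exact h1 ▸ hi1 a
      exact hQP (valuationRing_eq_of_le p hgen hle)
    have h1 := hbI m hm
    obtain ⟨e, he⟩ := Ideal.mem_span_singleton.mp h1
    have h2 : i b / i t = i e / i m := by
      have hm0 : i m ≠ 0 := by
        rintro h0
        rw [h0, map_zero] at hmQ
        exact zero_ne_one hmQ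
      rw [div_eq_div_iff ht0 hm0, ← map_mul, he, map_mul, mul_comm]
    rw [h2, ← mem_valuationRing, ← ValuationSubring.valuation_le_one_iff, map_div₀]
    change j.valuation _ / j.valuation _ ≤ 1
    rw [hmQ, div_one]
    exact hiQ e

variable (p) in
/-- On a curve of genus zero there is a rational function with a single, simple, pole. -/
theorem HasGenus.exists_single_pole (hg : HasGenus p 0) : ∃ (P : X) (x : FunField p),
    P ≠ genericPoint X ∧ 1 < (valuationRing p P).valuation x ∧
    (∀ f, (valuationRing p P).valuation f < 1 → (valuationRing p P).valuation (f * x) ≤ 1) ∧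
    ∀ Q ≠ P, x ∈ localRing p Q := by
  obtain ⟨U, V, hU, hV, hUV, hfin, hrank⟩ := hg
  have hVtop : V ≠ ⊤ := fun h => not_isAffineOpen_top p (h ▸ hV)
  have hUtop : U ≠ ⊤ := fun h => not_isAffineOpen_top p (h ▸ hU)
  have hne : ∀ W : X.Opens, W ≠ ⊥ → genericPoint X ∈ W := fun W hW => by
    obtain ⟨x, hx⟩ := (Opens.ne_bot_iff_nonempty W).mp hW
    exact genericPoint_mem_of_mem hx
  have hgU : genericPoint X ∈ U := hne U fun h => hVtop (by rwa [h, bot_sup_eq] at hUV)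
  have hgV : genericPoint X ∈ V := hne V fun h => hUtop (by rwa [h, sup_bot_eq] at hUV)
  -- A function with its only pole in `U` at a point outside `V` is regular on `U ⊓ V`, hence is a
  -- Čech cocycle.
  obtain ⟨P, hPV⟩ : ∃ P, P ∉ V := by
    by_contra! h
    exact hVtop (top_le_iff.mp fun x _ => h x)
  have hmem : ∀ Q, Q ∈ U ∨ Q ∈ V := fun Q => by
    have : Q ∈ U ⊔ V := hUV ▸ Opens.mem_top Q
    exact this
  have hPU : P ∈ U := (hmem P).resolve_right hPV
  have hPgen : P ≠ genericPoint X := fun h => hPV (h ▸ hgV)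
  obtain ⟨t, h, ht, htmax, hth, hreg⟩ := exists_simple_pole (p := p) hU hPU hPgen
  set O := valuationRing p P with hO
  obtain ⟨s, hs⟩ := mem_sectionRing.mp (mem_sectionRing_of_forall (p := p) (U := U ⊓ V)
    (hU := ⟨hgU, hgV⟩) (f := h) fun Q hQ => hreg Q hQ.1 fun h => hPV (h ▸ hQ.2))
  -- Genus zero splits `h` as `a + b` with `a` regular on `U` and `b` on `V`. Then `b = h - a` keeps
  -- the simple pole at `P` and has no other pole anywhere.
  have hsub : Subsingleton (CechH1 p U V) := by
    exact Module.finrank_zero_iff.mp hrank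
  obtain ⟨a, b, hab⟩ : ∃ (a : Γ(X, U)) (b : Γ(X, V)),
      restrict (inf_le_left : U ⊓ V ≤ U) a + restrict (inf_le_right : U ⊓ V ≤ V) b = s := by
    let s' : Sections p (U ⊓ V) := s
    have hsr : s' ∈
        (LinearMap.range (Sections.res p (inf_le_left : U ⊓ V ≤ U)).toLinearMap ⊔
        LinearMap.range (Sections.res p (inf_le_right : U ⊓ V ≤ V)).toLinearMap) :=
      (Submodule.Quotient.mk_eq_zero _).mp (hsub.elim _ _)
    obtain ⟨_, ⟨a, rfl⟩, _, ⟨b, rfl⟩, hab⟩ := Submodule.mem_sup.mp hsr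
    exact ⟨a, b, hab⟩
  have hsum : toFunField p U hgU a + toFunField p V hgV b = h := by
    rw [← hs, ← hab, ← toFunField_restrict (inf_le_left : U ⊓ V ≤ U) ⟨hgU, hgV⟩,
      ← toFunField_restrict (inf_le_right : U ⊓ V ≤ V) ⟨hgU, hgV⟩, map_add]
  have haO : O.valuation (toFunField p U hgU a) ≤ 1 :=
    (O.valuation_le_one_iff _).mpr (toFunField_mem_valuationRing hPU a)
  have hb : toFunField p V hgV b = h - toFunField p U hgU a := eq_sub_of_add_eq' hsum
  have htx : O.valuation (t * toFunField p V hgV b) = 1 := by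
    rw [hb, mul_sub, Valuation.map_sub_eq_of_lt_left, hth]
    rw [hth, map_mul]
    exact (mul_le_of_le_one_right' haO).trans_lt ht
  refine ⟨P, toFunField p V hgV b, hPgen, ?_, fun f hf => ?_, fun Q hQ => ?_⟩
  · by_contra! hle
    refine htx.not_lt ?_
    rw [map_mul]
    exact (mul_le_of_le_one_right' hle).trans_lt ht
  · rw [← htx, map_mul, map_mul]
    exact mul_le_mul_left (htmax f hf) _
  · obtain h1 | h1 := hmem Q
    · rw [hb]
      exact sub_mem (hreg Q h1 hQ) (sectionRing_le_localRing h1 ⟨a, rfl⟩)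
    · exact sectionRing_le_localRing h1 ⟨b, rfl⟩

variable (p) in
/-- The function field of a curve of genus zero is a rational function field. -/
theorem HasGenus.exists_adjoin_eq_top (hg : HasGenus p 0) : ∃ x : FunField p,
    Transcendental ℂ x ∧ IntermediateField.adjoin ℂ {x} = ⊤ := by
  obtain ⟨P, x, hPgen, hx, hx1, hreg⟩ := hg.exists_single_pole
  set O := valuationRing p P with hO
  have hx0 : x ≠ 0 := by
    rintro rfl
    simp at hx
  have hinv : O.valuation x⁻¹ < 1 := by
    rw [map_inv₀]
    exact inv_lt_one_of_one_lt₀ hx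
  -- Subtracting a multiple of `x ^ (m + 1)` lowers the order of the pole at `P`, and without a pole
  -- the function is constant. Thus functions with poles only at `P` are polynomials in `x`.
  have hpoly : ∀ m : ℕ, ∀ f : FunField p, (∀ Q ≠ P, f ∈ localRing p Q) →
      O.valuation f ≤ O.valuation x ^ m → f ∈ Algebra.adjoin ℂ {x} := by
    intro m
    induction m with
    | zero =>
      intro f hf hfm
      obtain ⟨c, rfl⟩ := mem_range_algebraMap_of_forall_mem_localRing (p := p) (f := f) fun Q => by
        by_cases h : Q = P
        · subst h
          exact (O.valuation_le_one_iff _).mp (by simpa using hfm)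
        · exact hf Q h
      exact Subalgebra.algebraMap_mem _ c
    | succ m ih =>
      intro f hf hfm
      obtain ⟨c, hc⟩ := exists_valuation_sub_algebraMap_lt_one O (trdeg_funField (p := p))
        (algebraMap_mem_valuationRing P) (valuationRing_ne_top hPgen)
        (f := f * (x ^ (m + 1))⁻¹) (by
          rw [← O.valuation_le_one_iff, map_mul, map_inv₀, map_pow]
          exact mul_inv_le_one_of_le₀ hfm zero_le)
      have hmem : f - c • x ^ (m + 1) ∈ Algebra.adjoin ℂ {x} := by
        refine ih _ (fun Q hQ => sub_mem (hf Q hQ)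
          (Subalgebra.smul_mem _ (pow_mem (hreg Q hQ) _) c)) ?_
        have h1 := hx1 _ hc
        have h2 : f - c • x ^ (m + 1) =
            (f * (x ^ (m + 1))⁻¹ - algebraMap ℂ (FunField p) c) * x * x ^ m := by
          have h3 : f * (x ^ (m + 1))⁻¹ * x ^ (m + 1) = f :=
            inv_mul_cancel_right₀ (pow_ne_zero _ hx0) f
          rw [Algebra.smul_def, mul_assoc, ← pow_succ', sub_mul, h3]
        rw [h2, map_mul, map_pow]
        exact mul_le_of_le_one_left' h1
      rw [← sub_add_cancel f (c • x ^ (m + 1))]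
      exact add_mem hmem (Subalgebra.smul_mem _
        (pow_mem (Algebra.self_mem_adjoin_singleton ℂ x) _) c)
  have hxt : Transcendental ℂ x := fun halg => by
    exact hx.not_ge ((O.valuation_le_one_iff _).mpr (mem_valuationSubring_of_isIntegral O
      (algebraMap_mem_valuationRing P) halg.isIntegral))
  refine ⟨x, hxt, top_le_iff.mp fun z _ => ?_⟩
  have := isAlgebraic_adjoin_simple_of_trdeg (trdeg_funField (p := p)) hxt
  let A := Algebra.adjoin ℂ {x}
  have halg : IsAlgebraic A z := by
    open scoped IntermediateField.algebraAdjoinAdjoin in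
    exact (IsFractionRing.isAlgebraic_iff A (IntermediateField.adjoin ℂ {x}) _).mpr
      (Algebra.IsAlgebraic.isAlgebraic z)
  -- A nonzero polynomial multiple of `z` is integral over `ℂ[x]`, hence regular away from `P`,
  -- hence itself a polynomial in `x`.
  obtain ⟨y, hy0, hyz⟩ := halg.exists_integral_multiple
  have hyreg : ∀ Q ≠ P, y • z ∈ localRing p Q := fun Q hQ => by
    rw [← mem_valuationRing]
    refine mem_valuationSubring_of_isIntegral _ (R := A) ?_ hyz
    rintro ⟨r, hr⟩
    have hle : Algebra.adjoin ℂ {x} ≤ localRing p Q :=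
      Algebra.adjoin_le (by simpa using hreg Q hQ)
    exact hle hr
  obtain ⟨t, ht, htmax, hpow⟩ := exists_uniformizer (p := p) P
  have hyzA : y • z ∈ A := by
    by_cases h0 : y • z = 0
    · rw [h0]; exact zero_mem _
    obtain ⟨m, hm⟩ := hpow (y • z)⁻¹ (inv_ne_zero h0)
    refine hpoly m _ hyreg ?_
    have h1 := htmax _ hinv
    rw [map_inv₀] at h1 hm
    have h2 := (pow_le_pow_left₀ zero_le h1 m).trans hm
    rw [inv_pow] at h2
    exact (inv_le_inv₀ (pow_pos (zero_lt_one.trans hx) m)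
      (zero_lt_iff.mpr ((map_ne_zero _).mpr h0))).mp h2
  have hle := IntermediateField.algebra_adjoin_le_adjoin ℂ ({x} : Set (FunField p))
  have hyne : (y : FunField p) ≠ 0 := fun h => hy0 (Subtype.ext h)
  have : z = (y : FunField p)⁻¹ * (y • z) := by
    rw [Algebra.smul_def]
    exact (inv_mul_cancel_left₀ hyne z).symm
  rw [this]
  exact mul_mem (inv_mem (hle y.2)) (hle hyzA)

end

/-! ### The standard chart of the projective line -/

attribute [local instance] MvPolynomial.gradedAlgebra

/-- The grading of the homogeneous coordinate ring of `ℙ¹`. -/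
abbrev lineGrading : ℕ → Submodule ℂ (MvPolynomial (Fin (1 + 1)) ℂ) :=
  MvPolynomial.homogeneousSubmodule (Fin (1 + 1)) ℂ

theorem X_mem_lineGrading (i : Fin (1 + 1)) : MvPolynomial.X i ∈ lineGrading 1 :=
  MvPolynomial.isHomogeneous_X ℂ i

/-- The coordinate ring of the standard chart of `ℙ¹`. -/
abbrev ChartRing : Type :=
  HomogeneousLocalization.Away lineGrading (MvPolynomial.X 0)

/-- The affine coordinate of `ℙ¹`. -/
def chartCoord : ChartRing :=
  HomogeneousLocalization.Away.mk lineGrading (X_mem_lineGrading 0) 1 (MvPolynomial.X 1)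
    (by simpa using X_mem_lineGrading 1)

/-- The constants in the coordinate ring of the standard chart. -/
def chartConst : ℂ →+* ChartRing :=
  (HomogeneousLocalization.fromZeroRingHom lineGrading _).comp (algebraMap ℂ (lineGrading 0))

theorem val_chartConst (c : ℂ) :
    (chartConst c).val = algebraMap (MvPolynomial (Fin (1 + 1)) ℂ) _ (MvPolynomial.C c) := by
  change Localization.mk _ _ = _
  rw [← Localization.mk_one_eq_algebraMap]
  rfl

theorem val_chartCoord_mul :
    chartCoord.val * algebraMap (MvPolynomial (Fin (1 + 1)) ℂ) _ (MvPolynomial.X 0) =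
      algebraMap (MvPolynomial (Fin (1 + 1)) ℂ) (Localization.Away (MvPolynomial.X 0))
        (MvPolynomial.X 1) := by
  rw [chartCoord, HomogeneousLocalization.Away.val_mk, Localization.mk_eq_mk']
  simp

/-- Dehomogenization: a monomial `X₀ ^ i * X₁ ^ j` divided by `X₀ ^ (i + j)` is the `j`-th power of
the coordinate. -/
theorem exists_eval₂_chartCoord (a : ChartRing) :
    ∃ P : Polynomial ℂ, a = P.eval₂ chartConst chartCoord := by
  obtain ⟨n, x, hx, rfl⟩ :=
    HomogeneousLocalization.Away.mk_surjective lineGrading (X_mem_lineGrading 0) a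
  have hx' : x.IsHomogeneous n := by simpa using hx
  refine ⟨∑ d ∈ x.support, Polynomial.monomial (d 1) (x.coeff d),
    HomogeneousLocalization.val_injective _ ?_⟩
  let ι := algebraMap (MvPolynomial (Fin (1 + 1)) ℂ)
    (Localization.Away (MvPolynomial.X (R := ℂ) (0 : Fin (1 + 1))))
  rw [HomogeneousLocalization.Away.val_mk, Localization.mk_eq_mk',
    IsLocalization.mk'_eq_iff_eq_mul]
  change ι x = _ * ι (MvPolynomial.X 0 ^ n)
  rw [Polynomial.eval₂_finsetSum, ← HomogeneousLocalization.algebraMap_apply, map_sum,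
    Finset.sum_mul]
  conv_lhs => rw [x.as_sum, map_sum]
  refine Finset.sum_congr rfl fun d hd => ?_
  have hdn : d 0 + d 1 = n := by
    have := hx' (MvPolynomial.mem_support_iff.mp hd)
    rw [← this, Finsupp.weight_apply, Finsupp.sum_fintype _ _ (by simp), Fin.sum_univ_two]
    simp
  rw [Polynomial.eval₂_monomial, map_mul, map_pow, HomogeneousLocalization.algebraMap_apply,
    HomogeneousLocalization.algebraMap_apply, val_chartConst, map_pow, ← hdn, pow_add,
    MvPolynomial.monomial_eq, Finsupp.prod_fintype _ _ (by simp), Fin.prod_univ_two, map_mul,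
    map_mul, map_pow, map_pow]
  change _ = ι _ * _ * (ι _ ^ _ * ι _ ^ _)
  rw [← val_chartCoord_mul, mul_pow]
  ring

/-- Evaluation at the point with homogeneous coordinates `(1, v)`. -/
theorem exists_chartRing_hom {R : Type*} [CommRing R] (ρ : ℂ →+* R) (v : R) :
    ∃ χ : ChartRing →+* R, χ.comp chartConst = ρ ∧ χ chartCoord = v := by
  let g : MvPolynomial (Fin (1 + 1)) ℂ →+* R := MvPolynomial.eval₂Hom ρ ![1, v]
  have hg : IsUnit (g (MvPolynomial.X 0)) := by simp [g]
  let l : Localization.Away (MvPolynomial.X (R := ℂ) (0 : Fin (1 + 1))) →+* R :=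
    IsLocalization.Away.lift (MvPolynomial.X 0) hg
  refine ⟨l.comp (algebraMap ChartRing _), ?_, ?_⟩
  · ext c
    simp only [RingHom.comp_apply, HomogeneousLocalization.algebraMap_apply, val_chartConst]
    rw [IsLocalization.Away.lift_eq]
    simp [g]
  · have h := congrArg l val_chartCoord_mul
    rw [map_mul, IsLocalization.Away.lift_eq, IsLocalization.Away.lift_eq] at h
    simpa [g] using h

/-- The standard chart of `ℙ¹`. -/
def lineChart : Spec (.of ChartRing) ⟶ ProjSpace 1 :=
  Proj.awayι lineGrading (MvPolynomial.X 0) (X_mem_lineGrading 0) one_pos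

instance : IsOpenImmersion lineChart :=
  inferInstanceAs (IsOpenImmersion (Proj.awayι lineGrading _ _ _))

theorem lineChart_comp :
    lineChart ≫ ProjSpace.toSpecC 1 = Spec.map (CommRingCat.ofHom chartConst) := by
  refine (Category.assoc _ _ _).symm.trans ?_
  refine (congrArg (· ≫ _) (Proj.awayι_toSpecZero lineGrading (MvPolynomial.X 0)
    (X_mem_lineGrading 0) one_pos)).trans ?_
  rw [← Spec.map_comp]
  rfl

/-- The open set covered by the standard chart. -/
def lineOpen : (ProjSpace 1).Opens := Proj.basicOpen lineGrading (MvPolynomial.X 0)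

theorem opensRange_lineChart : lineChart.opensRange = lineOpen := Proj.opensRange_awayι ..

theorem isAffineOpen_lineOpen : IsAffineOpen lineOpen :=
  Proj.isAffineOpen_basicOpen _ _ (X_mem_lineGrading 0) one_pos

/-- Regular functions on the standard chart. -/
def chartSection : CommRingCat.of ChartRing ⟶ Γ(ProjSpace 1, lineOpen) :=
  Proj.awayToSection lineGrading (MvPolynomial.X 0)

instance : IsIso chartSection := by
  have : chartSection =
    (Proj.basicOpenIsoAway lineGrading (MvPolynomial.X 0) (X_mem_lineGrading 0) one_pos).hom := rfl
  rw [this]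
  exact Iso.isIso_hom _

theorem spec_chartSection_comp : Spec.map chartSection ≫ lineChart =
    isAffineOpen_lineOpen.fromSpec := by
  rw [← cancel_epi isAffineOpen_lineOpen.isoSpec.hom]
  have h1 : isAffineOpen_lineOpen.isoSpec.hom ≫ isAffineOpen_lineOpen.fromSpec = lineOpen.ι :=
    isAffineOpen_lineOpen.toSpecΓ_fromSpec
  rw [h1]
  let e := Proj.basicOpenIsoSpec lineGrading (MvPolynomial.X 0) (X_mem_lineGrading 0) one_pos
  have h2 : isAffineOpen_lineOpen.isoSpec.hom ≫ Spec.map chartSection = e.hom := rfl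
  rw [← Category.assoc, h2]
  exact (Category.assoc _ _ _).symm.trans ((congrArg (· ≫ lineOpen.ι) e.hom_inv_id).trans
    (Category.id_comp _))

attribute [local instance] MvPolynomial.gradedAlgebra

/-! ### Morphisms to the projective line and their degrees -/

/-- `degree` is defined through a stalk of the target; this replaces the stalk by its image in the
function field. -/
theorem finrank_eq_finrank_adjoin {k R K : Type*} [Field k] [CommRing R] [Field K] [Algebra k K]
    (j : R →+* K) (hj : Function.Injective j) (u : K)
    (hr : ∀ f, f ∈ IntermediateField.adjoin k {u} ↔ f ∈ j.range) :
    letI := j.toAlgebra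
    Module.finrank R K = Module.finrank (IntermediateField.adjoin k {u}) K := by
  let := j.toAlgebra
  let e : R ≃+* IntermediateField.adjoin k {u} := RingEquiv.ofBijective
    (j.codRestrict _ fun r => (hr _).mpr ⟨r, rfl⟩)
    ⟨fun a b h => hj (congrArg Subtype.val h), fun ⟨f, hf⟩ => by
      obtain ⟨r, rfl⟩ := (hr f).mp hf
      exact ⟨r, rfl⟩⟩
  exact Algebra.finrank_eq_of_equiv_equiv e (RingEquiv.refl K) (by ext r; rfl)

theorem exists_algebraMap_eq_of_isAlgebraic {k K : Type*} [Field k] [IsAlgClosed k] [Field K]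
    [Algebra k K] {x : K} (hx : IsAlgebraic k x) : ∃ c, algebraMap k K c = x := by
  have := IntermediateField.isAlgebraic_adjoin_simple hx.isIntegral
  have h := IntermediateField.mem_adjoin_simple_self k x
  rw [IntermediateField.eq_bot_of_isAlgClosed_of_isAlgebraic (IntermediateField.adjoin k {x})] at h
  exact IntermediateField.mem_bot.mp h

theorem spec_stalkMap_comp_lineChart {T : Scheme.{0}} (m : T ⟶ ProjSpace 1) {τ : T}
    (h : m τ ∈ lineOpen) :
    Spec.map (chartSection ≫ (ProjSpace 1).presheaf.germ lineOpen _ h ≫ m.stalkMap τ) ≫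
      lineChart = T.fromSpecStalk τ ≫ m := by
  rw [← Scheme.SpecMap_stalkMap_fromSpecStalk m,
    ← isAffineOpen_lineOpen.fromSpecStalk_eq_fromSpecStalk h, IsAffineOpen.fromSpecStalk,
    ← spec_chartSection_comp]
  simp only [Spec.map_comp, Category.assoc]

/-- The point with coordinate `c + 1` has this property. It is used to see that a surjective
morphism is not the constant `c`. -/
theorem exists_isUnit_germ_chartSection (c : ℂ) : ∃ (z : ProjSpace 1) (hz : z ∈ lineOpen), IsUnit
    ((ProjSpace 1).presheaf.germ lineOpen z hz (chartSection (chartCoord - chartConst c))) := by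
  obtain ⟨ε, hε, hεc⟩ := exists_chartRing_hom (RingHom.id ℂ) (c + 1)
  let m : SpecC ⟶ ProjSpace 1 := Spec.map (CommRingCat.ofHom ε) ≫ lineChart
  let τ : SpecC := (⊥ : PrimeSpectrum ℂ)
  have hτ : m τ ∈ lineOpen := by
    rw [← opensRange_lineChart]
    exact ⟨Spec.map (CommRingCat.ofHom ε) τ, rfl⟩
  have h1 := spec_stalkMap_comp_lineChart m hτ
  obtain ⟨κ, hκ⟩ := Spec.map_surjective (SpecC.fromSpecStalk τ)
  rw [← hκ] at h1
  replace h1 := h1.trans (Category.assoc _ _ _).symm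
  rw [cancel_mono, ← Spec.map_comp, Spec.map_inj] at h1
  refine ⟨m τ, hτ, ?_⟩
  have h2 := ConcreteCategory.congr_hom h1 (chartCoord - chartConst c)
  refine isUnit_of_map_unit (m.stalkMap τ).hom _ ?_
  refine (congrArg IsUnit h2).mpr ?_
  have h3 : ε (chartCoord - chartConst c) = 1 := by
    rw [map_sub, hεc, ← RingHom.comp_apply, hε, RingHom.id_apply, add_sub_cancel_left]
  change IsUnit (κ.hom (ε (chartCoord - chartConst c)))
  rw [h3, map_one]
  exact isUnit_one

section

variable {X : Scheme.{0}} [IsIntegral X] {p : X ⟶ SpecC} {φ : X ⟶ ProjSpace 1}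

variable (p φ) in
/-- The pullback of rational functions on `ℙ¹`, restricted to the standard chart. -/
def chartHom (hη : φ (genericPoint X) ∈ lineOpen) : ChartRing →+* FunField p :=
  (chartSection ≫ (ProjSpace 1).presheaf.germ lineOpen _ hη ≫ φ.stalkMap (genericPoint X)).hom

theorem genericMap_comp_eq (hη : φ (genericPoint X) ∈ lineOpen) :
    genericMap p ≫ φ = Spec.map (CommRingCat.ofHom (chartHom p φ hη)) ≫ lineChart :=
  (spec_stalkMap_comp_lineChart φ hη).symm

theorem chartHom_comp_chartConst (hφ : φ ≫ ProjSpace.toSpecC 1 = p)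
    (hη : φ (genericPoint X) ∈ lineOpen) :
    (chartHom p φ hη).comp chartConst = algebraMap ℂ (FunField p) := by
  have h3 : Spec.map (CommRingCat.ofHom ((chartHom p φ hη).comp chartConst)) =
      Spec.map (CommRingCat.ofHom (algebraMap ℂ (FunField p))) := by
    rw [← genericMap_comp]
    subst hφ
    rw [← Category.assoc, genericMap_comp_eq hη, Category.assoc, lineChart_comp, ← Spec.map_comp]
    rfl
  exact congrArg CommRingCat.Hom.hom (Spec.map_inj.mp h3)

/-- The pullback of the chart ring is `ℂ[u]`, injectively because `u` is transcendental. Elements of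
the stalk are fractions of chart functions, and a chart function with nonzero pullback is a unit of
the stalk, since the stalk map is a local homomorphism into a field. So the image of the stalk is
exactly `ℂ(u)`. -/
theorem degree_eq_finrank_adjoin (hφ : φ ≫ ProjSpace.toSpecC 1 = p)
    (hη : φ (genericPoint X) ∈ lineOpen)
    (htr : Transcendental ℂ (chartHom p φ hη chartCoord)) : degree φ = Module.finrank
      (IntermediateField.adjoin ℂ {chartHom p φ hη chartCoord}) (FunField p) := by
  set χ := chartHom p φ hη with hχdef
  have h2 : χ.comp chartConst = algebraMap ℂ (FunField p) := chartHom_comp_chartConst hφ hη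
  let j : (ProjSpace 1).presheaf.stalk (φ (genericPoint X)) →+* FunField p :=
    (φ.stalkMap (genericPoint X)).hom
  have hχ : ∀ P : Polynomial ℂ, χ (P.eval₂ chartConst chartCoord) =
      Polynomial.aeval (χ chartCoord) P := fun P => by
    rw [Polynomial.hom_eval₂, h2]
    rfl
  have hχinj : Function.Injective χ := by
    rw [injective_iff_map_eq_zero]
    intro a ha
    obtain ⟨P, rfl⟩ := exists_eval₂_chartCoord a
    rw [hχ] at ha
    rw [(transcendental_iff.mp htr) P ha, Polynomial.eval₂_zero]
  let γ : ChartRing →+* (ProjSpace 1).presheaf.stalk (φ (genericPoint X)) :=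
    (chartSection ≫ (ProjSpace 1).presheaf.germ lineOpen _ hη).hom
  have hjγ : ∀ a, j (γ a) = χ a := fun a => rfl
  have hfrac : ∀ s, ∃ a b : ChartRing, IsUnit (γ b) ∧ s * γ b = γ a := by
    intro s
    let := (ProjSpace 1).presheaf.algebra_section_stalk (U := lineOpen) ⟨_, hη⟩
    have := isAffineOpen_lineOpen.isLocalization_stalk ⟨_, hη⟩
    obtain ⟨⟨a, b⟩, h⟩ := IsLocalization.surj
      (isAffineOpen_lineOpen.primeIdealOf ⟨_, hη⟩).asIdeal.primeCompl s
    have hsurj : Function.Surjective chartSection.hom :=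
      ((ConcreteCategory.isIso_iff_bijective chartSection).mp inferInstance).2
    obtain ⟨a', ha'⟩ := hsurj a
    obtain ⟨b', hb'⟩ := hsurj b
    have hb : IsUnit (γ b') := by
      change IsUnit ((ProjSpace 1).presheaf.germ lineOpen _ hη (chartSection.hom b'))
      rw [hb']
      exact IsLocalization.map_units _ b
    refine ⟨a', b', hb, ?_⟩
    change s * (ProjSpace 1).presheaf.germ lineOpen _ hη (chartSection.hom b') =
      (ProjSpace 1).presheaf.germ lineOpen _ hη (chartSection.hom a')
    rw [ha', hb']
    exact h
  have hjinj : Function.Injective j := by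
    rw [injective_iff_map_eq_zero]
    intro s hs
    obtain ⟨a, b, hb, hab⟩ := hfrac s
    have h3 : χ a = 0 := by rw [← hjγ, ← hab, map_mul, hs, zero_mul]
    rw [(injective_iff_map_eq_zero χ).mp hχinj a h3, map_zero] at hab
    exact hb.mul_left_eq_zero.mp hab
  refine finrank_eq_finrank_adjoin j hjinj (χ chartCoord) fun f => ⟨fun hf => ?_, ?_⟩
  · obtain ⟨P, Q, rfl⟩ := (IntermediateField.mem_adjoin_simple_iff _ _).mp hf
    by_cases hQ : Polynomial.aeval (χ chartCoord) Q = 0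
    · rw [hQ, div_zero]
      exact zero_mem _
    rw [← hχ, ← hjγ] at hQ
    have hu : IsUnit (γ (Q.eval₂ chartConst chartCoord)) :=
      isUnit_of_map_unit (φ.stalkMap (genericPoint X)).hom _ (Ne.isUnit hQ)
    obtain ⟨w, hw⟩ := hu.exists_right_inv
    refine ⟨γ (P.eval₂ chartConst chartCoord) * w, ?_⟩
    rw [← hχ, ← hχ, ← hjγ, ← hjγ, eq_div_iff hQ, ← map_mul, mul_assoc, mul_comm w, hw, mul_one]
  · rintro ⟨s, rfl⟩
    obtain ⟨a, b, hb, hab⟩ := hfrac s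
    have h3 : j s * χ b = χ a := by rw [← hjγ, ← hjγ, ← hab, map_mul]
    have h4 : χ b ≠ 0 := (hjγ b ▸ (hb.map j)).ne_zero
    obtain ⟨P, rfl⟩ := exists_eval₂_chartCoord a
    obtain ⟨Q, rfl⟩ := exists_eval₂_chartCoord b
    rw [eq_div_of_mul_eq h4 h3, hχ, hχ]
    exact (IntermediateField.mem_adjoin_simple_iff _ _).mpr ⟨P, Q, rfl⟩

/-- A surjective morphism from `X` to `ℙ¹` is given by a nonconstant rational function. -/
theorem exists_transcendental_of_surjective (hφ : φ ≫ ProjSpace.toSpecC 1 = p) [Surjective φ] :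
    ∃ u : FunField p, Transcendental ℂ u ∧
      degree φ = Module.finrank (IntermediateField.adjoin ℂ {u}) (FunField p) := by
  -- By surjectivity some point of `X` lies over the locus where the coordinate minus `c` is
  -- invertible. The preimage of that locus is open, so it contains the generic point, and the
  -- pulled-back coordinate differs from every constant.
  have hpt : ∀ c : ℂ, ∃ hη : φ (genericPoint X) ∈ lineOpen, IsUnit
      ((ProjSpace 1).presheaf.germ lineOpen (φ (genericPoint X)) hη
        (chartSection (chartCoord - chartConst c))) := by
    intro c
    obtain ⟨z, hz, hzu⟩ := exists_isUnit_germ_chartSection c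
    obtain ⟨x, rfl⟩ := φ.surjective z
    have hx : x ∈ φ ⁻¹ᵁ (ProjSpace 1).basicOpen (chartSection (chartCoord - chartConst c)) :=
      ((ProjSpace 1).mem_basicOpen _ _ hz).mpr hzu
    have h1 : φ (genericPoint X) ∈
        (ProjSpace 1).basicOpen (chartSection (chartCoord - chartConst c)) :=
      genericPoint_mem_of_mem hx
    exact ⟨(ProjSpace 1).basicOpen_le _ h1,
      ((ProjSpace 1).mem_basicOpen _ _ ((ProjSpace 1).basicOpen_le _ h1)).mp h1⟩
  obtain ⟨hη, -⟩ := hpt 0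
  have htr : Transcendental ℂ (chartHom p φ hη chartCoord) := by
    intro halg
    obtain ⟨c, hc⟩ := exists_algebraMap_eq_of_isAlgebraic halg
    obtain ⟨_, hu⟩ := hpt c
    have h1 : IsUnit (chartHom p φ hη (chartCoord - chartConst c)) :=
      hu.map (φ.stalkMap (genericPoint X)).hom
    rw [map_sub, ← RingHom.comp_apply, chartHom_comp_chartConst hφ hη, ← hc, sub_self] at h1
    exact not_isUnit_zero h1
  exact ⟨_, htr, degree_eq_finrank_adjoin hφ hη htr⟩

end

attribute [local instance] MvPolynomial.gradedAlgebra

/-! ### Morphisms from a smooth curve to a proper scheme -/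

theorem exists_hom_of_domain_eq_top {X Y : Scheme.{0}} [IsIntegral X] (g : X.PartialMap Y)
    (hg : g.domain = ⊤) :
    ∃ φ : X ⟶ Y, g.fromFunctionField = X.fromSpecStalk (genericPoint X) ≫ φ := by
  obtain ⟨U, hU, h⟩ := g
  obtain rfl : U = ⊤ := hg
  refine ⟨X.topIso.inv ≫ h, ?_⟩
  have h1 : (⟨⊤, hU, h⟩ : X.PartialMap Y) = (X.topIso.inv ≫ h : X ⟶ Y).toPartialMap := by
    refine Scheme.PartialMap.ext _ _ rfl ?_
    simp only [Scheme.Hom.toPartialMap_hom, Iso.hom_inv_id_assoc]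
    exact (Category.id_comp h).symm.trans
      (congrArg (· ≫ h) (congrArg Iso.hom (X.isoOfEq_rfl ⊤).symm))
  rw [← Scheme.PartialMap.fromSpecStalkOfMem_toPartialMap]
  congr 1

theorem fromFunctionField_eq {X Y : Scheme.{0}} [IsIntegral X] (g : X.PartialMap Y) {x : X}
    (hx : x ∈ g.domain) : g.fromFunctionField =
      Spec.map (X.presheaf.stalkSpecializes ((genericPoint_spec X).specializes trivial)) ≫
        g.fromSpecStalkOfMem hx := by
  rw [Scheme.PartialMap.fromFunctionField, Scheme.PartialMap.fromSpecStalkOfMem,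
    Scheme.PartialMap.fromSpecStalkOfMem, ← Category.assoc]
  congr 1
  rw [← cancel_mono g.domain.ι]
  simp [Scheme.SpecMap_stalkSpecializes_fromSpecStalk]

/-- The existence part of the valuative criterion. -/
theorem exists_lift_of_isProper {Y S : Scheme.{0}} (q : Y ⟶ S) [IsProper q] {A : CommRingCat.{0}}
    [IsDomain A] [ValuationRing A] {K : Type} [Field K] (j : A →+* K)
    (hj : letI := j.toAlgebra; IsFractionRing A K) (m : Spec (.of K) ⟶ Y) (b : Spec A ⟶ S)
    (h : m ≫ q = Spec.map (CommRingCat.ofHom j) ≫ b) :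
    ∃ l : Spec A ⟶ Y, Spec.map (CommRingCat.ofHom j) ≫ l = m ∧ l ≫ q = b := by
  have hex : (ValuativeCriterion.Existence ⊓ @QuasiCompact) q := by
    rw [← UniversallyClosed.eq_valuativeCriterion]
    exact (inferInstance : UniversallyClosed q)
  let := j.toAlgebra
  let S : ValuativeCommSq q :=
    { R := A
      K := K
      i₁ := m
      i₂ := b
      commSq := ⟨h⟩ }
  obtain ⟨⟨l, hl, hl'⟩⟩ := (hex.1 S).exists_lift
  exact ⟨l, hl, hl'⟩

theorem isDominant_genericMap {X : Scheme.{0}} [IsIntegral X] (p : X ⟶ SpecC) :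
    IsDominant (genericMap p) := by
  refine ⟨?_⟩
  have hgen : genericMap p (IsLocalRing.closedPoint (FunField p)) = genericPoint X :=
    Scheme.fromSpecStalk_closedPoint
  refine (dense_iff_closure_eq.mpr ?_ : Dense {genericPoint X}).mono ?_
  · exact genericPoint_spec X
  · rw [Set.singleton_subset_iff, ← hgen]
    exact Set.mem_range_self _

/-- A rational map from a smooth curve to a proper scheme is a morphism. -/
theorem exists_extension {X Y : Scheme.{0}} [IsIntegral X] (p : X ⟶ SpecC)
    [SmoothOfRelativeDimension 1 p] (q : Y ⟶ SpecC) [IsProper q]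
    (m : Spec (.of (FunField p)) ⟶ Y) (hm : m ≫ q = genericMap p ≫ p) :
    ∃ φ : X ⟶ Y, φ ≫ q = p ∧ genericMap p ≫ φ = m := by
  have : Y.IsSeparated := ⟨by
    rw [← terminal.comp_from q]
    infer_instance⟩
  let r : X.RationalMap Y := .ofFunctionField p q m hm
  have hr : r.fromFunctionField = m := Scheme.RationalMap.fromFunctionField_ofFunctionField _ _ _ _
  -- Each stalk of the curve is a valuation ring, so properness extends the map over its spectrum,
  -- and a morphism from the spectrum of a stalk spreads out to a neighborhood.
  have hdom : r.domain = ⊤ := by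
    refine top_le_iff.mp fun x _ => ?_
    have := isPrincipalIdealRing_stalk (p := p) x
    obtain ⟨l, hl, hl'⟩ := exists_lift_of_isProper q (stalkToFunField p x)
      (inferInstanceAs (IsFractionRing (X.presheaf.stalk x) X.functionField)) m
      (X.fromSpecStalk x ≫ p) (by
        rw [hm, ← Category.assoc]
        congr 1
        exact (Scheme.SpecMap_stalkSpecializes_fromSpecStalk
          ((genericPoint_spec X).specializes trivial)).symm)
    let g := Scheme.PartialMap.ofFromSpecStalk p q l hl'
    have hxg : x ∈ g.domain := Scheme.PartialMap.mem_domain_ofFromSpecStalk p q l hl'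
    refine Scheme.RationalMap.mem_domain.mpr ⟨g, hxg, ?_⟩
    refine Scheme.RationalMap.eq_of_fromFunctionField_eq _ _ ?_
    rw [Scheme.RationalMap.fromFunctionField_toRationalMap, fromFunctionField_eq g hxg,
      Scheme.PartialMap.fromSpecStalkOfMem_ofFromSpecStalk, hr]
    exact hl
  obtain ⟨φ, hφ⟩ := exists_hom_of_domain_eq_top r.toPartialMap hdom
  have hφm : genericMap p ≫ φ = m := by
    rw [← hr]
    refine hφ.symm.trans ?_
    rw [← Scheme.RationalMap.fromFunctionField_toRationalMap,
      Scheme.RationalMap.toRationalMap_toPartialMap]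
  refine ⟨φ, ?_, hφm⟩
  have := isDominant_genericMap p
  refine ext_of_isDominant (ι := genericMap p) ?_
  rw [← Category.assoc, hφm, hm]

theorem ProjSpace.exists_specializes (N : ℕ) :
    ∃ ζ : ProjSpace N, ∀ z : ProjSpace N, ζ ⤳ z := by
  let 𝒜 := MvPolynomial.homogeneousSubmodule (Fin (N + 1)) ℂ
  let ζ : ProjectiveSpectrum 𝒜 :=
    { asHomogeneousIdeal := ⊥
      isPrime := by
        rw [HomogeneousIdeal.toIdeal_bot]
        exact Ideal.isPrime_bot
      not_irrelevant_le := fun h => by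
        have h1 : (MvPolynomial.X 0 : MvPolynomial (Fin (N + 1)) ℂ) ∈
            HomogeneousIdeal.irrelevant 𝒜 := by
          rw [HomogeneousIdeal.mem_irrelevant_iff, GradedRing.proj_apply,
            DirectSum.decompose_of_mem_ne 𝒜 (MvPolynomial.isHomogeneous_X ℂ 0) one_ne_zero]
        have h2 := h h1
        rw [← HomogeneousIdeal.mem_iff, HomogeneousIdeal.toIdeal_bot] at h2
        exact MvPolynomial.X_ne_zero _ h2 }
  refine ⟨ζ, fun z => ?_⟩
  let z' : ProjectiveSpectrum 𝒜 := z
  have h : ζ.asHomogeneousIdeal ≤ z'.asHomogeneousIdeal := bot_le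
  exact specializes_iff_mem_closure.mpr ((ProjectiveSpectrum.le_iff_mem_closure 𝒜 ζ z').mp h)

/-- Every nonconstant rational function on a smooth projective curve is a surjective morphism to
`ℙ¹`. -/
theorem exists_surjective_of_transcendental {X : Scheme.{0}} [IsIntegral X] (p : X ⟶ SpecC)
    [SmoothOfRelativeDimension 1 p] [IsProper p] {u : FunField p} (hu : Transcendental ℂ u) :
    ∃ φ : X ⟶ ProjSpace 1, φ ≫ ProjSpace.toSpecC 1 = p ∧ Surjective φ ∧
      degree φ = Module.finrank (IntermediateField.adjoin ℂ {u}) (FunField p) := by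
  obtain ⟨χ, hχ, hχu⟩ := exists_chartRing_hom (algebraMap ℂ (FunField p)) u
  obtain ⟨φ, hφ, hφm⟩ := exists_extension p (ProjSpace.toSpecC 1)
    (Spec.map (CommRingCat.ofHom χ) ≫ lineChart) (by
      rw [genericMap_comp, Category.assoc, lineChart_comp, ← Spec.map_comp, ← hχ]
      rfl)
  have hgen : genericMap p (IsLocalRing.closedPoint (FunField p)) = genericPoint X :=
    Scheme.fromSpecStalk_closedPoint
  have hφη : φ (genericPoint X) = lineChart
      (Spec.map (CommRingCat.ofHom χ) (IsLocalRing.closedPoint (FunField p))) := by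
    rw [← hgen]
    exact congrArg (fun m : Spec (.of (FunField p)) ⟶ ProjSpace 1 =>
      m (IsLocalRing.closedPoint (FunField p))) hφm
  have hη : φ (genericPoint X) ∈ lineOpen := by
    rw [← opensRange_lineChart, hφη]
    exact ⟨_, rfl⟩
  have hχeq : chartHom p φ hη = χ := by
    have h1 := (genericMap_comp_eq (p := p) hη).symm.trans hφm
    rw [cancel_mono, Spec.map_inj] at h1
    exact congrArg CommRingCat.Hom.hom h1
  subst hχeq
  subst hχu
  refine ⟨φ, hφ, ?_, degree_eq_finrank_adjoin hφ hη hu⟩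
  have hprop : IsProper φ := by
    have : IsProper (φ ≫ ProjSpace.toSpecC 1) := hφ ▸ inferInstance
    exact IsProper.of_comp φ (ProjSpace.toSpecC 1)
  have hinj : Function.Injective (chartHom p φ hη) := by
    rw [injective_iff_map_eq_zero]
    intro a ha
    obtain ⟨P, rfl⟩ := exists_eval₂_chartCoord a
    rw [Polynomial.hom_eval₂, hχ] at ha
    rw [(transcendental_iff.mp hu) P ha, Polynomial.eval₂_zero]
  refine ⟨fun z => ?_⟩
  have hclosed : IsClosed (Set.range φ) := φ.isClosedMap.isClosed_range
  obtain ⟨ζ, hζ⟩ := ProjSpace.exists_specializes 1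
  have hζo : ζ ∈ lineChart.opensRange := by
    rw [opensRange_lineChart]
    exact (hζ _).mem_open lineOpen.2 hη
  obtain ⟨w, rfl⟩ := hζo
  -- Injectivity of the pullback says that the generic point of `X` maps to the zero ideal of the
  -- chart, hence to a point specializing to all of `ℙ¹`. The image of a proper morphism is closed,
  -- so it is everything.
  have hsp : (Spec.map (CommRingCat.ofHom (chartHom p φ hη))
      (IsLocalRing.closedPoint (FunField p))) ⤳ w := by
    refine (PrimeSpectrum.le_iff_specializes _ _).mp fun a ha => ?_
    have h1 : chartHom p φ hη a ∈ IsLocalRing.maximalIdeal (FunField p) := ha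
    rw [IsLocalRing.maximalIdeal_eq_bot] at h1
    rw [hinj (h1.trans (map_zero _).symm)]
    exact zero_mem _
  have h2 : φ (genericPoint X) ⤳ z := by
    rw [hφη]
    exact (hsp.map lineChart.continuous).trans (hζ z)
  exact h2.mem_closed hclosed ⟨_, rfl⟩

/-! ### Places of the rational function field, and cyclic coverings of the line in local
coordinates. -/

section

open Polynomial
open scoped nonZeroDivisors

section

variable {k : Type*} [Field k]

theorem finite_setOf_notMem_pointRing (f : RatFunc k) : {a | f ∉ pointRing a}.Finite := by
  refine (f.denom.rootSet_finite k).subset fun a ha => ?_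
  rw [mem_rootSet]
  refine ⟨f.denom_ne_zero, ?_⟩
  by_contra h
  refine ha ⟨f.num, f.denom, by simpa using h, ?_⟩
  exact (eq_div_iff (RatFunc.algebraMap_ne_zero f.denom_ne_zero)).mp f.num_div_denom.symm

theorem transcendental_ratFunc_X : Transcendental k (RatFunc.X : RatFunc k) := by
  rw [transcendental_iff]
  intro p hp
  rw [RatFunc.aeval_X_left_eq_algebraMap] at hp
  exact (map_eq_zero_iff _ (RatFunc.algebraMap_injective k)).mp hp

/-- The automorphism of the projective line exchanging `a` and infinity. -/
theorem exists_algEquiv_apply_X (a : k) : ∃ τ : RatFunc k ≃ₐ[k] RatFunc k,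
    τ RatFunc.X = algebraMap k _ a + (RatFunc.X - algebraMap k _ a)⁻¹ := by
  set x' : RatFunc k := algebraMap k _ a + (RatFunc.X - algebraMap k _ a)⁻¹ with hx'
  have htr : Transcendental k x' := by
    intro h
    have h1 := (h.sub (isAlgebraic_algebraMap (A := RatFunc k) a)).inv.add
      (isAlgebraic_algebraMap (A := RatFunc k) a)
    rw [hx', add_sub_cancel_left, inv_inv, sub_add_cancel] at h1
    exact transcendental_ratFunc_X h1
  have hinj : k[X]⁰ ≤ (RatFunc k)⁰.comap (aeval (R := k) x' : k[X] →ₐ[k] RatFunc k) := by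
    intro p hp
    rw [Submonoid.mem_comap, mem_nonZeroDivisors_iff_ne_zero]
    exact fun h => nonZeroDivisors.ne_zero hp (transcendental_iff.mp htr p h)
  let τ : RatFunc k →ₐ[k] RatFunc k := RatFunc.liftAlgHom (aeval x') hinj
  have hτ : τ RatFunc.X = x' := by
    have := RatFunc.liftAlgHom_apply_div' (φ := aeval (R := k) x') hinj X 1
    simpa using this
  -- The substitution `x ↦ a + (x - a)⁻¹` is an involution.
  have hcomp : τ.comp τ = AlgHom.id k _ := by
    apply AlgHom.coe_ringHom_injective
    refine IsLocalization.ringHom_ext k[X]⁰ ?_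
    apply Polynomial.ringHom_ext
    · intro c
      simp [← RatFunc.algebraMap_eq_C, AlgHom.commutes]
    · have : τ (τ RatFunc.X) = RatFunc.X := by
        rw [hτ, hx', map_add, map_inv₀, map_sub, hτ, AlgHom.commutes, hx', add_sub_cancel_left,
          inv_inv, add_sub_cancel]
      simpa using this
  exact ⟨AlgEquiv.ofAlgHom τ τ hcomp hcomp, hτ⟩

/-- The valuation ring of the point at infinity of the projective line. -/
def inftyRing (k : Type*) [Field k] : ValuationSubring (RatFunc k) :=
  letI := Classical.decEq (RatFunc k)
  (RatFunc.inftyValuation k).valuationSubring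

theorem mem_inftyRing {f : RatFunc k} : f ∈ inftyRing k ↔ f ∈ degLE k 0 := by
  classical
  rw [inftyRing, Valuation.mem_valuationSubring_iff, mem_degLE]
  by_cases hf : f = 0
  · simp [hf]
  · rw [RatFunc.inftyValuation_apply, RatFunc.inftyValuation_of_nonzero k hf]
    simp only [hf, false_or]
    rw [← WithZero.exp_zero, WithZero.exp_le_exp]

theorem algebraMap_mem_inftyRing (c : k) : algebraMap k (RatFunc k) c ∈ inftyRing k := by
  rw [mem_inftyRing]
  right
  simp [RatFunc.algebraMap_eq_C]

theorem X_notMem_inftyRing : (RatFunc.X : RatFunc k) ∉ inftyRing k := by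
  rw [mem_inftyRing, mem_degLE]
  simp [RatFunc.X_ne_zero]

/-- A valuation ring with these properties is that of the point at infinity. There `τ X` takes the
value `a`, so a denominator that does not vanish at `a` becomes a unit. -/
theorem map_mem_of_mem_pointRing {a : k} {τ : RatFunc k ≃ₐ[k] RatFunc k}
    (hτ : τ RatFunc.X = algebraMap k _ a + (RatFunc.X - algebraMap k _ a)⁻¹)
    {O : ValuationSubring (RatFunc k)} (hO : ∀ c : k, algebraMap k _ c ∈ O) (hX : RatFunc.X ∉ O)
    {f : RatFunc k} (hf : f ∈ pointRing a) : τ f ∈ O := by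
  obtain ⟨p, q, hq, h⟩ := hf
  have hXa : (RatFunc.X - algebraMap k (RatFunc k) a) ∉ O := fun h => hX (by
    simpa using add_mem h (hO a))
  have hlt : O.valuation (RatFunc.X - algebraMap k (RatFunc k) a)⁻¹ < 1 := by
    rw [map_inv₀]
    exact inv_lt_one_of_one_lt₀ (lt_of_not_ge fun h => hXa ((O.valuation_le_one_iff _).mp h))
  have hτX : τ RatFunc.X ∈ O := by
    rw [hτ]
    exact add_mem (hO a) ((O.valuation_le_one_iff _).mp hlt.le)
  have hpoly : ∀ p : k[X], τ (algebraMap _ _ p) ∈ O := by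
    intro p
    rw [← RatFunc.aeval_X_left_eq_algebraMap, ← aeval_algHom_apply, aeval_eq_sum_range]
    refine sum_mem fun i _ => ?_
    rw [Algebra.smul_def]
    exact mul_mem (hO _) (pow_mem hτX _)
  have hqv : O.valuation (τ (algebraMap _ _ q)) = 1 := by
    have hdiv : q = C (q.eval a) + (X - C a) * (q /ₘ (X - C a)) := by
      rw [← modByMonic_X_sub_C_eq_C_eval, modByMonic_add_div]
    rw [hdiv, map_add, map_add, map_mul, map_mul]
    have e1 : τ (algebraMap k[X] (RatFunc k) (C (q.eval a))) = algebraMap k _ (q.eval a) := by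
      rw [RatFunc.algebraMap_C, ← RatFunc.algebraMap_eq_C, AlgEquiv.commutes]
    have e2 : τ (algebraMap k[X] (RatFunc k) (X - C a)) =
        (RatFunc.X - algebraMap k (RatFunc k) a)⁻¹ := by
      rw [map_sub, RatFunc.algebraMap_X, RatFunc.algebraMap_C, ← RatFunc.algebraMap_eq_C, map_sub,
        hτ, AlgEquiv.commutes, add_sub_cancel_left]
    have h1 := valuation_algebraMap_eq_one O hO hq
    rw [e1, e2, Valuation.map_add_eq_of_lt_left, h1]
    rw [h1, map_mul]
    exact mul_lt_one_of_lt_of_le hlt ((O.valuation_le_one_iff _).mpr (hpoly _))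
  rw [← O.valuation_le_one_iff]
  have := congrArg (fun g => O.valuation (τ g)) h
  simp only [map_mul, hqv, mul_one] at this
  rw [this]
  exact (O.valuation_le_one_iff _).mpr (hpoly _)

/-- Finitely many rational functions have no poles at infinity in a suitable coordinate. -/
theorem exists_algEquiv_forall_mem [Infinite k] {t : Set (RatFunc k)} (ht : t.Finite) :
    ∃ τ : RatFunc k ≃ₐ[k] RatFunc k, ∀ f ∈ t, ∀ O : ValuationSubring (RatFunc k),
      (∀ c : k, algebraMap k _ c ∈ O) → RatFunc.X ∉ O → τ f ∈ O := by
  have hfin : (⋃ f ∈ t, {a | f ∉ pointRing a}).Finite :=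
    ht.biUnion fun f _ => finite_setOf_notMem_pointRing f
  obtain ⟨a, ha⟩ := hfin.exists_notMem
  obtain ⟨τ, hτ⟩ := exists_algEquiv_apply_X a
  refine ⟨τ, fun f hf O hO hX => map_mem_of_mem_pointRing hτ hO hX ?_⟩
  by_contra h
  exact ha (Set.mem_biUnion hf h)

/-- A quotient of the local ring of the affine line at `a` in which `p` vanishes has dimension at
most the multiplicity of the root `a` of `p`. -/
theorem finrank_le_rootMultiplicity {R V : Type*} [CommRing R] [CommRing V] [Algebra k R]
    [Algebra k V] {a : k} (j : R →ₐ[k] RatFunc k) (hj : Function.Injective j)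
    (hrange : ∀ f, f ∈ pointRing a ↔ f ∈ j.range) (π : R →ₐ[k] V) (hπ : Function.Surjective π)
    {x : R} (hx : π x = 0) {p : k[X]} (hp : p ≠ 0) {e : RatFunc k} (he : e ∈ pointRing a)
    (hpe : algebraMap k[X] (RatFunc k) p = j x * e) :
    Module.Finite k V ∧ Module.finrank k V ≤ p.rootMultiplicity a := by
  set m := p.rootMultiplicity a
  have hX : ∃ t : R, j t = RatFunc.X := (hrange _).mp (by
    simpa using algebraMap_mem_pointRing a X)
  obtain ⟨t, ht⟩ := hX
  have hjt : ∀ P : k[X], j (aeval t P) = algebraMap k[X] (RatFunc k) P := by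
    intro P
    rw [← aeval_algHom_apply, ht, RatFunc.aeval_X_left_eq_algebraMap]
  obtain ⟨p2, hp2, hpa⟩ := exists_eq_pow_rootMultiplicity_mul_and_not_dvd p hp a
  rw [dvd_iff_isRoot, IsRoot.def] at hpa
  -- In the local ring `p` is `(X - a) ^ m` up to a unit and is also a multiple of `x`, so the
  -- kernel of `π` contains `(X - a) ^ m`.
  have hkill : ∀ r : R, π (aeval t ((X - C a) ^ m) * r) = 0 := by
    intro r
    obtain ⟨w, hw⟩ : ∃ w, j w = e * (algebraMap k[X] (RatFunc k) p2)⁻¹ :=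
      (hrange _).mp (mul_mem he (inv_algebraMap_mem_pointRing hpa))
    have h0 : algebraMap k[X] (RatFunc k) p2 ≠ 0 := RatFunc.algebraMap_ne_zero (by
      rintro rfl; simp at hpa)
    have : aeval t ((X - C a) ^ m) = x * w := by
      apply hj
      rw [hjt, map_mul, hw, ← mul_assoc, ← hpe, hp2, map_mul, mul_assoc, mul_inv_cancel₀ h0,
        mul_one]
    rw [this, map_mul, map_mul, hx, zero_mul, zero_mul]
  let ψ : degreeLT k m →ₗ[k] V :=
    (π.toLinearMap.comp (aeval t).toLinearMap).comp (degreeLT k m).subtype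
  -- A denominator prime to `X - a` is invertible modulo `(X - a) ^ m`, so polynomials of degree
  -- less than `m` represent every class.
  have hψ : Function.Surjective ψ := by
    intro v
    obtain ⟨r, rfl⟩ := hπ v
    obtain ⟨p', q, hq, h⟩ := (hrange _).mpr (⟨r, rfl⟩ : j r ∈ j.range)
    have hcop : IsCoprime q ((X - C a) ^ m) := by
      refine IsCoprime.pow_right (IsCoprime.symm ?_)
      refine (irreducible_X_sub_C a).coprime_iff_not_dvd.mpr ?_
      rwa [dvd_iff_isRoot, IsRoot.def]
    obtain ⟨A, B, hAB⟩ := hcop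
    have hmon : ((X - C a) ^ m).Monic := (monic_X_sub_C a).pow m
    refine ⟨⟨(A * p') %ₘ (X - C a) ^ m, ?_⟩, ?_⟩
    · rw [mem_degreeLT]
      refine (degree_modByMonic_lt _ hmon).trans_le ?_
      rw [degree_pow, degree_X_sub_C]
      simp
    · change π (aeval t ((A * p') %ₘ (X - C a) ^ m)) = π r
      have hr : r = aeval t ((A * p') %ₘ (X - C a) ^ m) + aeval t ((X - C a) ^ m) *
          (aeval t ((A * p') /ₘ (X - C a) ^ m) + aeval t B * r) := by
        apply hj
        rw [map_add, map_mul, map_add, map_mul, hjt, hjt, hjt, hjt, mul_add, ← add_assoc,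
          ← map_mul, ← map_add, modByMonic_add_div, map_mul, ← h]
        have h1 := congrArg (algebraMap k[X] (RatFunc k)) hAB
        rw [map_add, map_mul, map_mul, map_one] at h1
        linear_combination (-j r) * h1
      conv_rhs => rw [hr]
      rw [map_add, hkill, add_zero]
  have hfr : Module.finrank k (degreeLT k m) = m := by
    rw [(degreeLTEquiv k m).finrank_eq, Module.finrank_fin_fun]
  have : Module.Finite k (degreeLT k m) := .equiv (degreeLTEquiv k m).symm
  refine ⟨.of_surjective ψ hψ, ?_⟩
  calc _ ≤ Module.finrank k (degreeLT k m) := LinearMap.finrank_le_finrank_of_surjective hψ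
    _ = m := hfr

theorem sum_rootMultiplicity_le (p : k[X]) (t : Finset k) :
    ∑ a ∈ t, p.rootMultiplicity a ≤ p.natDegree := by
  classical
  calc ∑ a ∈ t, p.rootMultiplicity a = ∑ a ∈ t, p.roots.count a := by simp
    _ ≤ ∑ a ∈ t ∪ p.roots.toFinset, p.roots.count a :=
      Finset.sum_le_sum_of_subset Finset.subset_union_left
    _ = p.roots.card := Multiset.sum_count_eq_card fun a ha => by simp [ha]
    _ ≤ p.natDegree := card_roots' p

variable {K : Type*} [Field K] [Algebra (RatFunc k) K] [Algebra k K]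
  [IsScalarTower k (RatFunc k) K]

/-- The function field of a cyclic covering of the projective line of degree `n`, given by
local coordinates `z i` with `z i ^ n = s i`, has gonality at least `n` if the branch divisor has
degree at least `2 * n`. -/
theorem le_finrank_of_cyclic_charts [IsAlgClosed k] {n : ℕ} (hn : 2 ≤ n) {ι : Type*}
    (R : ι → Set (RatFunc k)) (z : ι → K) (s γ : ι → RatFunc k) (o : ι)
    (B : Module.Basis (Fin n) (RatFunc k) K) (hB : ∀ j, B j = z o ^ (j : ℕ))
    (hγ0 : ∀ i, γ i ≠ 0) (hγ : ∀ i, z i = γ i • z o)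
    (hs : ∀ i, z i ^ n = algebraMap (RatFunc k) K (s i)) (hsR : ∀ i, s i ∈ R i) (hs0 : s o ≠ 0)
    (hs1 : s o ∈ degLE k 0) (hs2 : (s o)⁻¹ ∈ degLE k 0) (i : k → ι)
    (hi : ∀ a, R (i a) ⊆ pointRing a) (hfin : {a | i a ≠ o}.Finite)
    (hr : ∀ p : k[X], p ≠ 0 → (∀ a, ∃ e ∈ pointRing a, e⁻¹ ∈ pointRing a ∧
      algebraMap k[X] (RatFunc k) p = s (i a) * e) → 2 * n ≤ p.natDegree)
    {u : K} (hu : Transcendental k u) (c : Fin n → RatFunc k)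
    (hc : u = ∑ j, c j • z o ^ (j : ℕ)) (hc0 : ∀ j, c j ∈ degLE k 0)
    [Module.Finite (IntermediateField.adjoin k {u}) K]
    (hloc : ∀ i, HasLocalDenominators n (R i) (z i) u) :
    n ≤ Module.finrank (IntermediateField.adjoin k {u}) K := by
  obtain ⟨n, rfl⟩ : ∃ m, n = m + 2 := ⟨n - 2, by omega⟩
  have hz0 : z o ≠ 0 := by
    have := B.ne_zero ⟨1, by omega⟩
    rwa [hB, pow_one] at this
  have hγo : γ o = 1 := by
    have := hγ o
    rw [Algebra.smul_def, eq_comm, mul_eq_right₀ hz0] at this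
    exact (algebraMap (RatFunc k) K).injective (this.trans (map_one _).symm)
  have hsγ : ∀ i, s o * γ i ^ (n + 2) = s i := by
    intro i
    apply (algebraMap (RatFunc k) K).injective
    rw [map_mul, map_pow, ← hs, ← hs, hγ i, Algebra.smul_def, mul_pow, mul_comm]
  -- The chart is `o`, with factor `1`, at all but finitely many points, so the factors `γ` define a
  -- divisor on the affine line. As `z o` is also the coordinate at infinity, the degree of `q` is
  -- that of the line bundle.
  obtain ⟨q, hq0, hq⟩ := exists_ratFunc_of_divisor (fun a => γ (i a)) (fun a => hγ0 _)
    (hfin.subset fun a ha h => ha (by simp only [h, hγo]))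
  have hpoly : s o * q ^ (n + 2) ∈ polys k := by
    refine mem_polys_of_forall_mem_pointRing fun a => ?_
    have : s o * q ^ (n + 2) = s (i a) * ((γ (i a))⁻¹ * q) ^ (n + 2) := by
      rw [← hsγ (i a), mul_assoc, ← mul_pow, mul_inv_cancel_left₀ (hγ0 _)]
    rw [this]
    exact mul_mem (hi a (hsR _)) (pow_mem (hq a).2 _)
  obtain ⟨p, hp⟩ := mem_polys.mp hpoly
  have hp0 : p ≠ 0 := by
    rintro rfl
    rw [map_zero, eq_comm, mul_eq_zero] at hp
    exact hp.elim hs0 (pow_ne_zero _ hq0)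
  have hdeg := hr p hp0 fun a => by
    refine ⟨((γ (i a))⁻¹ * q) ^ (n + 2), pow_mem (hq a).2 _, ?_, ?_⟩
    · have : (((γ (i a))⁻¹ * q) ^ (n + 2))⁻¹ = (γ (i a) * q⁻¹) ^ (n + 2) := by
        rw [← inv_pow, mul_inv, inv_inv]
      rw [this]
      exact pow_mem (hq a).1 _
    · rw [hp, ← hsγ (i a), mul_assoc, ← mul_pow, mul_inv_cancel_left₀ (hγ0 _)]
  -- The branch section is a unit at infinity, so `deg p = n * deg q` for a covering of degree `n`;
  -- with `deg p ≥ 2 * n` this forces `deg q ≥ 2`.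
  have hs3 : (s o).intDegree = 0 := by
    have h1 := hs1.resolve_left hs0
    have h2 := hs2.resolve_left (inv_ne_zero hs0)
    rw [RatFunc.intDegree_inv] at h2
    omega
  have hpow : ∀ m : ℕ, (q ^ m).intDegree = m * q.intDegree := by
    intro m
    induction m with
    | zero => simp
    | succ m ih =>
      rw [pow_succ, RatFunc.intDegree_mul (pow_ne_zero _ hq0) hq0, ih]
      push_cast; ring
  have hpd : (p.natDegree : ℤ) = (n + 2 : ℕ) * q.intDegree := by
    rw [← RatFunc.intDegree_polynomial, hp, RatFunc.intDegree_mul hs0 (pow_ne_zero _ hq0), hs3,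
      zero_add, hpow]
  refine le_finrank_of_cyclic B hB (hs o) (fun a => γ (i a)) (fun a => ?_) hq0 hq ?_
    (fun a => hγ0 _) hu c hc hc0 fun a => ?_
  · rw [hsγ]
    exact hi a (hsR _)
  · by_contra! hlt
    have : (p.natDegree : ℤ) ≤ (n + 2 : ℕ) * 1 := by
      rw [hpd]
      exact mul_le_mul_of_nonneg_left (by omega) (by omega)
    omega
  · rw [← hγ]
    exact (hloc _).mono (hi a)

end

end

/-! ### Fraction fields of finite extensions, affine charts of curves, pullback of rational
functions. -/

section

open scoped nonZeroDivisors

theorem isFractionRing_of_forall {A L : Type*} [CommRing A] [IsDomain A] [Field L] [Algebra A L]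
    (h : Function.Injective (algebraMap A L))
    (hf : ∀ f : L, ∃ a b : A, algebraMap A L b ≠ 0 ∧ f * algebraMap A L b = algebraMap A L a) :
    IsFractionRing A L := by
  refine ⟨⟨fun y => ?_, fun f => ?_, fun {x y} hxy => ⟨1, by rw [h hxy]⟩⟩⟩
  · exact isUnit_iff_ne_zero.mpr ((map_ne_zero_iff _ h).mpr (nonZeroDivisors.ne_zero y.2))
  · obtain ⟨a, b, hb, hab⟩ := hf f
    exact ⟨⟨a, ⟨b, mem_nonZeroDivisors_of_ne_zero fun h0 => hb (by rw [h0, map_zero])⟩⟩, hab⟩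

theorem exists_powerBasis_of_existsUnique {R S : Type*} [CommRing R] [CommRing S] [Algebra R S]
    {n : ℕ} {z : S}
    (h : ∀ w : S, ∃! a : Fin n → R, w = ∑ l, algebraMap R S (a l) * z ^ (l : ℕ)) :
    ∃ b : Module.Basis (Fin n) R S, ∀ l, b l = z ^ (l : ℕ) := by
  have hli : LinearIndependent R (fun l : Fin n => z ^ (l : ℕ)) := by
    rw [Fintype.linearIndependent_iff]
    intro g hg
    have h0 := (h 0).unique (y₁ := g) (y₂ := 0) (by
      rw [← hg]
      exact Finset.sum_congr rfl fun l _ => (Algebra.smul_def _ _)) (by simp)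
    exact fun l => congrFun h0 l
  refine ⟨.mk hli fun w _ => ?_, fun l => Module.Basis.mk_apply _ _ l⟩
  obtain ⟨a, ha, _⟩ := h w
  rw [ha]
  refine sum_mem fun l _ => ?_
  rw [← Algebra.smul_def]
  exact Submodule.smul_mem _ _ (Submodule.subset_span ⟨l, rfl⟩)

theorem existsUnique_of_powerBasis {R S : Type*} [CommRing R] [CommRing S] [Algebra R S]
    {n : ℕ} {z : S} (b : Module.Basis (Fin n) R S) (hb : ∀ l, b l = z ^ (l : ℕ)) (w : S) :
    ∃! a : Fin n → R, w = ∑ l, algebraMap R S (a l) * z ^ (l : ℕ) := by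
  simp_rw [← hb, ← Algebra.smul_def]
  refine ⟨fun l => b.repr w l, (b.sum_repr w).symm, fun a ha => ?_⟩
  rw [ha]
  exact (b.repr_sum_self a).symm

/-- A power basis of a finite extension of domains is a basis of the fraction fields. -/
theorem exists_basis_of_existsUnique {R S F K : Type*} [CommRing R] [CommRing S] [Field F] [Field K]
    (θ : R →+* S) (i : R →+* F) (j : S →+* K) (π : F →+* K) (comm : ∀ r, j (θ r) = π (i r))
    (hi : Function.Injective i) (hif : ∀ f, ∃ a b, i b ≠ 0 ∧ f * i b = i a)
    (hj : Function.Injective j) (hjf : ∀ f, ∃ a b, j b ≠ 0 ∧ f * j b = j a)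
    {n : ℕ} {z : S} (h : ∀ w : S, ∃! a : Fin n → R, w = ∑ l, θ (a l) * z ^ (l : ℕ)) :
    letI := π.toAlgebra
    ∃ B : Module.Basis (Fin n) F K, ∀ l, B l = j z ^ (l : ℕ) := by
  let := π.toAlgebra
  let := θ.toAlgebra
  let := i.toAlgebra
  let := j.toAlgebra
  let := (j.comp θ).toAlgebra
  have : IsDomain R := hi.isDomain
  have : IsDomain S := hj.isDomain
  have : IsScalarTower R S K := .of_algebraMap_eq fun _ => rfl
  have : IsScalarTower R F K := .of_algebraMap_eq fun r => comm r
  have : IsFractionRing R F := isFractionRing_of_forall hi hif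
  have : IsFractionRing S K := isFractionRing_of_forall hj hjf
  obtain ⟨b, hb⟩ := exists_powerBasis_of_existsUnique (R := R) h
  have : Module.Finite R S := .of_basis b
  have : FaithfulSMul R S := by
    rw [faithfulSMul_iff_algebraMap_injective]
    intro r r' hr
    exact hi (π.injective (by rw [← comm, ← comm]; exact congrArg j hr))
  have : Algebra.IsAlgebraic R S := inferInstance
  refine ⟨b.localizationLocalization F R⁰ K, fun l => ?_⟩
  rw [Module.Basis.localizationLocalization_apply, hb, map_pow]
  rfl

/-- Over `k(u)` the field `K` is algebraic, by transcendence degree, and finitely generated, hence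
finite. -/
theorem finite_adjoin_of_finiteType {k R K : Type*} [Field k] [CommRing R] [IsDomain R]
    [Field K] [Algebra k R] [Algebra R K] [Algebra k K] [IsScalarTower k R K] [IsFractionRing R K]
    [Algebra.FiniteType k R] (htr : Algebra.trdeg k K = 1) {u : K} (hu : Transcendental k u) :
    Module.Finite (IntermediateField.adjoin k {u}) K := by
  have := isAlgebraic_adjoin_simple_of_trdeg htr hu
  have : Algebra.EssFiniteType R K := .of_isLocalization _ (nonZeroDivisors R)
  have : Algebra.EssFiniteType k K := .comp _ R _
  have : Algebra.EssFiniteType (IntermediateField.adjoin k {u}) K := .of_comp k _ _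
  obtain ⟨s, hs⟩ := IntermediateField.fg_top (IntermediateField.adjoin k {u}) K
  have := IntermediateField.finiteDimensional_adjoin (K := IntermediateField.adjoin k {u})
    (S := (s : Set K)) fun x _ => Algebra.IsIntegral.isIntegral x
  rw [hs] at this
  exact .equiv (IntermediateField.topEquiv (F := IntermediateField.adjoin k {u})).toLinearEquiv

section

variable {X : Scheme.{0}} [IsIntegral X] {p : X ⟶ SpecC}

theorem finite_adjoin_of_transcendental [SmoothOfRelativeDimension 1 p] {u : FunField p}
    (hu : Transcendental ℂ u) : Module.Finite (IntermediateField.adjoin ℂ {u}) (FunField p) := by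
  obtain ⟨V, hV, hx, hs⟩ := exists_isStandardSmooth_constants p (genericPoint X)
  have : Nonempty V := ⟨⟨_, hx⟩⟩
  let := (constants p V).toAlgebra
  let := (toFunField p V hx).toAlgebra
  have := isFractionRing_toFunField (p := p) hV hx
  have : IsScalarTower ℂ Γ(X, V) (FunField p) :=
    .of_algebraMap_eq fun c => (toFunField_constants V hx c).symm
  have : Algebra.IsStandardSmoothOfRelativeDimension 1 ℂ Γ(X, V) := hs
  have : Algebra.IsStandardSmooth ℂ Γ(X, V) := this.isStandardSmooth
  exact finite_adjoin_of_finiteType (R := Γ(X, V)) trdeg_funField hu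

/-- A valuation ring containing the regular functions on an affine open set has its center
there. -/
theorem exists_isCenter_mem {U : X.Opens} (hU : IsAffineOpen U) (hg : genericPoint X ∈ U)
    (O : ValuationSubring (FunField p)) (h : ∀ s, toFunField p U hg s ∈ O) :
    ∃ x ∈ U, IsCenter p O x := by
  let i : Γ(X, U) →+* O := (toFunField p U hg).codRestrict O.toSubring h
  -- The center is the contraction of the maximal ideal of `O`.
  let y : PrimeSpectrum Γ(X, U) := ⟨(IsLocalRing.maximalIdeal O).comap i, inferInstance⟩
  have hval : ∀ s, s ∉ y.asIdeal ↔ O.valuation (toFunField p U hg s) = 1 := by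
    intro s
    refine Iff.trans ?_ (O.valuation_eq_one_iff ⟨_, h s⟩)
    change ¬ (i s ∈ IsLocalRing.maximalIdeal O) ↔ IsUnit (i s)
    rw [IsLocalRing.mem_maximalIdeal, mem_nonunits_iff, not_not]
  have hxU : hU.fromSpec y ∈ U := by
    rw [← SetLike.mem_coe, ← hU.range_fromSpec]
    exact ⟨y, rfl⟩
  have hunit : ∀ s, IsUnit (X.presheaf.germ U _ hxU s) ↔ O.valuation (toFunField p U hg s) = 1 := by
    intro s
    rw [← hval, ← X.mem_basicOpen]
    have := congrArg (fun V : Opens _ => y ∈ V) (hU.fromSpec_preimage_basicOpen s)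
    exact (iff_of_eq this)
  refine ⟨hU.fromSpec y, hxU, fun f hf => ?_⟩
  obtain ⟨a, b, hb, hab⟩ := exists_fraction_of_mem_localRing hU hxU hf
  have hb1 := (hunit b).mp hb
  have hfa := congrArg O.valuation hab
  rw [map_mul, hb1, mul_one] at hfa
  have hfO : f ∈ O := by
    rw [← O.valuation_le_one_iff, hfa, O.valuation_le_one_iff]
    exact h a
  refine ⟨hfO, fun hfi => ?_⟩
  by_cases hf0 : f = 0
  · rw [hf0, inv_zero]; exact zero_mem _
  have hf1 : O.valuation f = 1 := by
    refine le_antisymm ((O.valuation_le_one_iff _).mpr hfO) ?_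
    have h2 := (O.valuation_le_one_iff _).mpr hfi
    rw [map_inv₀] at h2
    exact (inv_le_one₀ (zero_lt_iff.mpr (by simpa using hf0))).mp h2
  have ha := (hunit a).mpr (hfa.symm.trans hf1)
  obtain ⟨t, ht⟩ := ha.exists_right_inv
  refine ⟨X.presheaf.germ U _ hxU b * t, ?_⟩
  have h3 := congrArg (stalkToFunField p _) ht
  rw [map_mul, map_one, stalkToFunField_germ, ← hab] at h3
  rw [map_mul, stalkToFunField_germ]
  field_simp
  rw [← h3]
  ring

/-- Comaximal denominators on an affine open subset of a smooth curve. -/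
theorem exists_add_eq_one_of_isAffineOpen [SmoothOfRelativeDimension 1 p] {U : X.Opens}
    (hU : IsAffineOpen U) (hg : genericPoint X ∈ U) (v : FunField p) :
    ∃ a b : FunField p, a + b = 1 ∧ a ∈ sectionRing p U hg ∧ b ∈ sectionRing p U hg ∧
      a * v ∈ sectionRing p U hg ∧ b * v⁻¹ ∈ sectionRing p U hg := by
  let I : FunField p → Ideal Γ(X, U) := fun v =>
    { carrier := {s | toFunField p U hg s * v ∈ sectionRing p U hg}
      zero_mem' := by
        change toFunField p U hg 0 * v ∈ sectionRing p U hg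
        rw [map_zero, zero_mul]; exact zero_mem _
      add_mem' := fun {a b} ha hb => by
        change toFunField p U hg (a + b) * v ∈ sectionRing p U hg
        rw [map_add, add_mul]; exact add_mem ha hb
      smul_mem' := fun c s hs => by
        change toFunField p U hg (c * s) * v ∈ sectionRing p U hg
        rw [map_mul, mul_assoc]; exact mul_mem ⟨c, rfl⟩ hs }
  have key : ∀ v : FunField p, ∀ x : U, v ∈ localRing p x.1 → ∃ s ∈ I v, x.1 ∈ X.basicOpen s := by
    intro v x hx
    obtain ⟨a, b, hb, hab⟩ := exists_fraction_of_mem_localRing hU x.2 hx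
    refine ⟨b, ⟨a, ?_⟩, (X.mem_basicOpen _ _ x.2).mpr hb⟩
    rw [mul_comm]
    exact hab.symm
  -- The local rings are valuation rings, so at each point `v` or `v⁻¹` is regular, and the two
  -- ideals of denominators have no common zero.
  have htop : Ideal.span ((I v : Set Γ(X, U)) ∪ I v⁻¹) = ⊤ := by
    rw [← hU.self_le_iSup_basicOpen_iff]
    intro x hx
    obtain h | h := mem_or_inv_mem_localRing (p := p) x v
    · obtain ⟨s, hs, hxs⟩ := key v ⟨x, hx⟩ h
      exact Opens.mem_iSup.mpr ⟨⟨s, Or.inl hs⟩, hxs⟩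
    · obtain ⟨s, hs, hxs⟩ := key v⁻¹ ⟨x, hx⟩ h
      exact Opens.mem_iSup.mpr ⟨⟨s, Or.inr hs⟩, hxs⟩
  rw [Ideal.span_union, Ideal.span_eq, Ideal.span_eq, Ideal.eq_top_iff_one,
    Submodule.mem_sup] at htop
  obtain ⟨a, ha, b, hb, hab⟩ := htop
  refine ⟨toFunField p U hg a, toFunField p U hg b, ?_, ⟨a, rfl⟩, ⟨b, rfl⟩, ha, hb⟩
  rw [← map_add, hab, map_one]

end

theorem app_constants {Z W : Scheme.{0}} (pW : W ⟶ SpecC) (θ : Z ⟶ W) (U : W.Opens) (c : ℂ) :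
    θ.app U (constants pW U c) = constants (θ ≫ pW) (θ ⁻¹ᵁ U) c := by
  change (θ.app U) (W.presheaf.map _ _) = Z.presheaf.map _ _
  rw [← CommRingCat.comp_apply, θ.naturality, CommRingCat.comp_apply]
  simp
  rfl

section

variable {Z W : Scheme.{0}} [IsIntegral Z] [IsIntegral W]

/-- The inclusion of function fields given by a dominant morphism. -/
def pullFun (pW : W ⟶ SpecC) (θ : Z ⟶ W) (h : θ (genericPoint Z) ⤳ genericPoint W) :
    FunField pW →+* FunField (θ ≫ pW) :=
  (W.presheaf.stalkSpecializes h ≫ θ.stalkMap (genericPoint Z)).hom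

theorem pullFun_toFunField (pW : W ⟶ SpecC) (θ : Z ⟶ W)
    (h : θ (genericPoint Z) ⤳ genericPoint W) (U : W.Opens) (hU : genericPoint Z ∈ θ ⁻¹ᵁ U)
    (s : Γ(W, U)) :
    pullFun pW θ h (toFunField pW U (genericPoint_mem_of_mem hU) s) =
      toFunField (θ ≫ pW) (θ ⁻¹ᵁ U) hU (θ.app U s) := by
  have h1 := W.presheaf.germ_stalkSpecializes (U := U) (genericPoint_mem_of_mem hU) h
  have h2 := Scheme.Hom.germ_stalkMap θ U (genericPoint Z) hU
  have h3 : W.presheaf.germ U (genericPoint W) (genericPoint_mem_of_mem hU) ≫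
      W.presheaf.stalkSpecializes h ≫ θ.stalkMap (genericPoint Z) =
      θ.app U ≫ Z.presheaf.germ (θ ⁻¹ᵁ U) (genericPoint Z) hU := by
    rw [← h2, ← h1, Category.assoc]
  exact congrArg (fun f => f.hom s) h3

theorem pullFun_algebraMap (pW : W ⟶ SpecC) (θ : Z ⟶ W)
    (h : θ (genericPoint Z) ⤳ genericPoint W) (c : ℂ) :
    pullFun pW θ h (algebraMap ℂ _ c) = algebraMap ℂ _ c := by
  rw [← toFunField_constants ⊤ (Opens.mem_top _)]
  refine (pullFun_toFunField pW θ h ⊤ (Opens.mem_top _) _).trans ?_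
  rw [app_constants]
  exact toFunField_constants _ _ _

end

end

/-- A nontrivial valuation ring of the rational functions which contains the polynomials is the
local ring of a point of the affine line. -/
theorem exists_eq_pointRing {k : Type*} [Field k] [IsAlgClosed k] {O : ValuationSubring (RatFunc k)}
    (hO : ∀ c : k, algebraMap k _ c ∈ O) (hX : RatFunc.X ∈ O) (hne : O ≠ ⊤) :
    ∃ a, O = pointRing a := by
  have hpoly : ∀ q : Polynomial k, algebraMap _ (RatFunc k) q ∈ O := by
    intro q
    rw [← RatFunc.aeval_X_left_eq_algebraMap, Polynomial.aeval_eq_sum_range]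
    refine sum_mem fun i _ => ?_
    rw [Algebra.smul_def]
    exact mul_mem (hO _) (pow_mem hX _)
  have hXa : ∀ a : k, algebraMap (Polynomial k) (RatFunc k) (.X - .C a) =
      RatFunc.X - algebraMap k _ a := by
    intro a
    rw [map_sub, RatFunc.algebraMap_X, RatFunc.algebraMap_C, RatFunc.algebraMap_eq_C]
  -- If every `X - a` were a unit of `O`, every nonzero polynomial would be one, and `O` would be
  -- the whole field.
  obtain ⟨a, ha⟩ : ∃ a : k,
      O.valuation (algebraMap (Polynomial k) (RatFunc k) (.X - .C a)) < 1 := by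
    by_contra! H
    have H1 : ∀ q : Polynomial k, q ≠ 0 → O.valuation (algebraMap _ (RatFunc k) q) = 1 := by
      intro q hq
      have hs := (IsAlgClosed.splits q).eq_prod_roots
      rw [hs, map_mul, map_mul, RatFunc.algebraMap_C, ← RatFunc.algebraMap_eq_C,
        valuation_algebraMap_eq_one O hO (by simpa), one_mul, map_multiset_prod, map_multiset_prod]
      refine Multiset.prod_eq_one fun y hy => ?_
      simp only [Multiset.map_map, Multiset.mem_map, Function.comp_apply] at hy
      obtain ⟨b, _, rfl⟩ := hy
      exact le_antisymm ((O.valuation_le_one_iff _).mpr (hpoly _)) (H b)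
    refine hne (top_le_iff.mp fun f _ => ?_)
    rw [← O.valuation_le_one_iff, ← f.num_div_denom, map_div₀, H1 _ f.denom_ne_zero, div_one,
      O.valuation_le_one_iff]
    exact hpoly _
  have hle : pointRing a ≤ O := by
    rintro f ⟨p, q, hq, h⟩
    have hqv : O.valuation (algebraMap _ (RatFunc k) q) = 1 := by
      have hdiv : q = .C (q.eval a) + (.X - .C a) * (q /ₘ (.X - .C a)) := by
        rw [← Polynomial.modByMonic_X_sub_C_eq_C_eval, Polynomial.modByMonic_add_div]
      have h1 := valuation_algebraMap_eq_one O hO hq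
      rw [hdiv, map_add, map_mul, RatFunc.algebraMap_C, ← RatFunc.algebraMap_eq_C,
        Valuation.map_add_eq_of_lt_left, h1]
      rw [h1, map_mul]
      exact mul_lt_one_of_lt_of_le ha ((O.valuation_le_one_iff _).mpr (hpoly _))
    have := congrArg O.valuation h
    rw [map_mul, hqv, mul_one] at this
    rw [← O.valuation_le_one_iff, this, O.valuation_le_one_iff]
    exact hpoly _
  refine ⟨a, le_antisymm (fun f hf => ?_) hle⟩
  by_cases hf0 : f = 0
  · rw [hf0]; exact zero_mem _
  obtain ⟨m, g, hfg, hg, hg'⟩ := exists_eq_zpow_mul a hf0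
  have hg0 : g ≠ 0 := by
    rintro rfl
    exact hf0 (by rw [hfg, mul_zero])
  obtain ⟨l, rfl | rfl⟩ := m.eq_nat_or_neg
  · rw [hfg, zpow_natCast]
    exact mul_mem (pow_mem (algebraMap_mem_pointRing _ _) _) hg
  · cases l with
    | zero => simpa [hfg] using hg
    | succ l =>
      exfalso
      have h1 := mul_mem hf (hle hg')
      rw [hfg, mul_assoc, mul_inv_cancel₀ hg0, mul_one, zpow_neg, zpow_natCast,
        ← O.valuation_le_one_iff, map_inv₀, map_pow] at h1
      have h0 : O.valuation (algebraMap (Polynomial k) (RatFunc k) (.X - .C a)) ≠ 0 :=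
        (Valuation.ne_zero_iff _).mpr (RatFunc.algebraMap_ne_zero (Polynomial.X_sub_C_ne_zero a))
      have h2 := (one_lt_inv₀ (zero_lt_iff.mpr (pow_ne_zero (l + 1) h0))).mpr
        (pow_lt_one₀ zero_le ha (Nat.succ_ne_zero l))
      exact absurd h1 (not_le.mpr h2)

/-! ### The length of a finite subscheme of a rational curve. -/

section

variable {X : Scheme.{0}}

/-- The constants in a stalk of a complex scheme. -/
def stalkConstants (p : X ⟶ SpecC) (x : X) : ℂ →+* X.presheaf.stalk x :=
  (X.presheaf.germ ⊤ x (Opens.mem_top x)).hom.comp (constants p ⊤)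

theorem stalkMap_stalkConstants {E : Scheme.{0}} (p : X ⟶ SpecC) (e : E ⟶ X) (Q : E) (c : ℂ) :
    e.stalkMap Q (stalkConstants p (e Q) c) = stalkConstants (e ≫ p) Q c := by
  refine (Scheme.Hom.germ_stalkMap_apply e ⊤ Q (Opens.mem_top _) _).trans ?_
  exact congrArg (E.presheaf.germ ⊤ Q (Opens.mem_top Q)) (app_constants p e ⊤ c)

theorem constants_finiteType (p : X ⟶ SpecC) [LocallyOfFiniteType p] {U : X.Opens}
    (hU : IsAffineOpen U) : (constants p U).FiniteType := by
  have h1 := p.finiteType_appLE (isAffineOpen_top SpecC) hU le_top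
  have h2 : Function.Surjective (Scheme.ΓSpecIso (CommRingCat.of ℂ)).inv.hom :=
    (Scheme.ΓSpecIso (CommRingCat.of ℂ)).symm.commRingCatIsoToRingEquiv.surjective
  exact h1.comp (.of_surjective _ h2)

variable [IsIntegral X] {p : X ⟶ SpecC}

/-- A regular function vanishing on a closed subscheme is not invertible at its points. -/
theorem inv_toFunField_notMem_localRing {E : Scheme.{0}} (e : E ⟶ X) (Q : E) {U : X.Opens}
    (hQ : e Q ∈ U) {s : Γ(X, U)} (hs : e.app U s = 0)
    (hs0 : toFunField p U (genericPoint_mem_of_mem hQ) s ≠ 0) :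
    (toFunField p U (genericPoint_mem_of_mem hQ) s)⁻¹ ∉ localRing p (e Q) := by
  rintro ⟨t, ht⟩
  have h1 : X.presheaf.germ U (e Q) hQ s * t = 1 := by
    apply stalkToFunField_injective (p := p)
    rw [map_mul, stalkToFunField_germ, map_one]
    exact (congrArg _ ht).trans (mul_inv_cancel₀ hs0)
  have h2 := congrArg (e.stalkMap Q) h1
  rw [map_mul, map_one, Scheme.Hom.germ_stalkMap_apply e U Q hQ s, hs, map_zero, zero_mul] at h2
  exact zero_ne_one h2

/-- A finite subscheme of a rational curve has length at most the degree of a polynomial which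
vanishes on it. -/
theorem finrank_sections_le_natDegree [SmoothOfRelativeDimension 1 p] [IsProper p]
    (ψ : RatFunc ℂ ≃ₐ[ℂ] FunField p) {E : Scheme.{0}} (e : E ⟶ X) [IsClosedImmersion e]
    [IsFinite (e ≫ p)] {ι : Type*} (U : ι → X.Opens) (hU : ∀ i, IsAffineOpen (U i))
    (hcov : ∀ x, ∃ i, x ∈ U i) (hg : ∀ i, genericPoint X ∈ U i) (s : ∀ i, Γ(X, U i))
    (hs : ∀ i, e.app (U i) (s i) = 0) (hs0 : ∀ i, toFunField p (U i) (hg i) (s i) ≠ 0) (o : ι)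
    (hinf : ∀ O : ValuationSubring (RatFunc ℂ), (∀ c : ℂ, algebraMap ℂ _ c ∈ O) →
      RatFunc.X ∉ O → (∀ f, ψ.symm (toFunField p (U o) (hg o) f) ∈ O) ∧
        (ψ.symm (toFunField p (U o) (hg o) (s o)))⁻¹ ∈ O)
    (i : ℂ → ι) (hi : ∀ a f, ψ.symm (toFunField p (U (i a)) (hg (i a)) f) ∈ pointRing a)
    {q : Polynomial ℂ} (hq : q ≠ 0) (hqs : ∀ a, ∃ e ∈ pointRing a, e⁻¹ ∈ pointRing a ∧
      algebraMap _ (RatFunc ℂ) q = ψ.symm (toFunField p (U (i a)) (hg (i a)) (s (i a))) * e) :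
    Module.finrank ℂ (Sections (e ≫ p) ⊤) ≤ q.natDegree := by
  -- A point of `E` cannot lie over infinity, where the equation from chart `o` is a unit, nor be
  -- the generic point, where every nonzero equation is a unit. So it is a finite point of the line.
  have hloc : ∀ Q : E, ∃ a, (valuationRing p (e Q)).comap (ψ : RatFunc ℂ →+* FunField p) =
      pointRing a := by
    intro Q
    set O := (valuationRing p (e Q)).comap (ψ : RatFunc ℂ →+* FunField p) with hO
    have hmem : ∀ f, ψ.symm f ∈ O ↔ f ∈ localRing p (e Q) := by
      intro f
      rw [hO, ValuationSubring.mem_comap]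
      change ψ (ψ.symm f) ∈ _ ↔ _
      rw [AlgEquiv.apply_symm_apply, mem_valuationRing]
    have hc : ∀ c : ℂ, algebraMap ℂ _ c ∈ O := by
      intro c
      rw [← AlgEquiv.commutes ψ.symm, hmem]
      exact (localRing p (e Q)).algebraMap_mem c
    refine exists_eq_pointRing hc ?_ ?_
    · by_contra hX
      obtain ⟨h1, h2⟩ := hinf O hc hX
      obtain ⟨y, hy, hyc⟩ := exists_isCenter_mem (hU o) (hg o) (valuationRing p (e Q))
        fun f => (hmem _).mp (h1 f)
      obtain rfl := hyc.eq (isCenter_valuationRing _)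
      rw [← map_inv₀, hmem] at h2
      exact inv_toFunField_notMem_localRing e Q hy (hs o) (hs0 o) h2
    · intro htop
      obtain ⟨j, hj⟩ := hcov (e Q)
      refine inv_toFunField_notMem_localRing (p := p) e Q hj (hs j) (hs0 j) ((hmem _).mp ?_)
      rw [htop]
      trivial
  choose a ha using hloc
  have hmem : ∀ Q f, ψ.symm f ∈ pointRing (a Q) ↔ f ∈ localRing p (e Q) := by
    intro Q f
    rw [← ha Q, ValuationSubring.mem_comap]
    change ψ (ψ.symm f) ∈ _ ↔ _
    rw [AlgEquiv.apply_symm_apply, mem_valuationRing]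
  have hinj : Function.Injective a := by
    intro Q Q' h
    have : e Q = e Q' := by
      refine valuationRing_injective (p := p) ?_
      ext f
      rw [mem_valuationRing, mem_valuationRing, ← hmem, ← hmem, h]
    exact e.isClosedEmbedding.injective this
  have hfinite : Finite E := by
    have h1 := (e ≫ p).finite_preimage_singleton default
    have h2 : (e ≫ p) ⁻¹' {default} = Set.univ :=
      Set.eq_univ_of_forall fun x => Subsingleton.elim (α := PrimeSpectrum ℂ) _ _
    rw [h2] at h1
    exact Set.finite_univ_iff.mp h1
  have := Fintype.ofFinite E
  let (Q : E) : Algebra ℂ (E.presheaf.stalk Q) := (stalkConstants (e ≫ p) Q).toAlgebra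
  -- The stalk of `E` is a quotient of the local ring of the line at `a Q` in which the local
  -- equation vanishes; up to a unit this equation is `q`.
  have hrank : ∀ Q : E, Module.Finite ℂ (E.presheaf.stalk Q) ∧
      Module.finrank ℂ (E.presheaf.stalk Q) ≤ q.rootMultiplicity (a Q) := by
    intro Q
    let : Algebra ℂ (X.presheaf.stalk (e Q)) := (stalkConstants p (e Q)).toAlgebra
    let j : X.presheaf.stalk (e Q) →ₐ[ℂ] RatFunc ℂ :=
      { (ψ.symm : FunField p →+* RatFunc ℂ).comp (stalkToFunField p (e Q)) with
        commutes' := fun c => by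
          change ψ.symm (stalkToFunField p (e Q) (X.presheaf.germ _ _ _ _)) = _
          rw [stalkToFunField_germ, toFunField_constants, AlgEquiv.commutes] }
    let π : X.presheaf.stalk (e Q) →ₐ[ℂ] E.presheaf.stalk Q :=
      { (e.stalkMap Q).hom with commutes' := stalkMap_stalkConstants p e Q }
    obtain ⟨y, hy, hyc⟩ := exists_isCenter_mem (hU (i (a Q))) (hg _) (valuationRing p (e Q))
      fun f => (hmem _ _).mp (hi (a Q) f)
    obtain rfl := hyc.eq (isCenter_valuationRing _)
    obtain ⟨c, hc, _, hqc⟩ := hqs (a Q)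
    refine finrank_le_rootMultiplicity (a := a Q) j
      (ψ.symm.injective.comp (stalkToFunField_injective _)) (fun f => ?_) π
      (e.stalkMap_surjective Q) (x := X.presheaf.germ (U (i (a Q))) (e Q) hy (s (i (a Q)))) ?_ hq
      hc ?_
    · rw [← ψ.symm_apply_apply f, hmem]
      exact ⟨fun ⟨t, ht⟩ => ⟨t, congrArg ψ.symm ht⟩, fun ⟨t, ht⟩ => ⟨t, ψ.symm.injective ht⟩⟩
    · refine (Scheme.Hom.germ_stalkMap_apply e _ Q hy _).trans ?_
      rw [hs, map_zero]
    · refine hqc.trans (congrArg (· * c) ?_)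
      exact congrArg ψ.symm (stalkToFunField_germ hy _).symm
  have (Q : E) := (hrank Q).1
  let Φ : Sections (e ≫ p) ⊤ →ₗ[ℂ] (∀ Q : E, E.presheaf.stalk Q) :=
    LinearMap.pi fun Q => AlgHom.toLinearMap
      { (E.presheaf.germ ⊤ Q (Opens.mem_top Q)).hom with commutes' := fun c => rfl }
  have hΦ : Function.Injective Φ := fun f g hfg =>
    TopCat.Presheaf.section_ext E.sheaf ⊤ f g fun Q _ => congrFun hfg Q
  calc Module.finrank ℂ (Sections (e ≫ p) ⊤)
      ≤ Module.finrank ℂ (∀ Q : E, E.presheaf.stalk Q) :=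
        LinearMap.finrank_le_finrank_of_injective hΦ
    _ = ∑ Q : E, Module.finrank ℂ (E.presheaf.stalk Q) := Module.finrank_pi_fintype ℂ
    _ ≤ ∑ Q : E, q.rootMultiplicity (a Q) := Finset.sum_le_sum fun Q _ => (hrank Q).2
    _ = ∑ b ∈ Finset.univ.map ⟨a, hinj⟩, q.rootMultiplicity b := by rw [Finset.sum_map]; rfl
    _ ≤ q.natDegree := sum_rootMultiplicity_le q _

end

/-- A coordinate of a rational curve without poles of given functions at infinity. -/
theorem exists_algEquiv_ratFunc {F : Type*} [Field F] [Algebra ℂ F] {x : F}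
    (hx : Transcendental ℂ x) (htop : IntermediateField.adjoin ℂ {x} = ⊤) {t : Set F}
    (ht : t.Finite) : ∃ ψ : RatFunc ℂ ≃ₐ[ℂ] F, ∀ O : ValuationSubring (RatFunc ℂ),
      (∀ c : ℂ, algebraMap ℂ _ c ∈ O) → RatFunc.X ∉ O → ∀ f ∈ t, ψ.symm f ∈ O := by
  let ψ₀ : RatFunc ℂ ≃ₐ[ℂ] F := (RatFunc.algEquivOfTranscendental x hx).trans
    ((IntermediateField.equivOfEq htop).trans IntermediateField.topEquiv)
  obtain ⟨τ, hτ⟩ := exists_algEquiv_forall_mem (ht.image ψ₀.symm)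
  exact ⟨τ.symm.trans ψ₀, fun O hO hX f hf => hτ _ ⟨f, hf, rfl⟩ O hO hX⟩

/-- Regularity at a place of all functions on a chart becomes a condition on finitely many of them,
so that it can be arranged by the choice of coordinate. -/
theorem sections_mem_of_generators {X : Scheme.{0}} [IsIntegral X] {p : X ⟶ SpecC}
    [LocallyOfFiniteType p] {U : X.Opens} (hU : IsAffineOpen U) (hg : genericPoint X ∈ U) :
    ∃ t : Set (FunField p), t.Finite ∧ ∀ A : Subalgebra ℂ (FunField p), t ⊆ A →
      ∀ s, toFunField p U hg s ∈ A := by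
  let := (constants p U).toAlgebra
  have : Algebra.FiniteType ℂ Γ(X, U) := constants_finiteType p hU
  obtain ⟨G, hG⟩ := this
  let j : Γ(X, U) →ₐ[ℂ] FunField p :=
    { toFunField p U hg with commutes' := toFunField_constants U hg }
  refine ⟨j '' G, G.finite_toSet.image j, fun A hA s => ?_⟩
  have h1 : Algebra.adjoin ℂ (G : Set Γ(X, U)) ≤ A.comap j :=
    Algebra.adjoin_le fun g hg => hA ⟨g, hg, rfl⟩
  rw [hG] at h1
  exact h1 (Algebra.mem_top (x := s))

/-! ### The function field of a cyclic covering of a curve. -/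

namespace IsClassicalCyclicCovering

variable {Z W : Scheme.{0}} {θ : Z ⟶ W} {L : LineBundle W} {n : ℕ} {s : L.PowerSection n}

theorem app_injective (h : IsClassicalCyclicCovering θ L n s) (hn : n ≠ 0) (i : L.ι) :
    Function.Injective (θ.app (L.U i)) := by
  obtain ⟨z, -, -, hz⟩ := h.exists_coordinate
  intro a b hab
  have : NeZero n := ⟨hn⟩
  have key : ∀ c : Γ(W, L.U i), (θ.app (L.U i)).hom c =
      ∑ l : Fin n, (θ.app (L.U i)).hom ((Pi.single 0 c : Fin n → Γ(W, L.U i)) l) *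
        z i ^ (l : ℕ) := by
    intro c
    rw [Finset.sum_eq_single 0]
    · simp
    · intro l _ hl
      simp [Pi.single_eq_of_ne hl]
    · simp
  have h2 := (hz i _).unique (key a) (hab.trans (key b))
  simpa using congrFun h2 0

variable [IsIntegral Z] [IsIntegral W]

/-- Functions on a chart inject into functions on its preimage, so a nonempty basic open subset has
a nonempty preimage, which contains the generic point. Thus `θ` is dominant. -/
theorem genericPoint_specializes (h : IsClassicalCyclicCovering θ L n s) (hn : n ≠ 0) :
    θ (genericPoint Z) ⤳ genericPoint W := by
  rw [specializes_iff_forall_open]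
  intro V hV hη
  obtain ⟨i, hi⟩ : ∃ i, genericPoint W ∈ L.U i := by
    rw [← Opens.mem_iSup, L.cover]; exact Opens.mem_top _
  obtain ⟨f, hfV, hηf⟩ := (L.isAffineOpen i).exists_basicOpen_le (V := ⟨V, hV⟩)
    ⟨genericPoint W, hη⟩ hi
  apply hfV
  change genericPoint Z ∈ θ ⁻¹ᵁ W.basicOpen f
  rw [Scheme.preimage_basicOpen]
  have hne : Z.basicOpen (θ.app (L.U i) f) ≠ ⊥ := by
    intro h0
    rw [basicOpen_eq_bot_iff] at h0
    have hf0 := h.app_injective hn i (h0.trans (map_zero _).symm)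
    rw [hf0, Scheme.basicOpen_zero] at hηf
    exact hηf
  obtain ⟨x, hx⟩ := (Opens.ne_bot_iff_nonempty _).mp hne
  exact genericPoint_mem_of_mem hx

variable {pW : W ⟶ SpecC}

/-- The isomorphism `ψ` is a parameter so that the same basis can be used over the function field of
`W` itself and over `ℂ(x)` for any coordinate `x`. -/
theorem exists_basis (hη : θ (genericPoint Z) ⤳ genericPoint W) {i : L.ι}
    (hi : genericPoint Z ∈ θ ⁻¹ᵁ L.U i) [IsAffineHom θ] {F : Type*} [Field F]
    (ψ : F ≃+* FunField pW) {z : Γ(Z, θ ⁻¹ᵁ L.U i)}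
    (hz : ∀ w, ∃! a : Fin n → Γ(W, L.U i), w = ∑ l, (θ.app (L.U i)).hom (a l) * z ^ (l : ℕ)) :
    letI := ((pullFun pW θ hη).comp (ψ : F →+* FunField pW)).toAlgebra
    ∃ B : Module.Basis (Fin n) F (FunField (θ ≫ pW)),
      ∀ l, B l = toFunField (θ ≫ pW) (θ ⁻¹ᵁ L.U i) hi z ^ (l : ℕ) := by
  refine exists_basis_of_existsUnique (θ.app (L.U i)).hom
    ((ψ.symm : FunField pW →+* F).comp (toFunField pW (L.U i) (genericPoint_mem_of_mem hi)))
    (toFunField (θ ≫ pW) (θ ⁻¹ᵁ L.U i) hi) _ (fun r => ?_)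
    (ψ.symm.injective.comp (toFunField_injective _ _)) (fun f => ?_) (toFunField_injective _ _)
    (fun f => exists_fraction ((L.isAffineOpen i).preimage θ) hi f) hz
  · refine (pullFun_toFunField pW θ hη (L.U i) hi r).symm.trans ?_
    exact congrArg (pullFun pW θ hη) (ψ.apply_symm_apply _).symm
  · obtain ⟨a, b, hb, hab⟩ := exists_fraction (L.isAffineOpen i) (genericPoint_mem_of_mem hi) (ψ f)
    refine ⟨a, b, (map_ne_zero_iff _ ψ.symm.injective).mpr hb, ψ.injective ?_⟩
    change ψ (f * ψ.symm _) = ψ (ψ.symm _)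
    rw [map_mul, ψ.apply_symm_apply, ψ.apply_symm_apply, hab]

/-- The function field of a cyclic covering of degree `n` of a rational curve is an extension of
degree `n` of a field of rational functions. -/
theorem exists_finrank_adjoin_eq (h : IsClassicalCyclicCovering θ L n s) (hn : n ≠ 0)
    {x : FunField pW} (hx : Transcendental ℂ x) (htop : IntermediateField.adjoin ℂ {x} = ⊤) :
    ∃ y : FunField (θ ≫ pW), Transcendental ℂ y ∧
      Module.finrank (IntermediateField.adjoin ℂ {y}) (FunField (θ ≫ pW)) = n := by
  have hη := h.genericPoint_specializes hn
  have := h.isAffineHom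
  obtain ⟨i, hi⟩ : ∃ i, θ (genericPoint Z) ∈ L.U i := by
    rw [← Opens.mem_iSup, L.cover]; exact Opens.mem_top _
  obtain ⟨z, -, -, hz⟩ := h.exists_coordinate
  obtain ⟨B, -⟩ := exists_basis (pW := pW) hη (i := i) hi (RingEquiv.refl _) (hz i)
  let j : FunField pW →ₐ[ℂ] FunField (θ ≫ pW) :=
    { pullFun pW θ hη with commutes' := pullFun_algebraMap pW θ hη }
  refine ⟨j x, fun halg => hx ((isAlgebraic_algHom_iff j j.injective).mp halg), ?_⟩
  refine (finrank_eq_finrank_adjoin (pullFun pW θ hη) (pullFun pW θ hη).injective (j x)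
    fun f => ?_).symm.trans ?_
  · have h1 : IntermediateField.adjoin ℂ {j x} = j.fieldRange := by
      rw [AlgHom.fieldRange_eq_map, ← htop, IntermediateField.adjoin_map, Set.image_singleton]
    rw [h1]
    rfl
  · let := ((pullFun pW θ hη).comp ((RingEquiv.refl (FunField pW) : FunField pW ≃+* FunField pW) :
      FunField pW →+* FunField pW)).toAlgebra
    exact (Module.finrank_eq_card_basis B).trans (Fintype.card_fin n)

theorem isIntegralCombination (hη : θ (genericPoint Z) ⤳ genericPoint W) {i : L.ι}
    (hi : genericPoint Z ∈ θ ⁻¹ᵁ L.U i) {F : Type*} [Field F]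
    (ψ : F ≃+* FunField pW) {z : Γ(Z, θ ⁻¹ᵁ L.U i)}
    (hz : ∀ w, ∃! a : Fin n → Γ(W, L.U i), w = ∑ l, (θ.app (L.U i)).hom (a l) * z ^ (l : ℕ))
    {f : FunField (θ ≫ pW)} (hf : f ∈ sectionRing (θ ≫ pW) (θ ⁻¹ᵁ L.U i) hi) :
    letI := ((pullFun pW θ hη).comp (ψ : F →+* FunField pW)).toAlgebra
    IsIntegralCombination n
      (Set.range fun r => ψ.symm (toFunField pW (L.U i) (genericPoint_mem_of_mem hi) r))
      (toFunField (θ ≫ pW) (θ ⁻¹ᵁ L.U i) hi z) f := by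
  let := ((pullFun pW θ hη).comp (ψ : F →+* FunField pW)).toAlgebra
  obtain ⟨w, rfl⟩ := hf
  obtain ⟨a, ha, _⟩ := hz w
  refine ⟨fun l => ψ.symm (toFunField pW (L.U i) (genericPoint_mem_of_mem hi) (a l)),
    fun l => ⟨a l, rfl⟩, ?_⟩
  refine (congrArg (toFunField (θ ≫ pW) (θ ⁻¹ᵁ L.U i) hi) ha).trans ?_
  rw [map_sum]
  refine Finset.sum_congr rfl fun l _ => ?_
  rw [map_mul, map_pow, Algebra.smul_def]
  refine congrArg (· * _) ((pullFun_toFunField pW θ hη (L.U i) hi (a l)).symm.trans ?_)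
  exact congrArg (pullFun pW θ hη) (ψ.apply_symm_apply _).symm

end IsClassicalCyclicCovering

/-- The elements of a function field which belong to a valuation ring of an isomorphic field. -/
def comapSubalgebra {L F : Type*} [Field L] [Field F] [Algebra ℂ L] [Algebra ℂ F]
    (ψ : L ≃ₐ[ℂ] F) (O : ValuationSubring L) (hO : ∀ c : ℂ, algebraMap ℂ L c ∈ O) :
    Subalgebra ℂ F :=
  { O.toSubring.comap (ψ.symm : F →+* L) with
    algebraMap_mem' := fun c => by
      change ψ.symm (algebraMap ℂ F c) ∈ O
      rw [AlgEquiv.commutes]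
      exact hO c }

namespace IsClassicalCyclicCovering

variable {Z W : Scheme.{0}} {θ : Z ⟶ W} {L : LineBundle W} {n : ℕ} {s : L.PowerSection n}
  [IsIntegral Z] [IsIntegral W] {pW : W ⟶ SpecC}

/-- A cyclic covering of degree `n` of a rational curve has gonality at least `n` if the length of
the branch divisor is at least `2 * n`. -/
theorem le_finrank_adjoin [SmoothOfRelativeDimension 1 pW] [IsProper pW]
    [SmoothOfRelativeDimension 1 (θ ≫ pW)] (h : IsClassicalCyclicCovering θ L n s) (hn : 2 ≤ n)
    {x : FunField pW} (hx : Transcendental ℂ x) (htop : IntermediateField.adjoin ℂ {x} = ⊤)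
    {E : Scheme.{0}} (e : E ⟶ W) [IsClosedImmersion e] [IsFinite (e ≫ pW)]
    (he : ∀ i, e.app (L.U i) (s.val i) = 0)
    (hE : 2 * n ≤ Module.finrank ℂ (Sections (e ≫ pW) ⊤))
    {u : FunField (θ ≫ pW)} (hu : Transcendental ℂ u) :
    n ≤ Module.finrank (IntermediateField.adjoin ℂ {u}) (FunField (θ ≫ pW)) := by
  have hn0 : n ≠ 0 := by omega
  have hη := h.genericPoint_specializes hn0
  have := h.isAffineHom
  obtain ⟨z, hz1, hz2, hz3⟩ := h.exists_coordinate
  -- Only nonempty charts have functions that embed into the function field.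
  let I := {i : L.ι // genericPoint W ∈ L.U i}
  have hcov : ∀ y : W, ∃ i : I, y ∈ L.U i.1 := by
    intro y
    obtain ⟨i, hi⟩ : ∃ i, y ∈ L.U i := by
      rw [← Opens.mem_iSup, L.cover]; exact Opens.mem_top _
    exact ⟨⟨i, genericPoint_mem_of_mem hi⟩, hi⟩
  have hZ : ∀ i : I, genericPoint Z ∈ θ ⁻¹ᵁ L.U i.1 := fun i =>
    hη.mem_open (L.U i.1).isOpen i.2
  let ζ : I → FunField (θ ≫ pW) := fun i => toFunField (θ ≫ pW) (θ ⁻¹ᵁ L.U i.1) (hZ i) (z i.1)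
  let σ : I → FunField pW := fun i => toFunField pW (L.U i.1) i.2 (s.val i.1)
  have hζσ : ∀ i, ζ i ^ n = pullFun pW θ hη (σ i) := by
    intro i
    refine ((map_pow _ _ _).symm.trans (congrArg _ (hz2 i.1))).trans ?_
    exact (pullFun_toFunField pW θ hη (L.U i.1) (hZ i) _).symm
  have hζ0 : ∀ i, ζ i ≠ 0 := by
    intro i
    obtain ⟨B, hB⟩ := exists_basis (pW := pW) hη (hZ i) (RingEquiv.refl _) (hz3 i.1)
    let := ((pullFun pW θ hη).comp ((RingEquiv.refl (FunField pW) : FunField pW ≃+* FunField pW) :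
      FunField pW →+* FunField pW)).toAlgebra
    have h1 := B.ne_zero ⟨1, by omega⟩
    rw [hB, pow_one] at h1
    exact h1
  have hσ0 : ∀ i, σ i ≠ 0 := by
    intro i h0
    have h1 := hζσ i
    rw [h0, map_zero] at h1
    exact pow_ne_zero n (hζ0 i) h1
  obtain ⟨o, -⟩ := hcov (genericPoint W)
  obtain ⟨c', hc'⟩ : ∃ c' : Fin n → FunField pW,
      u = ∑ j, pullFun pW θ hη (c' j) * ζ o ^ (j : ℕ) := by
    obtain ⟨B, hB⟩ := exists_basis (pW := pW) hη (hZ o) (RingEquiv.refl _) (hz3 o.1)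
    let := ((pullFun pW θ hη).comp ((RingEquiv.refl (FunField pW) : FunField pW ≃+* FunField pW) :
      FunField pW →+* FunField pW)).toAlgebra
    refine ⟨fun j => B.repr u j, (B.sum_repr u).symm.trans (Finset.sum_congr rfl fun j _ => ?_)⟩
    rw [Algebra.smul_def, hB]
    rfl
  -- The coordinate is chosen so that infinity lies in the chart `o`, off the branch divisor, and
  -- the coefficients of `u` are regular there. Generators of the chart, the coefficients, and the
  -- branch equation with its inverse are finitely many functions that express this.
  obtain ⟨t, ht, htgen⟩ := sections_mem_of_generators (p := pW) (L.isAffineOpen o.1) o.2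
  obtain ⟨ψ, hψ⟩ := exists_algEquiv_ratFunc hx htop
    (ht.union ((Set.finite_range c').union (Set.toFinite {σ o, (σ o)⁻¹})))
  have hgen : ∀ O : ValuationSubring (RatFunc ℂ), (∀ c : ℂ, algebraMap ℂ _ c ∈ O) →
      (∀ f ∈ t, ψ.symm f ∈ O) → ∀ f, ψ.symm (toFunField pW (L.U o.1) o.2 f) ∈ O :=
    fun O hO hf => htgen (comapSubalgebra ψ O hO) hf
  have hconst : ∀ a c : ℂ, algebraMap ℂ (RatFunc ℂ) c ∈ pointRing a := by
    intro a c
    rw [RatFunc.algebraMap_eq_C, ← RatFunc.algebraMap_C]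
    exact algebraMap_mem_pointRing _ _
  -- The chart `o` is preferred wherever it contains the point `a`; elsewhere any chart through the
  -- center of the local ring at `a` serves. As the chart `o` has finitely many generators, it fails
  -- at only finitely many `a`.
  have hidx : ∀ a : ℂ, ∃ i : I, (∀ f, ψ.symm (toFunField pW (L.U i.1) i.2 f) ∈ pointRing a) ∧
      ((∀ f, ψ.symm (toFunField pW (L.U o.1) o.2 f) ∈ pointRing a) → i = o) := by
    intro a
    by_cases ha : ∀ f, ψ.symm (toFunField pW (L.U o.1) o.2 f) ∈ pointRing a
    · exact ⟨o, ha, fun _ => rfl⟩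
    · obtain ⟨Q, hQ⟩ := exists_isCenter (p := pW)
        ((pointRing a).comap (ψ.symm : FunField pW →+* RatFunc ℂ)) fun c => by
          rw [ValuationSubring.mem_comap]
          change ψ.symm _ ∈ _
          rw [AlgEquiv.commutes]
          exact hconst a c
      obtain ⟨i, hi⟩ := hcov Q
      exact ⟨i, fun f => (hQ _ (sectionRing_le_localRing hi ⟨f, rfl⟩)).1, fun h' => absurd h' ha⟩
  choose i hi hio using hidx
  have hfin : {a | i a ≠ o}.Finite := by
    refine (ht.biUnion fun f _ => finite_setOf_notMem_pointRing (ψ.symm f)).subset fun a ha => ?_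
    by_contra hcon
    refine ha (hio a (hgen _ (hconst a) fun f hf => ?_))
    by_contra hfa
    exact hcon (Set.mem_biUnion hf hfa)
  have hinfty := hψ (inftyRing ℂ) algebraMap_mem_inftyRing X_notMem_inftyRing
  let := ((pullFun pW θ hη).comp ((ψ : RatFunc ℂ ≃+* FunField pW) :
    RatFunc ℂ →+* FunField pW)).toAlgebra
  have halg : ∀ f, algebraMap (RatFunc ℂ) (FunField (θ ≫ pW)) f = pullFun pW θ hη (ψ f) :=
    fun _ => rfl
  have halg' : ∀ f, algebraMap (RatFunc ℂ) (FunField (θ ≫ pW)) (ψ.symm f) =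
      pullFun pW θ hη f := fun f => by rw [halg, ψ.apply_symm_apply]
  have : IsScalarTower ℂ (RatFunc ℂ) (FunField (θ ≫ pW)) := .of_algebraMap_eq fun c => by
    rw [halg, AlgEquiv.commutes, pullFun_algebraMap]
  have := finite_adjoin_of_transcendental hu
  obtain ⟨B, hB⟩ := exists_basis (pW := pW) hη (hZ o) (ψ : RatFunc ℂ ≃+* FunField pW) (hz3 o.1)
  have hgo : ∀ i : I, genericPoint W ∈ L.U i.1 ⊓ L.U o.1 := fun i => ⟨i.2, o.2⟩
  have hZo : ∀ i : I, genericPoint Z ∈ θ ⁻¹ᵁ (L.U i.1 ⊓ L.U o.1) := fun i => ⟨hZ i, hZ o⟩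
  refine le_finrank_of_cyclic_charts hn
    (fun i : I => Set.range fun r => ψ.symm (toFunField pW (L.U i.1) i.2 r)) ζ
    (fun i => ψ.symm (σ i))
    (fun i => ψ.symm (toFunField pW (L.U i.1 ⊓ L.U o.1) (hgo i) (L.g i.1 o.1)))
    o B hB (fun i => ?_) (fun i => ?_) (fun i => ?_) (fun i => ⟨_, rfl⟩) ?_ ?_ ?_ i ?_ hfin ?_ hu
    (fun j => ψ.symm (c' j)) ?_ (fun j => ?_) (fun i => ?_)
  · exact ((((L.g i.1 o.1).isUnit.map (toFunField pW _ (hgo i))).map ψ.symm).ne_zero)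
  · rw [Algebra.smul_def, halg']
    have h1 := congrArg (toFunField (θ ≫ pW) _ (hZo i)) (hz1 i.1 o.1)
    rw [map_mul, toFunField_restrict, toFunField_restrict] at h1
    refine h1.trans (congrArg (· * _) ?_)
    exact (pullFun_toFunField pW θ hη _ (hZo i) _).symm
  · rw [halg', hζσ]
  · exact (map_ne_zero_iff _ ψ.symm.injective).mpr (hσ0 o)
  · exact mem_inftyRing.mp (hinfty _ (by simp))
  · rw [← map_inv₀]
    exact mem_inftyRing.mp (hinfty _ (by simp))
  · rintro a _ ⟨f, rfl⟩
    exact hi a f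
  · intro q hq hqs
    refine hE.trans (finrank_sections_le_natDegree ψ e (fun i : I => L.U i.1)
      (fun i => L.isAffineOpen i.1) hcov (fun i => i.2) (fun i => s.val i.1) (fun i => he i.1) hσ0
      o (fun O hO hX => ⟨hgen O hO fun f hf => hψ O hO hX f (Or.inl hf), ?_⟩) i hi hq hqs)
    rw [← map_inv₀]
    exact hψ O hO hX _ (by simp [σ])
  · simp_rw [Algebra.smul_def, halg']
    exact hc'
  · exact mem_inftyRing.mp (hinfty _ (by simp))
  · obtain ⟨a, b, hab, h1, h2, h3, h4⟩ := exists_add_eq_one_of_isAffineOpen (p := θ ≫ pW)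
      ((L.isAffineOpen i.1).preimage θ) (hZ i) u
    have key := fun f => isIntegralCombination (pW := pW) hη (hZ i)
      (ψ : RatFunc ℂ ≃+* FunField pW) (hz3 i.1) (f := f)
    exact ⟨a, b, hab, key _ h1, key _ h2, key _ h3, key _ h4⟩

end IsClassicalCyclicCovering

/-! ### Base change of cyclic coverings. -/

theorem existsUnique_of_isPushout {R S T P : CommRingCat.{0}} {f : R ⟶ S} {g : R ⟶ T} {i : S ⟶ P}
    {j : T ⟶ P} (h : IsPushout f g i j) {n : ℕ} {z : S}
    (hz : ∀ w : S, ∃! a : Fin n → R, w = ∑ l, f.hom (a l) * z ^ (l : ℕ)) (w : P) :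
    ∃! a : Fin n → T, w = ∑ l, j.hom (a l) * i.hom z ^ (l : ℕ) := by
  let := f.hom.toAlgebra
  let := g.hom.toAlgebra
  let := i.hom.toAlgebra
  let := j.hom.toAlgebra
  let := (i.hom.comp f.hom).toAlgebra
  have : IsScalarTower R S P := .of_algebraMap_eq fun _ => rfl
  have : IsScalarTower R T P := .of_algebraMap_eq' congr($(h.1.1).hom)
  have hP : Algebra.IsPushout R T S P := CommRingCat.isPushout_iff_isPushout.mp h.flip
  obtain ⟨b, hb⟩ := exists_powerBasis_of_existsUnique (R := R) (S := S) hz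
  refine existsUnique_of_powerBasis (R := T) (S := P) (hP.out.basis b) (fun l => ?_) w
  rw [IsBaseChange.basis_apply, hb]
  exact map_pow i.hom z l

theorem app_restrict {Y' Y : Scheme.{0}} (k : Y' ⟶ Y) {U V : Y.Opens} (h : V ≤ U) (x : Γ(Y, U)) :
    k.app V (restrict h x) = restrict (k.preimage_mono h) (k.app U x) := by
  simp only [restrict]
  rw [← CommRingCat.comp_apply, k.naturality]
  rfl

theorem appLE_restrict {Y' Y : Scheme.{0}} (k : Y' ⟶ Y) {U V : Y.Opens} {U' V' : Y'.Opens}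
    (h : V ≤ U) (hU : U' ≤ k ⁻¹ᵁ U) (hV : V' ≤ k ⁻¹ᵁ V) (h' : V' ≤ U') (x : Γ(Y, U)) :
    k.appLE V V' hV (restrict h x) = restrict h' (k.appLE U U' hU x) := by
  simp only [restrict]
  rw [← CommRingCat.comp_apply, ← CommRingCat.comp_apply, Scheme.Hom.map_appLE,
    Scheme.Hom.appLE_map]

/-- The pullback of a line bundle under an affine morphism. -/
def LineBundle.pullback {Y' Y : Scheme.{0}} (k : Y' ⟶ Y) [IsAffineHom k] (L : LineBundle Y) :
    LineBundle Y' where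
  ι := L.ι
  U i := k ⁻¹ᵁ L.U i
  isAffineOpen i := (L.isAffineOpen i).preimage k
  cover := by rw [← Scheme.Hom.preimage_iSup, L.cover, Scheme.Hom.preimage_top]
  g i j := Units.map (k.app (L.U i ⊓ L.U j)).hom.toMonoidHom (L.g i j)
  cocycle i j l := by
    have h := congrArg (k.app _) (L.cocycle i j l)
    rw [map_mul, app_restrict, app_restrict, app_restrict] at h
    exact h

/-- The pullback of a section of a power of a line bundle under an affine morphism. -/
def LineBundle.PowerSection.pullback {Y' Y : Scheme.{0}} (k : Y' ⟶ Y) [IsAffineHom k]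
    {L : LineBundle Y} {n : ℕ} (s : L.PowerSection n) : (L.pullback k).PowerSection n where
  val i := k.app (L.U i) (s.val i)
  compat i j := by
    have h := congrArg (k.app _) (s.compat i j)
    rw [map_mul, map_pow, app_restrict, app_restrict] at h
    exact h

/-- Classical cyclic coverings are stable under affine base change. -/
theorem IsClassicalCyclicCovering.baseChange {Z Y Z' Y' : Scheme.{0}} {θ : Z ⟶ Y} {θ' : Z' ⟶ Y'}
    {k' : Z' ⟶ Z} {k : Y' ⟶ Y} [IsAffineHom k] {L : LineBundle Y} {n : ℕ} {s : L.PowerSection n}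
    (h : IsClassicalCyclicCovering θ L n s) (sq : IsPullback k' θ' θ k) :
    IsClassicalCyclicCovering θ' (L.pullback k) n (s.pullback k) := by
  have := h.isAffineHom
  have hpre : ∀ U : Y.Opens, θ' ⁻¹ᵁ (k ⁻¹ᵁ U) = k' ⁻¹ᵁ (θ ⁻¹ᵁ U) := fun U => by
    rw [← Scheme.Hom.comp_preimage, ← Scheme.Hom.comp_preimage, sq.w]
  have hcomm : ∀ (U : Y.Opens) (x : Γ(Y, U)), θ'.app (k ⁻¹ᵁ U) (k.app U x) =
      k'.appLE (θ ⁻¹ᵁ U) (θ' ⁻¹ᵁ (k ⁻¹ᵁ U)) (hpre U).le (θ.app U x) := by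
    intro U x
    rw [Scheme.Hom.app_eq_appLE, Scheme.Hom.app_eq_appLE, Scheme.Hom.app_eq_appLE,
      ← CommRingCat.comp_apply, ← CommRingCat.comp_apply, Scheme.Hom.appLE_comp_appLE,
      Scheme.Hom.appLE_comp_appLE]
    have key : ∀ (f g : Z' ⟶ Y) (e : f = g) (V : Z'.Opens) (hf : V ≤ f ⁻¹ᵁ U) (hg : V ≤ g ⁻¹ᵁ U),
        f.appLE U V hf = g.appLE U V hg := by
      rintro f _ rfl V _ _
      rfl
    rw [key _ _ sq.w]
  obtain ⟨z, hz1, hz2, hz3⟩ := h.exists_coordinate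
  refine ⟨MorphismProperty.of_isPullback sq h.isAffineHom,
    fun i => k'.appLE (θ ⁻¹ᵁ L.U i) (θ' ⁻¹ᵁ (k ⁻¹ᵁ L.U i)) (hpre _).le (z i),
    fun i j => ?_, fun i => ?_, fun i => ?_⟩
  · have h1 := congrArg (k'.appLE (θ ⁻¹ᵁ (L.U i ⊓ L.U j)) (θ' ⁻¹ᵁ (k ⁻¹ᵁ (L.U i ⊓ L.U j)))
      (hpre _).le) (hz1 i j)
    rw [map_mul, appLE_restrict k' _ (hpre _).le _ (θ'.preimage_mono (k.preimage_mono inf_le_left)),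
      appLE_restrict k' _ (hpre _).le _ (θ'.preimage_mono (k.preimage_mono inf_le_right))] at h1
    refine h1.trans (congrArg (· * _) ?_)
    exact (hcomm _ _).symm
  · refine (map_pow _ _ _).symm.trans ((congrArg _ (hz2 i)).trans ?_)
    exact (hcomm _ _).symm
  · have hUY : θ' ⁻¹ᵁ (k ⁻¹ᵁ L.U i) = k' ⁻¹ᵁ (θ ⁻¹ᵁ L.U i) ⊓ θ' ⁻¹ᵁ (k ⁻¹ᵁ L.U i) := by
      rw [hpre, inf_idem]
    -- Over affine charts the cartesian square becomes a pushout of rings, and a power basis stays a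
    -- power basis under base change.
    have hP := (isIso_pushoutSection_iff sq (US := L.U i) (UT := k ⁻¹ᵁ L.U i)
      (UX := θ ⁻¹ᵁ L.U i) le_rfl le_rfl hUY).mp (isIso_pushoutSection_of_isAffineOpen sq _ _ _
        (L.isAffineOpen i) ((L.isAffineOpen i).preimage k) ((L.isAffineOpen i).preimage θ))
    rw [← Scheme.Hom.app_eq_appLE, ← Scheme.Hom.app_eq_appLE] at hP
    rw [← Scheme.Hom.app_eq_appLE] at hP
    exact existsUnique_of_isPushout hP (hz3 i)

/-! ### General points of the base and birational morphisms. -/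

theorem exists_isOpen_subset_or_subset_compl {T : Type*} [TopologicalSpace T] [IrreducibleSpace T]
    {s : Set T} (hs : Topology.IsConstructible s) :
    ∃ U : Set T, IsOpen U ∧ U.Nonempty ∧ (U ⊆ s ∨ U ⊆ sᶜ) := by
  induction hs using Topology.IsConstructible.empty_union_induction with
  | open_retrocompact U hU _ =>
    rcases U.eq_empty_or_nonempty with rfl | hne
    · exact ⟨Set.univ, isOpen_univ, Set.univ_nonempty, Or.inr (by simp)⟩
    · exact ⟨U, hU, hne, Or.inl subset_rfl⟩
  | union s _ t _ h1 h2 =>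
    obtain ⟨U, hU, hUne, h1 | h1⟩ := h1
    · exact ⟨U, hU, hUne, Or.inl (h1.trans Set.subset_union_left)⟩
    obtain ⟨V, hV, hVne, h2 | h2⟩ := h2
    · exact ⟨V, hV, hVne, Or.inl (h2.trans Set.subset_union_right)⟩
    refine ⟨U ∩ V, hU.inter hV, nonempty_preirreducible_inter hU hV hUne hVne, Or.inr ?_⟩
    rw [Set.compl_union]
    exact Set.inter_subset_inter h1 h2
  | compl s _ h =>
    obtain ⟨U, hU, hUne, h⟩ := h
    exact ⟨U, hU, hUne, by rwa [compl_compl, or_comm]⟩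

/-- By Chevalley the image of `V` is constructible, so it or its complement contains a nonempty open
set. The complement cannot: by surjectivity the preimage of that open set is nonempty and contains
the generic point of `S`, which also lies in `V`. -/
theorem exists_isOpen_subset_image {S B : Scheme.{0}} [IsIntegral S] [IsIntegral B]
    [IsLocallyNoetherian B] [CompactSpace B] [QuasiSeparatedSpace B] [IsLocallyNoetherian S]
    (f : S ⟶ B) [LocallyOfFiniteType f] [QuasiCompact f] [CompactSpace S]
    [Surjective f] (V : S.Opens) (hV : (V : Set S).Nonempty) :
    ∃ U : B.Opens, (U : Set B).Nonempty ∧ (U : Set B) ⊆ f '' V := by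
  have : IsNoetherian S := {}
  have hc : Topology.IsConstructible (V : Set S) :=
    (NoetherianSpace.isCompact _).isConstructible V.isOpen
  obtain ⟨U, hU, hne, h | h⟩ := exists_isOpen_subset_or_subset_compl (f.isConstructible_image hc)
  · exact ⟨⟨U, hU⟩, hne, h⟩
  · exfalso
    obtain ⟨y, hy⟩ := hne
    obtain ⟨x, rfl⟩ := f.surjective y
    obtain ⟨v, hv⟩ := hV
    have h1 : genericPoint S ∈ V := genericPoint_mem_of_mem hv
    have h2 : genericPoint S ∈ f ⁻¹ᵁ (⟨U, hU⟩ : B.Opens) := genericPoint_mem_of_mem (x := x) hy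
    exact h h2 ⟨_, h1, rfl⟩

/-- Restriction to an open set is itself a base change, so the restriction of `ρ'` is a base change
of that of `ρ`. -/
theorem isIso_morphismRestrict_of_isPullback {Z S Z' S' : Scheme.{0}} {ρ : Z ⟶ S} {ρ' : Z' ⟶ S'}
    {k' : Z' ⟶ Z} {k : S' ⟶ S} (sq : IsPullback k' ρ' ρ k) (V : S.Opens) [IsIso (ρ ∣_ V)] :
    IsIso (ρ' ∣_ (k ⁻¹ᵁ V)) := by
  have h1 := (isPullback_morphismRestrict ρ' (k ⁻¹ᵁ V)).flip.paste_horiz sq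
  rw [← morphismRestrict_ι] at h1
  have h2 := IsPullback.of_right' h1 (isPullback_morphismRestrict ρ V).flip
  exact h2.isIso_snd_of_isIso

/-- A birational morphism induces an isomorphism of function fields. -/
theorem exists_algEquiv_funField {Z S : Scheme.{0}} [IsIntegral Z] [IsIntegral S] (p : S ⟶ SpecC)
    (ρ : Z ⟶ S) (h : IsBirationalMorphism ρ) :
    Nonempty (FunField p ≃ₐ[ℂ] FunField (ρ ≫ p)) := by
  obtain ⟨V, ⟨v, hv⟩, hiso⟩ := h
  obtain ⟨y, hyv⟩ := (ρ ∣_ V).surjective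
    (⟨genericPoint S, genericPoint_mem_of_mem hv⟩ : V.toScheme)
  have hyη : ρ y.1 = genericPoint S :=
    (morphismRestrict_base_coe ρ V y).symm.trans (congrArg Subtype.val hyv)
  have hη : ρ (genericPoint Z) ⤳ genericPoint S :=
    hyη ▸ ((genericPoint_spec Z).specializes (Set.mem_univ y.1)).map ρ.continuous
  have hZV : genericPoint Z ∈ ρ ⁻¹ᵁ V := genericPoint_mem_of_mem y.2
  have hst : IsIso (ρ.stalkMap (genericPoint Z)) := by
    let x : (ρ ⁻¹ᵁ V).toScheme := ⟨genericPoint Z, hZV⟩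
    have h1 : IsIso ((ρ ∣_ V).stalkMap x) := inferInstance
    exact ((MorphismProperty.isomorphisms CommRingCat).arrow_mk_iso_iff
      (morphismRestrictStalkMap ρ V x)).mp h1
  have hins : Inseparable (genericPoint S) (ρ (genericPoint Z)) :=
    inseparable_iff_specializes_and.mpr ⟨(genericPoint_spec S).specializes (Set.mem_univ _), hη⟩
  have hsp : IsIso (S.presheaf.stalkSpecializes hη) :=
    (S.presheaf.stalkCongr hins).isIso_hom
  have hpf : IsIso (S.presheaf.stalkSpecializes hη ≫ ρ.stalkMap (genericPoint Z)) := inferInstance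
  exact ⟨AlgEquiv.ofBijective
    { pullFun p ρ hη with commutes' := pullFun_algebraMap p ρ hη }
    ((ConcreteCategory.isIso_iff_bijective _).mp hpf)⟩

/-! ### Gonality in terms of function fields, and restriction to the fibers. -/

theorem finrank_adjoin_algEquiv {k K L : Type*} [Field k] [Field K] [Field L] [Algebra k K]
    [Algebra k L] (Φ : K ≃ₐ[k] L) (u : K) :
    Module.finrank (IntermediateField.adjoin k {u}) K =
      Module.finrank (IntermediateField.adjoin k {Φ u}) L := by
  have h : (IntermediateField.adjoin k {u}).map (Φ : K →ₐ[k] L) =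
      IntermediateField.adjoin k {Φ u} := by
    rw [IntermediateField.adjoin_map, Set.image_singleton]
    rfl
  refine Algebra.finrank_eq_of_equiv_equiv
    ((IntermediateField.equivMap _ (Φ : K →ₐ[k] L)).trans
      (IntermediateField.equivOfEq h)).toRingEquiv Φ.toRingEquiv ?_
  ext x
  rfl

/-- Surjective morphisms to `ℙ¹` and transcendental functions realize the same degrees, so the
minimum can be taken in the function field. -/
theorem hasGonality_of_finrank_adjoin {X : Scheme.{0}} [IsIntegral X] {p : X ⟶ SpecC}
    [SmoothOfRelativeDimension 1 p] [IsProper p] {n : ℕ} {y : FunField p}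
    (hy : Transcendental ℂ y)
    (hyn : Module.finrank (IntermediateField.adjoin ℂ {y}) (FunField p) = n)
    (hn : ∀ u : FunField p, Transcendental ℂ u →
      n ≤ Module.finrank (IntermediateField.adjoin ℂ {u}) (FunField p)) : HasGonality p n := by
  refine ⟨inferInstance, ?_, ?_⟩
  · obtain ⟨φ, h1, h2, h3⟩ := exists_surjective_of_transcendental p hy
    exact ⟨φ, h1, h2, h3.trans hyn⟩
  · rintro d ⟨φ, h1, h2, rfl⟩
    obtain ⟨u, hu, hd⟩ := exists_transcendental_of_surjective h1
    exact (hn u hu).trans_eq hd.symm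

/-- A cyclic covering of degree `n` of a rational curve is birational to a curve of gonality `n` if
the length of the branch divisor is at least `2 * n`. -/
theorem IsClassicalCyclicCovering.hasGonality {X Z W E : Scheme.{0}} [IsIntegral X] [IsIntegral Z]
    [IsIntegral W] {p : X ⟶ SpecC} {pW : W ⟶ SpecC} {θ : Z ⟶ W} {ρ : Z ⟶ X}
    (hcomp : θ ≫ pW = ρ ≫ p) [SmoothOfRelativeDimension 1 p] [IsProper p]
    [SmoothOfRelativeDimension 1 pW] [IsProper pW] [SmoothOfRelativeDimension 1 (θ ≫ pW)]
    (hρ : IsBirationalMorphism ρ) {L : LineBundle W} {n : ℕ} {s : L.PowerSection n}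
    (h : IsClassicalCyclicCovering θ L n s) (hn : 2 ≤ n) (hg : HasGenus pW 0) (e : E ⟶ W)
    [IsClosedImmersion e] [IsFinite (e ≫ pW)] (he : ∀ i, e.app (L.U i) (s.val i) = 0)
    (hE : 2 * n ≤ Module.finrank ℂ (Sections (e ≫ pW) ⊤)) : HasGonality p n := by
  obtain ⟨x, hx, htop⟩ := hg.exists_adjoin_eq_top
  have hA := h.exists_finrank_adjoin_eq (by omega) hx htop
  have hB := fun u hu => h.le_finrank_adjoin (u := u) hn hx htop e he hE hu
  -- `FunField` depends on the structure morphism, so the two structure morphisms of `Z` are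
  -- identified before passing to `X` along `ρ`.
  rw [hcomp] at hA hB
  obtain ⟨Φ⟩ := exists_algEquiv_funField p ρ hρ
  obtain ⟨y, hy, hyn⟩ := hA
  refine hasGonality_of_finrank_adjoin (y := Φ.symm y) ?_ ?_ fun u hu => ?_
  · exact fun h => hy ((isAlgebraic_algHom_iff Φ.symm.toAlgHom Φ.symm.injective).mp h)
  · rw [← hyn, finrank_adjoin_algEquiv Φ.symm y]
  · rw [finrank_adjoin_algEquiv Φ u]
    exact hB _ fun h => hu ((isAlgebraic_algHom_iff Φ.toAlgHom Φ.injective).mp h)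

theorem ForGeneral.and {B : Scheme.{0}} [IrreducibleSpace B] {pB : B ⟶ SpecC}
    {P Q : ClosedPt pB → Prop} (hP : ForGeneral pB P) (hQ : ForGeneral pB Q) :
    ForGeneral pB fun b => P b ∧ Q b := by
  obtain ⟨U, hU, hP⟩ := hP
  obtain ⟨V, hV, hQ⟩ := hQ
  exact ⟨U ⊓ V, nonempty_preirreducible_inter U.isOpen V.isOpen hU hV, fun b hb =>
    ⟨hP b (hb.trans Set.inter_subset_left), hQ b (hb.trans Set.inter_subset_right)⟩⟩

theorem ForGeneral.mono {B : Scheme.{0}} {pB : B ⟶ SpecC} {P Q : ClosedPt pB → Prop}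
    (hP : ForGeneral pB P) (h : ∀ b, P b → Q b) : ForGeneral pB Q := by
  obtain ⟨U, hU, hP⟩ := hP
  exact ⟨U, hU, fun b hb => h b (hP b hb)⟩

/-- A morphism of schemes over `B` induces a morphism of fibers. -/
theorem exists_isPullback_fiber {A C B T : Scheme.{0}} (ρ : A ⟶ C) (f : C ⟶ B) (g : A ⟶ B)
    (h : ρ ≫ f = g) (b : T ⟶ B) : ∃ ρ' : pullback g b ⟶ pullback f b,
      ρ' ≫ pullback.snd f b = pullback.snd g b ∧
        IsPullback (pullback.fst g b) ρ' ρ (pullback.fst f b) := by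
  subst h
  refine ⟨pullback.lift (pullback.fst _ _ ≫ ρ) (pullback.snd _ _)
    (by rw [Category.assoc, pullback.condition]), pullback.lift_snd _ _ _, ?_⟩
  refine IsPullback.of_bot ?_ (pullback.lift_fst _ _ _).symm (IsPullback.of_hasPullback f b)
  rw [pullback.lift_snd]
  exact IsPullback.of_hasPullback _ _

theorem ClosedPt.isClosedImmersion {B : Scheme.{0}} {pB : B ⟶ SpecC} [IsSeparated pB]
    (b : ClosedPt pB) : IsClosedImmersion b.1 := by
  have : IsClosedImmersion (b.1 ≫ pB) := by
    rw [b.2]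
    infer_instance
  exact .of_comp b.1 pB

/-- Vanishing of the local branch equations on `R̃ ∩ Γ̃` is what bounds the length of this
intersection by the degree of the branch polynomial. -/
theorem PowerSection.app_pullback_snd_eq_zero {Y Y' : Scheme.{0}} (k : Y' ⟶ Y) [IsAffineHom k]
    {L : LineBundle Y} {n : ℕ} {s : L.PowerSection n} {R : Y.IdealSheafData} (h : s.Defines R)
    (i : L.ι) : (pullback.snd R.subschemeι k).app ((L.pullback k).U i) ((s.pullback k).val i) =
      0 := by
  have h1 : R.subschemeι.app (L.U i) (s.val i) = 0 := by
    have := R.ker_subschemeι_app ⟨L.U i, L.isAffineOpen i⟩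
    rw [(h i).2] at this
    exact RingHom.mem_ker.mp (this.ge (Ideal.mem_span_singleton_self _))
  have key : ∀ (f g : pullback R.subschemeι k ⟶ Y) (e : f = g) (V : (pullback R.subschemeι k : Scheme).Opens)
      (hf : V ≤ f ⁻¹ᵁ L.U i) (hg : V ≤ g ⁻¹ᵁ L.U i), f.appLE (L.U i) V hf = g.appLE (L.U i) V hg := by
    rintro f _ rfl V _ _
    rfl
  change (pullback.snd R.subschemeι k).app (k ⁻¹ᵁ L.U i) (k.app (L.U i) (s.val i)) = 0
  have hle : pullback.snd R.subschemeι k ⁻¹ᵁ k ⁻¹ᵁ L.U i ≤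
      pullback.fst R.subschemeι k ⁻¹ᵁ R.subschemeι ⁻¹ᵁ L.U i := by
    rw [← Scheme.Hom.comp_preimage, ← Scheme.Hom.comp_preimage, pullback.condition]
  rw [Scheme.Hom.app_eq_appLE, Scheme.Hom.app_eq_appLE, ← CommRingCat.comp_apply,
    Scheme.Hom.appLE_comp_appLE, key _ _ pullback.condition.symm _ _ hle,
    ← Scheme.Hom.appLE_comp_appLE _ _ _ (R.subschemeι ⁻¹ᵁ L.U i) _ le_rfl hle,
    CommRingCat.comp_apply, ← Scheme.Hom.app_eq_appLE, h1, map_zero]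

/-- The image of a nonempty open set under a fibration contains the general closed points. -/
theorem IsFibration.forGeneral_exists_mem {S B : Scheme.{0}} {pB : B ⟶ SpecC} {f : S ⟶ B}
    (h : IsFibration pB f) {V : S.Opens} (hV : (V : Set S).Nonempty) :
    ForGeneral pB fun b => (pullback.fst f b.1 ⁻¹ᵁ V : Set (fiber f b)).Nonempty := by
  have := h.surface.integral
  have := h.curve.integral
  have := h.surface.projective.isProper
  have := h.curve.projective.isProper
  have : IsLocallyNoetherian B := LocallyOfFiniteType.isLocallyNoetherian pB
  have : IsLocallyNoetherian S := LocallyOfFiniteType.isLocallyNoetherian (f ≫ pB)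
  have : CompactSpace B := QuasiCompact.compactSpace_of_compactSpace pB
  have : CompactSpace S := QuasiCompact.compactSpace_of_compactSpace (f ≫ pB)
  have : IsNoetherian S := {}
  have : LocallyOfFiniteType f := locallyOfFiniteType_of_comp f pB
  have := h.surjective
  obtain ⟨U, hU, hUV⟩ := exists_isOpen_subset_image f V hV
  refine ⟨U, hU, fun b hb => ?_⟩
  obtain ⟨v, hv, hvb⟩ := hUV (hb ⟨default, rfl⟩)
  obtain ⟨y, hy, _⟩ := Scheme.Pullback.exists_preimage_pullback v default hvb
  exact ⟨y, by rw [SetLike.mem_coe, Scheme.Hom.mem_preimage, hy]; exact hv⟩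

/-- The inclusion of a fiber is a closed immersion, hence affine, so the line bundle and its cyclic
covering pull back to the fiber. Since the fiber of `f` meets the open set over which `ρ` is an
isomorphism, the restriction of `ρ` is birational. -/
theorem PrimitiveCyclicCovering.hasGonality_fiber {S B : Scheme.{0}} {pB : B ⟶ SpecC} {f : S ⟶ B}
    {g n : ℕ} (D : PrimitiveCyclicCovering pB f g 0 n) (b : ClosedPt pB)
    (hS : IsSmoothProjectiveVariety 1 (fiberToSpecC f b))
    (hW : IsSmoothProjectiveVariety 1 (fiberToSpecC D.φ b))
    (hW0 : HasGenus (fiberToSpecC D.φ b) 0)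
    (hZ : IsSmoothProjectiveVariety 1 (fiberToSpecC (D.θ ≫ D.φ) b))
    (hE : IsFinite (pullback.snd D.R.subschemeι (pullback.fst D.φ b.1) ≫ fiberToSpecC D.φ b))
    (hEn : 2 * n ≤ Module.finrank ℂ
      (Sections (pullback.snd D.R.subschemeι (pullback.fst D.φ b.1) ≫ fiberToSpecC D.φ b) ⊤))
    {V : S.Opens} (hV : IsIso (D.ρ ∣_ V))
    (hVb : (pullback.fst f b.1 ⁻¹ᵁ V : Set (fiber f b)).Nonempty) :
    HasGonality (fiberToSpecC f b) n := by
  have := D.isFibration.curve.projective.isProper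
  have := b.isClosedImmersion
  have := hS.integral
  have := hS.smooth
  have := hS.projective.isProper
  have := hW.integral
  have := hW.smooth
  have := hW.projective.isProper
  have := hZ.integral
  obtain ⟨θ', hθ', sqθ⟩ := exists_isPullback_fiber D.θ D.φ (D.θ ≫ D.φ) rfl b.1
  obtain ⟨ρ', hρ', sqρ⟩ := exists_isPullback_fiber D.ρ f (D.θ ≫ D.φ) D.ρ_comp b.1
  have hsm : SmoothOfRelativeDimension 1 (θ' ≫ fiberToSpecC D.φ b) := by
    rw [hθ']
    exact hZ.smooth
  have hcyc := D.isCyclic.baseChange sqθ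
  have hbir : IsBirationalMorphism ρ' :=
    ⟨_, hVb, isIso_morphismRestrict_of_isPullback sqρ V⟩
  have he := PowerSection.app_pullback_snd_eq_zero (pullback.fst D.φ b.1) D.defines
  have hcl : IsClosedImmersion (pullback.snd D.R.subschemeι (pullback.fst D.φ b.1)) :=
    inferInstance
  generalize pullback.snd D.R.subschemeι (pullback.fst D.φ b.1) = e at hE hEn he hcl
  exact hcyc.hasGonality (hθ'.trans hρ'.symm) hbir D.two_le_n hW0 e he hEn

end CyclicFibration

end

theorem lemma3p4 {S B : AlgebraicGeometry.Scheme.{0}} (pB : B ⟶ CyclicFibration.SpecC) (f : S ⟶ B)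
    (g n r : ℕ) (D : CyclicFibration.PrimitiveCyclicCovering pB f g 0 n)
    (hr : D.HasBranchNumber r) (h2n : 2 * n ≤ r) :
    CyclicFibration.ForGeneral pB fun b =>
      CyclicFibration.IsSmoothProjectiveVariety 1 (CyclicFibration.fiberToSpecC f b) ∧
        CyclicFibration.HasGonality (CyclicFibration.fiberToSpecC f b) n := by
  have := D.isFibration.curve.integral
  obtain ⟨V, hV, hiso⟩ := D.birational_ρ
  -- `B` is irreducible, so finitely many conditions on a general point hold simultaneously.
  refine ((((D.isFibration.genus.and D.isFibration_φ.genus).and D.isFibration_Z.genus).and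
    hr).and (D.isFibration.forGeneral_exists_mem hV)).mono fun b hb => ?_
  obtain ⟨⟨⟨⟨hS, hW⟩, hZ⟩, hE⟩, hVb⟩ := hb
  exact ⟨hS.1, D.hasGonality_fiber b hS.1 hW.1 hW.2 hZ.1 hE.1 (h2n.trans_eq hE.2.symm) hiso hVb⟩
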